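/- For $\nu\in\mathbb{C}$ let $P_\nu$ be the Legendre function of the first kind, i.e. the holomorphic function on $\mathbb{C}\setminus(-\infty,-1]$ with $P_\nu(z)={}_2F_1(-\nu,\nu+1;1;\tfrac{1-z}{2})$ for $|z-1|<2$. Let $Q_\nu$ be the Legendre function of the second kind, $$Q_\nu(z)=\frac{\pi}{2}\,\frac{e^{\mp i\pi\nu}P_\nu(z)-P_\nu(-z)}{\sin(\pi\nu)}\qquad(\operatorname{Im}z\gtrless0),$$ extended to $\nu\in\mathbb{N}_0=\{0,1,2,\dots\}$ by its limit in $\nu$, to $z\in(1,\infty)$ by continuity in $z$, and to $z\in(-\infty,-1)$ (where $Q_\nu$ has a branch cut for general $\nu$) by its boundary value from the upper half-plane. Let $\ln$ be the principal logarithm, with argument in $(-\pi,\pi]$; let $\operatorname{Li}_2(z)=-\int_0^z\frac{\ln(1-t)}{t}\,dt$, integrated along the segment from $0$ to $z$; let $P_n$ ($n\in\mathbb{N}_0$) be the Legendre polynomials, $\psi=\Gamma'/\Gamma$ and $\psi_1=\psi'$. For $n\in\mathbb{N}_0$ put $$B_n(z)=4[\psi(2n+1)-\psi(n+1)]P_n(z)+4\sum_{k=0}^{n-1}\frac{2k+1}{(n-k)(n+k+1)}P_k(z)$$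 and $$\begin{aligned}C_n(z)={}&\Big\{-\frac{\pi^2}{3}+4[\psi(2n+1)-\psi(n+1)]^2+4\psi_1(2n+1)-2\psi_1(n+1)\Big\}P_n(z)\\&+4\sum_{k=0}^{n-1}(-1)^{n+k}\frac{2k+1}{(n-k)(n+k+1)}\Big\{2\Big[\psi(n+k+1)-\psi(n-k+1)-\psi\big(\lfloor\tfrac{n+k}{2}\rfloor+1\big)+\psi\big(\lfloor\tfrac{n-k}{2}\rfloor+1\big)\Big]\\&\qquad-(-1)^{n+k}\frac{2k+1}{(n-k)(n+k+1)}-\frac{2n+1}{(n-k)(n+k+1)}\Big\}P_k(z).\end{aligned}$$ Then for every $n\in\mathbb{N}_0$ and every $z\in\mathbb{C}\setminus[-1,1]$ the function $\nu\mapsto Q_\nu(z)$ is complex differentiable at $\nu=n$, and $$\begin{aligned}\frac{\partial Q_\nu(z)}{\partial\nu}\bigg|_{\nu=n}={}&-P_n(z)\operatorname{Li}_2\frac{1-z}{2}-\frac12P_n(z)\ln\frac{z+1}{2}\ln\frac{z-1}{2}+\frac14B_n(z)\ln\frac{z+1}{2}-\frac{(-1)^n}{4}B_n(-z)\ln\frac{z-1}{2}\\&-\frac{\pi^2}{6}P_n(z)+\frac14C_n(z)-\frac{(-1)^n}{4}C_n(-z).\end{aligned}$$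 -/

import Mathlib

open Filter Topology

noncomputable section

namespace LegendreDegree

/-- The complex plane cut along the real half-line from `-1` to `-∞`. -/
def cutPlane : Set ℂ := {z | z + 1 ∈ Complex.slitPlane}

/-- `f` is holomorphic on the plane cut along `(-∞, -1]`, and on the disk `|z - 1| < 2` it is the
sum of the hypergeometric series `₂F₁(-ν, ν + 1; 1; (1 - z) / 2)`. By the identity theorem at most
one such `f` exists, as a function on the cut plane. -/
def IsLegendreContinuation (ν : ℂ) (f : ℂ → ℂ) : Prop :=
  DifferentiableOn ℂ f cutPlane ∧
    ∀ z ∈ Metric.ball (1 : ℂ) 2, f z = ₂F₁ (-ν) (ν + 1) (1 : ℂ) ((1 - z) / 2)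

/-- The Legendre function of the first kind `P_ν(z) = ₂F₁(-ν, ν + 1; 1; (1 - z) / 2)`, where
`₂F₁` is continued analytically to `z ∈ ℂ ∖ (-∞, -1]`. Its values on the cut are never used. -/
def legendreP (ν : ℂ) : ℂ → ℂ := Classical.epsilon (IsLegendreContinuation ν)

/-- The quotient
`(π / 2) (exp(∓iπν) P_ν(z) - P_ν(-z)) / sin(πν)`, with the upper sign for `Im z > 0` and the lower
sign for `Im z < 0`. -/
def legendreQuotient (ν z : ℂ) : ℂ :=
  (Real.pi / 2 : ℂ) *
    ((if 0 < z.im then Complex.exp (-(Complex.I * Real.pi * ν))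
      else Complex.exp (Complex.I * Real.pi * ν)) * legendreP ν z - legendreP ν (-z)) /
    Complex.sin (Real.pi * ν)

/-- The Legendre function of the second kind off the real axis: the quotient above, continued
to the integers `ν` by its limit (the singularity is removable at `ν = 0, 1, 2, …`). -/
def legendreQOffReal (ν z : ℂ) : ℂ :=
  if Complex.sin (Real.pi * ν) = 0 then limUnder (𝓝[≠] ν) (fun μ => legendreQuotient μ z)
  else legendreQuotient ν z

/-- The Legendre function of the second kind `Q_ν(z)` for `z ∈ ℂ ∖ [-1, 1]`. On `(1, ∞)` it is
the continuous extension from both half-planes. On the branch cut `(-∞, -1)` it is the boundary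
value from the upper half-plane, as for the principal logarithm, whose argument lies in
`(-π, π]`. -/
def legendreQ (ν z : ℂ) : ℂ :=
  if z.im ≠ 0 then legendreQOffReal ν z
  else if 1 < z.re then limUnder (𝓝[{w : ℂ | w.im ≠ 0}] z) (fun w => legendreQOffReal ν w)
  else limUnder (𝓝[{w : ℂ | 0 < w.im}] z) (fun w => legendreQOffReal ν w)

/-- The Legendre polynomial `P_n`, by Rodrigues' formula. -/
def legendrePoly (n : ℕ) : Polynomial ℂ :=
  Polynomial.C ((1 : ℂ) / (2 ^ n * n.factorial)) *
    Polynomial.derivative^[n] ((Polynomial.X ^ 2 - 1) ^ n)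

/-- The value `P_n(z)` of the Legendre polynomial. -/
def legP (n : ℕ) (z : ℂ) : ℂ := (legendrePoly n).eval z

/-- The dilogarithm `Li₂ z = -∫_0^z ln(1 - t) / t dt`, integrated along the segment from `0` to
`z`, with the principal logarithm. -/
def dilog (z : ℂ) : ℂ := -∫ t in (0 : ℝ)..1, Complex.log (1 - t * z) / t

/-- The digamma function at a natural number. -/
def psi (m : ℕ) : ℂ := Complex.digamma m

/-- The trigamma function, the derivative of the digamma function, at a natural number. -/
def psi₁ (m : ℕ) : ℂ := deriv Complex.digamma m

/-- `(2k + 1) / ((n - k) (n + k + 1))`. -/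
def coeffA (n k : ℕ) : ℂ := (2 * k + 1) / (((n : ℂ) - k) * (n + k + 1))

/-- `(2n + 1) / ((n - k) (n + k + 1))`. -/
def coeffD (n k : ℕ) : ℂ := (2 * n + 1) / (((n : ℂ) - k) * (n + k + 1))

/-- The polynomial function `B_n`. -/
def polyB (n : ℕ) (z : ℂ) : ℂ :=
  4 * (psi (2 * n + 1) - psi (n + 1)) * legP n z
    + 4 * ∑ k ∈ Finset.range n, coeffA n k * legP k z

/-- The polynomial function `C_n`. The integer parts `⌊(n ± k) / 2⌋` are natural-number divisions,
and `k < n` in the sum, so `n - k` is not truncated. -/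
def polyC (n : ℕ) (z : ℂ) : ℂ :=
  (-(Real.pi : ℂ) ^ 2 / 3 + 4 * (psi (2 * n + 1) - psi (n + 1)) ^ 2
      + 4 * psi₁ (2 * n + 1) - 2 * psi₁ (n + 1)) * legP n z
    + 4 * ∑ k ∈ Finset.range n, (-1) ^ (n + k) * coeffA n k *
        (2 * (psi (n + k + 1) - psi (n - k + 1)
              - psi ((n + k) / 2 + 1) + psi ((n - k) / 2 + 1))
          - (-1) ^ (n + k) * coeffA n k - coeffD n k) * legP k z

end LegendreDegree

end

/-!
With `lam = ν (ν + 1)`, the function `P_ν` is the solution of Legendre's equation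
`((1 - z²) f')' = -lam f` on the cut plane that is regular at `z = 1` with value `1` there. Dividing
twice by the vanishing factor `z - 1` and integrating along segments from `1` turns this problem into
the Volterra equation `f = 1 + lam * volterra f`, whose Neumann series converges for every `lam` and
every `z` in the star-shaped cut plane. The sum `legendreFn lam z` is entire in `lam`, holomorphic in
`z`, and agrees with the hypergeometric series near `1` (`legendreP_eq`). A second series, `logFn`,
gives the solution `legendreFn lam z * log ((1 - z) / 2) + logFn lam z`.

*First and second degree derivatives of `P_ν`.* The derivatives of the Volterra equation with
respect to `ν` characterise `∂P_ν/∂ν` and `∂²P_ν/∂ν²` at `ν = n`. The functions `legendreDot` and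
`legendreDdot`, built from `P_n`, a logarithm, a dilogarithm and combinations of Legendre
polynomials, solve these equations (`legendreFn₁_natCast`, `legendreFn₂_natCast`). For the
polynomial parts, this is a comparison of Legendre coefficients, in which the digamma values
collapse to alternating harmonic numbers.

*Off the real axis.* The numerator `N(ν)` of `Q_ν(z)` vanishes at `ν = n`, so the derivative of the
continued quotient is `(-1)ⁿ N''(n) / 4` (`hasDerivAt_limUnder_div_sin`). It is expressed through
`legendreDot` and `legendreDdot` at `z` and `-z`, and Euler's reflection formula for `Li₂`
(`dilog_reflection`) brings it to the stated form (`hasDerivAt_legendreQOffReal`).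

*On the real axis.* There `Q_ν` is a limit in `z`, which has to be exchanged with the derivative in
`ν`. The connection formula (`exists_connection`) expresses `P_ν(-z)` through the two solutions at
`z = 1`. It follows that near `ν = n` both half-planes share the representation
`Q_ν = K(ν) P_ν - (P_ν log ((z - 1) / 2) + logFn) / 2` with `K` differentiable at `n`
(`exists_legendreQOffReal_eq`), which is visibly continuous across `(1, ∞)` together with its degree
derivative. The closed formula is continuous there as well, so that both agree on `(1, ∞)`. On the
cut `(-∞, -1)` the relation `Q_ν(z) = -exp (-iπν) Q_ν(-z)` for `Im z > 0` reduces the matter to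
`(1, ∞)`.

The sine in the connection formula comes from the behaviour of `P_ν` at the singular point `-1`,
where the coefficients of the hypergeometric series are asymptotically those of a logarithm with the
factor given by Euler's sine product, and Abel's limit theorem applies.
-/

namespace LegendreDegree

/-! ### Averages along segments issuing from `1` and the Volterra operator -/

/-- The mean value of `f` along the segment from `1` to `z`; `(z - 1) * avg f z` is the primitive
of `f` that vanishes at `1`. -/
noncomputable def avg (f : ℂ → ℂ) (z : ℂ) : ℂ := ∫ t in (0 : ℝ)..1, f (1 + t * (z - 1))

/-- The right inverse of `f ↦ -((1 - z²) f')'` whose values vanish at `1`. Two averages are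
taken so that the singular point `1` does not appear as a zero of a denominator. -/
noncomputable def volterra (f : ℂ → ℂ) (z : ℂ) : ℂ :=
  (z - 1) * avg (fun w => avg f w / (w + 1)) z

lemma isOpen_cutPlane : IsOpen cutPlane :=
  Complex.isOpen_slitPlane.preimage (continuous_id.add continuous_const)

lemma one_mem_cutPlane : (1 : ℂ) ∈ cutPlane := by
  simp only [cutPlane, Set.mem_ofPred_eq]
  left; norm_num

lemma add_one_ne_zero_of_mem {z : ℂ} (hz : z ∈ cutPlane) : z + 1 ≠ 0 :=
  Complex.slitPlane_ne_zero hz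

lemma segment_mem {U : Set ℂ} (hs : StarConvex ℝ 1 U) {z : ℂ} (hz : z ∈ U) {t : ℝ}
    (ht : t ∈ Set.Icc (0 : ℝ) 1) : (1 : ℂ) + t * (z - 1) ∈ U := by
  have := hs.add_smul_sub_mem hz ht.1 ht.2
  rwa [Complex.real_smul] at this

lemma starConvex_of_segment_mem {U : Set ℂ}
    (h : ∀ z ∈ U, ∀ t ∈ Set.Icc (0 : ℝ) 1, (1 : ℂ) + t * (z - 1) ∈ U) : StarConvex ℝ 1 U := by
  intro z hz a b ha hb hab
  have := h z hz b ⟨hb, by linarith⟩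
  convert this using 1
  have ha' : a = 1 - b := by linarith
  subst ha'
  simp only [Complex.real_smul]; push_cast; ring

lemma starConvex_cutPlane : StarConvex ℝ 1 cutPlane := by
  refine starConvex_of_segment_mem fun z hz t ht => ?_
  have h2 : StarConvex ℝ ((2 : ℝ) : ℂ) Complex.slitPlane :=
    Complex.starConvex_ofReal_slitPlane (by norm_num)
  have := h2.add_smul_sub_mem hz ht.1 ht.2
  simp only [cutPlane, Set.mem_ofPred_eq]
  convert this using 1
  rw [Complex.real_smul]; push_cast; ring

/-- The union of the segments from `1` to the points of `K`. -/
def starHull (K : Set ℂ) : Set ℂ :=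
  (fun p : ℝ × ℂ => (1 : ℂ) + p.1 * (p.2 - 1)) '' (Set.Icc 0 1 ×ˢ K)

lemma subset_starHull (K : Set ℂ) : K ⊆ starHull K := fun z hz =>
  ⟨(1, z), ⟨⟨zero_le_one, le_rfl⟩, hz⟩, by simp⟩

lemma isCompact_starHull {K : Set ℂ} (hK : IsCompact K) : IsCompact (starHull K) :=
  (isCompact_Icc.prod hK).image (by fun_prop)

lemma starHull_subset {U K : Set ℂ} (hs : StarConvex ℝ 1 U) (h : K ⊆ U) : starHull K ⊆ U := by
  rintro _ ⟨⟨t, z⟩, ⟨ht, hz⟩, rfl⟩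
  exact segment_mem hs (h hz) ht

lemma starConvex_starHull (K : Set ℂ) : StarConvex ℝ 1 (starHull K) := by
  refine starConvex_of_segment_mem ?_
  rintro _ ⟨⟨s, z⟩, ⟨hs, hz⟩, rfl⟩ t ht
  refine ⟨(t * s, z), ⟨⟨mul_nonneg ht.1 hs.1, mul_le_one₀ ht.2 hs.1 hs.2⟩, hz⟩, ?_⟩
  simp only; push_cast; ring

lemma continuousOn_segment {U : Set ℂ} (hs : StarConvex ℝ 1 U) {f : ℂ → ℂ}
    (hf : ContinuousOn f U) {z : ℂ} (hz : z ∈ U) :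
    ContinuousOn (fun t : ℝ => f (1 + t * (z - 1))) (Set.Icc 0 1) :=
  hf.comp (by fun_prop) fun _ ht => segment_mem hs hz ht

lemma intervalIntegrable_segment {U : Set ℂ} (hs : StarConvex ℝ 1 U) {f : ℂ → ℂ}
    (hf : ContinuousOn f U) {z : ℂ} (hz : z ∈ U) :
    IntervalIntegrable (fun t : ℝ => f (1 + t * (z - 1))) MeasureTheory.volume 0 1 :=
  ContinuousOn.intervalIntegrable (by
    rw [Set.uIcc_of_le zero_le_one]; exact continuousOn_segment hs hf hz)

section Holomorphic

variable {U : Set ℂ} {f : ℂ → ℂ} {z : ℂ}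

lemma avg_congr {g : ℂ → ℂ} (hs : StarConvex ℝ 1 U) (h : Set.EqOn f g U) (hz : z ∈ U) :
    avg f z = avg g z := by
  refine intervalIntegral.integral_congr fun t ht => ?_
  rw [Set.uIcc_of_le zero_le_one] at ht
  exact h (segment_mem hs hz ht)

lemma volterra_congr {g : ℂ → ℂ} (hs : StarConvex ℝ 1 U) (h : Set.EqOn f g U) (hz : z ∈ U) :
    volterra f z = volterra g z := by
  unfold volterra
  rw [avg_congr hs (fun w hw => ?_) hz]
  simp only [avg_congr hs h hw]

lemma hasDerivAt_avg (hU : IsOpen U) (hs : StarConvex ℝ 1 U) (hf : DifferentiableOn ℂ f U)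
    (hz : z ∈ U) :
    HasDerivAt (avg f) (∫ t in (0 : ℝ)..1, t * deriv f (1 + t * (z - 1))) z := by
  obtain ⟨δ, hδ, hball⟩ := Metric.nhds_basis_closedBall.mem_iff.1 (hU.mem_nhds hz)
  have hc : ContinuousOn (deriv f) U := (hf.deriv hU).continuousOn
  have hKU := starHull_subset hs hball
  obtain ⟨B, hB⟩ := (isCompact_starHull (isCompact_closedBall z δ)).exists_bound_of_continuousOn
    (hc.mono hKU)
  have hint : ∀ g : ℂ → ℂ, ContinuousOn g U → ∀ x ∈ U,
      MeasureTheory.AEStronglyMeasurable (fun t : ℝ => g (1 + t * (x - 1)))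
        (MeasureTheory.volume.restrict (Set.uIoc 0 1)) := by
    intro g hg x hx
    have := (intervalIntegrable_segment hs hg hx).aestronglyMeasurable
    rwa [Set.uIoc_of_le zero_le_one]
  refine (intervalIntegral.hasDerivAt_integral_of_dominated_loc_of_deriv_le
    (F := fun x (t : ℝ) => f (1 + t * (x - 1)))
    (F' := fun x (t : ℝ) => t * deriv f (1 + t * (x - 1))) (bound := fun _ => B)
    (Metric.ball_mem_nhds z hδ) ?_ (intervalIntegrable_segment hs hf.continuousOn hz) ?_ ?_
    intervalIntegrable_const ?_).2
  · filter_upwards [hU.mem_nhds hz] with x hx using hint f hf.continuousOn x hx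
  · exact (Complex.continuous_ofReal.aestronglyMeasurable).mul (hint _ hc z hz)
  · refine Eventually.of_forall fun t ht x hx => ?_
    rw [Set.uIoc_of_le zero_le_one] at ht
    have h1 : ‖deriv f (1 + t * (x - 1))‖ ≤ B :=
      hB _ ⟨(t, x), ⟨⟨ht.1.le, ht.2⟩, Metric.ball_subset_closedBall hx⟩, rfl⟩
    rw [norm_mul, Complex.norm_real, Real.norm_of_nonneg ht.1.le]
    nlinarith [norm_nonneg (deriv f (1 + t * (x - 1))), ht.2, ht.1]
  · refine Eventually.of_forall fun t ht x hx => ?_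
    rw [Set.uIoc_of_le zero_le_one] at ht
    have h1 := (hf.differentiableAt (hU.mem_nhds (segment_mem hs
      (hball (Metric.ball_subset_closedBall hx)) ⟨ht.1.le, ht.2⟩))).hasDerivAt
    have h2 : HasDerivAt (fun x : ℂ => (1 : ℂ) + t * (x - 1)) t x := by
      simpa using (((hasDerivAt_id x).sub_const 1).const_mul (t : ℂ)).const_add 1
    exact (h1.comp x h2).congr_deriv (mul_comm _ _)

lemma differentiableOn_avg (hU : IsOpen U) (hs : StarConvex ℝ 1 U)
    (hf : DifferentiableOn ℂ f U) : DifferentiableOn ℂ (avg f) U := fun _ hz =>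
  (hasDerivAt_avg hU hs hf hz).differentiableAt.differentiableWithinAt

lemma hasDerivAt_mul_avg (hU : IsOpen U) (hs : StarConvex ℝ 1 U) (hf : DifferentiableOn ℂ f U)
    (hz : z ∈ U) : HasDerivAt (fun z => (z - 1) * avg f z) (f z) z := by
  have hc : ContinuousOn (deriv f) U := (hf.deriv hU).continuousOn
  have h := ((hasDerivAt_id z).sub_const 1).mul (hasDerivAt_avg hU hs hf hz)
  refine h.congr_deriv ?_
  have hd : ∀ t ∈ Set.uIcc (0 : ℝ) 1,
      HasDerivAt (fun t : ℝ => (t : ℂ) * f (1 + t * (z - 1)))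
        (f (1 + t * (z - 1)) + (z - 1) * (t * deriv f (1 + t * (z - 1)))) t := by
    intro t ht
    rw [Set.uIcc_of_le zero_le_one] at ht
    have h1 := (hf.differentiableAt (hU.mem_nhds (segment_mem hs hz ht))).hasDerivAt
    have h2 : HasDerivAt (fun t : ℝ => (1 : ℂ) + t * (z - 1)) (z - 1) t := by
      simpa using ((Complex.ofRealCLM.hasDerivAt (x := t)).mul_const (z - 1)).const_add 1
    have h3 : HasDerivAt (fun t : ℝ => (t : ℂ)) 1 t := Complex.ofRealCLM.hasDerivAt (x := t)
    refine (h3.mul (h1.comp t h2)).congr_deriv ?_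
    simp; ring
  have i1 := intervalIntegrable_segment hs hf.continuousOn hz
  have i2 : IntervalIntegrable (fun t : ℝ => (t : ℂ) * deriv f (1 + t * (z - 1)))
      MeasureTheory.volume 0 1 := ContinuousOn.intervalIntegrable (by
    rw [Set.uIcc_of_le zero_le_one]
    exact Complex.continuous_ofReal.continuousOn.mul (continuousOn_segment hs hc hz))
  have := intervalIntegral.integral_eq_sub_of_hasDerivAt hd (i1.add (i2.const_mul _))
  rw [intervalIntegral.integral_add i1 (i2.const_mul _),
    intervalIntegral.integral_const_mul] at this
  simpa [avg] using this

lemma differentiableOn_avg_div (hU : IsOpen U) (hs : StarConvex ℝ 1 U) (hc : U ⊆ cutPlane)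
    (hf : DifferentiableOn ℂ f U) : DifferentiableOn ℂ (fun w => avg f w / (w + 1)) U :=
  (differentiableOn_avg hU hs hf).div (by fun_prop) fun _ hw => add_one_ne_zero_of_mem (hc hw)

lemma hasDerivAt_volterra (hU : IsOpen U) (hs : StarConvex ℝ 1 U) (hc : U ⊆ cutPlane)
    (hf : DifferentiableOn ℂ f U) (hz : z ∈ U) :
    HasDerivAt (volterra f) (avg f z / (z + 1)) z :=
  hasDerivAt_mul_avg hU hs (differentiableOn_avg_div hU hs hc hf) hz

lemma differentiableOn_volterra (hU : IsOpen U) (hs : StarConvex ℝ 1 U) (hc : U ⊆ cutPlane)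
    (hf : DifferentiableOn ℂ f U) : DifferentiableOn ℂ (volterra f) U := fun _ hz =>
  (hasDerivAt_volterra hU hs hc hf hz).differentiableAt.differentiableWithinAt

lemma volterra_one (f : ℂ → ℂ) : volterra f 1 = 0 := by simp [volterra]

lemma avg_const_mul (c : ℂ) (f : ℂ → ℂ) (z : ℂ) : avg (fun w => c * f w) z = c * avg f z :=
  intervalIntegral.integral_const_mul _ _

lemma avg_add {g : ℂ → ℂ} (hs : StarConvex ℝ 1 U) (hf : ContinuousOn f U)
    (hg : ContinuousOn g U) (hz : z ∈ U) : avg (fun w => f w + g w) z = avg f z + avg g z :=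
  intervalIntegral.integral_add (intervalIntegrable_segment hs hf hz)
    (intervalIntegrable_segment hs hg hz)

lemma volterra_const_mul (c : ℂ) (f : ℂ → ℂ) (z : ℂ) :
    volterra (fun w => c * f w) z = c * volterra f z := by
  simp only [volterra, avg_const_mul, mul_div_assoc]
  ring

lemma volterra_add {g : ℂ → ℂ} (hU : IsOpen U) (hs : StarConvex ℝ 1 U) (hc : U ⊆ cutPlane)
    (hf : DifferentiableOn ℂ f U) (hg : DifferentiableOn ℂ g U) (hz : z ∈ U) :
    volterra (fun w => f w + g w) z = volterra f z + volterra g z := by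
  unfold volterra
  rw [avg_congr (g := fun w => avg f w / (w + 1) + avg g w / (w + 1)) hs (fun w hw => ?_) hz,
    avg_add hs (differentiableOn_avg_div hU hs hc hf).continuousOn
      (differentiableOn_avg_div hU hs hc hg).continuousOn hz, mul_add]
  simp only [avg_add hs hf.continuousOn hg.continuousOn hw, add_div]

end Holomorphic

/-! ### Norm bounds and uniqueness for the Volterra equation -/

section Bounds

variable {K : Set ℂ} {f : ℂ → ℂ}

lemma norm_avg_le {m : ℝ} {k : ℕ} (hs : StarConvex ℝ 1 K)
    (hf : ∀ z ∈ K, ‖f z‖ ≤ m * ‖z - 1‖ ^ k) {z : ℂ} (hz : z ∈ K) :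
    ‖avg f z‖ ≤ m * ‖z - 1‖ ^ k / (k + 1) := by
  have hi : ∫ t in (0 : ℝ)..1, m * ‖z - 1‖ ^ k * t ^ k = m * ‖z - 1‖ ^ k / (k + 1) := by
    rw [intervalIntegral.integral_const_mul, integral_pow]
    simp; ring
  rw [← hi]
  refine intervalIntegral.norm_integral_le_of_norm_le zero_le_one
    (Eventually.of_forall fun t ht => ?_) (Continuous.intervalIntegrable (by fun_prop) _ _)
  refine (hf _ (segment_mem hs hz ⟨ht.1.le, ht.2⟩)).trans_eq ?_
  rw [add_sub_cancel_left, norm_mul, Complex.norm_real, Real.norm_of_nonneg ht.1.le, mul_pow]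
  ring

/-- The outer average of a function bounded by a multiple of `‖z - 1‖ ^ k` gains the factor
`1 / (k + 1)`, so that iterates of `volterra` decay factorially. -/
lemma norm_volterra_le {m M : ℝ} {k : ℕ} (hs : StarConvex ℝ 1 K) (hm : 0 ≤ m)
    (hM : ∀ z ∈ K, ‖(z + 1)⁻¹‖ ≤ M)
    (hf : ∀ z ∈ K, ‖f z‖ ≤ m * ‖z - 1‖ ^ k) {z : ℂ} (hz : z ∈ K) :
    ‖volterra f z‖ ≤ m * M * ‖z - 1‖ ^ (k + 1) / (k + 1) := by
  have hM0 : 0 ≤ M := (norm_nonneg _).trans (hM z hz)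
  have h1 : ∀ w ∈ K, ‖avg f w / (w + 1)‖ ≤ m * M * ‖w - 1‖ ^ k := by
    intro w hw
    rw [div_eq_mul_inv, norm_mul]
    have h2 := norm_avg_le hs hf hw
    have h3 : m * ‖w - 1‖ ^ k / (k + 1) ≤ m * ‖w - 1‖ ^ k :=
      div_le_self (by positivity) (by linarith [(Nat.cast_nonneg k : (0 : ℝ) ≤ k)])
    calc _ ≤ (m * ‖w - 1‖ ^ k) * M :=
          mul_le_mul (h2.trans h3) (hM w hw) (norm_nonneg _) (by positivity)
      _ = _ := by ring
  rw [volterra, norm_mul]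
  calc _ ≤ ‖z - 1‖ * (m * M * ‖z - 1‖ ^ k / (k + 1)) := by
        gcongr; exact norm_avg_le hs h1 hz
    _ = _ := by ring

/-- By induction, `f` is bounded by every term of an exponential series, and these tend to zero. -/
lemma eq_zero_of_eq_volterra {m M : ℝ} {lam : ℂ} (hs : StarConvex ℝ 1 K)
    (hM : ∀ z ∈ K, ‖(z + 1)⁻¹‖ ≤ M) (hm : ∀ z ∈ K, ‖f z‖ ≤ m)
    (h : ∀ z ∈ K, f z = lam * volterra f z) {z : ℂ} (hz : z ∈ K) : f z = 0 := by
  have hm0 : 0 ≤ m := (norm_nonneg _).trans (hm z hz)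
  have hM0 : 0 ≤ M := (norm_nonneg _).trans (hM z hz)
  have key : ∀ k : ℕ, ∀ z ∈ K, ‖f z‖ ≤ m * (‖lam‖ * M) ^ k / k.factorial * ‖z - 1‖ ^ k := by
    intro k
    induction k with
    | zero => intro z hz; simpa using hm z hz
    | succ k ih =>
      intro z hz
      rw [h z hz, norm_mul]
      refine (mul_le_mul_of_nonneg_left (norm_volterra_le hs (by positivity) hM ih hz)
        (norm_nonneg _)).trans_eq ?_
      rw [Nat.factorial_succ]; push_cast
      field_simp
      ring
  have hlim : Tendsto (fun k : ℕ => m * ((‖lam‖ * M * ‖z - 1‖) ^ k / k.factorial)) atTop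
      (𝓝 (m * 0)) := (FloorSemiring.tendsto_pow_div_factorial_atTop _).const_mul m
  have : ‖f z‖ ≤ m * 0 := ge_of_tendsto' hlim fun k => (key k z hz).trans_eq (by
    rw [mul_pow _ (‖z - 1‖)]; ring)
  simpa using this

end Bounds

lemma exists_norm_inv_add_one_le {K : Set ℂ} (hK : IsCompact K) (h : K ⊆ cutPlane) :
    ∃ M, ∀ z ∈ K, ‖(z + 1)⁻¹‖ ≤ M :=
  hK.exists_bound_of_continuousOn
    (ContinuousOn.inv₀ (by fun_prop) fun _ hz => add_one_ne_zero_of_mem (h hz))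

/-- A solution of the Volterra equation `f = c + volterra (lam * f + h)` is unique. -/
lemma volterra_unique {U : Set ℂ} (hU : IsOpen U) (hs : StarConvex ℝ 1 U) (hc : U ⊆ cutPlane)
    {f g h : ℂ → ℂ} {c lam : ℂ} (hf : DifferentiableOn ℂ f U) (hg : DifferentiableOn ℂ g U)
    (hh : DifferentiableOn ℂ h U)
    (ef : ∀ z ∈ U, f z = c + volterra (fun w => lam * f w + h w) z)
    (eg : ∀ z ∈ U, g z = c + volterra (fun w => lam * g w + h w) z) : Set.EqOn f g U := by
  intro z hz
  have hK : starHull {z} ⊆ U := starHull_subset hs (by simpa using hz)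
  have hcK := isCompact_starHull (isCompact_singleton (x := z))
  obtain ⟨M, hM⟩ := exists_norm_inv_add_one_le hcK (hK.trans hc)
  obtain ⟨m, hm⟩ := hcK.exists_bound_of_continuousOn ((hf.sub hg).continuousOn.mono hK)
  have key : ∀ w ∈ U, f w - g w = lam * volterra (fun w => f w - g w) w := by
    intro w hw
    have h1 : volterra (fun w => lam * f w + h w) w =
        lam * volterra f w + volterra h w := by
      rw [volterra_add hU hs hc (hf.const_mul lam) hh hw, volterra_const_mul]
    have h2 : volterra (fun w => lam * g w + h w) w =
        lam * volterra g w + volterra h w := by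
      rw [volterra_add hU hs hc (hg.const_mul lam) hh hw, volterra_const_mul]
    have h3 : volterra (fun w => f w - g w) w = volterra f w - volterra g w := by
      have := volterra_add hU hs hc hf (hg.const_mul (-1)) hw
      rw [volterra_const_mul] at this
      simp only [neg_one_mul, ← sub_eq_add_neg] at this
      exact this
    rw [ef w hw, eg w hw, h1, h2, h3]; ring
  have := eq_zero_of_eq_volterra (f := fun w => f w - g w) (starConvex_starHull {z}) hM hm
    (fun w hw => key w (hK hw)) (subset_starHull {z} rfl)
  exact sub_eq_zero.1 this

lemma eqOn_of_hasDerivAt_eq {U : Set ℂ} (hU : IsOpen U) {a : ℂ} (hs : StarConvex ℝ a U)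
    {f g d : ℂ → ℂ}
    (hf : ∀ z ∈ U, HasDerivAt f (d z) z) (hg : ∀ z ∈ U, HasDerivAt g (d z) z)
    (ha : a ∈ U) (h : f a = g a) : Set.EqOn f g U := by
  have hp : IsPreconnected U := (hs.isPathConnected ha).isConnected.isPreconnected
  refine hU.eqOn_of_deriv_eq hp (fun z hz => (hf z hz).differentiableAt.differentiableWithinAt)
    (fun z hz => (hg z hz).differentiableAt.differentiableWithinAt)
    (fun z hz => (hf z hz).deriv.trans (hg z hz).deriv.symm) ha h

/-- A holomorphic solution of `((1 - z²) f')' = -h` is determined by its value at `1`, although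
`1` is a singular point of the equation. -/
lemma eq_add_volterra_of_ode {U : Set ℂ} (hU : IsOpen U) (hs : StarConvex ℝ 1 U)
    (hc : U ⊆ cutPlane) (h1 : (1 : ℂ) ∈ U) {f f' h : ℂ → ℂ} (hf : ∀ z ∈ U, HasDerivAt f (f' z) z)
    (hh : DifferentiableOn ℂ h U)
    (hode : ∀ z ∈ U, HasDerivAt (fun z => (1 - z ^ 2) * f' z) (-h z) z) {z : ℂ} (hz : z ∈ U) :
    f z = f 1 + volterra h z := by
  have hflux : Set.EqOn (fun z => (1 - z ^ 2) * f' z) (fun z => -((z - 1) * avg h z)) U :=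
    eqOn_of_hasDerivAt_eq hU hs hode (fun z hz => (hasDerivAt_mul_avg hU hs hh hz).neg) h1
      (by simp)
  have hfd : DifferentiableOn ℂ f U := fun z hz =>
    (hf z hz).differentiableAt.differentiableWithinAt
  have hf'd : DifferentiableOn ℂ f' U := (hfd.deriv hU).congr fun z hz => (hf z hz).deriv.symm
  have hne : ∀ z ∈ U, z ≠ 1 → f' z = avg h z / (z + 1) := by
    intro z hz hz1
    have := hflux hz
    simp only at this
    rw [eq_div_iff (add_one_ne_zero_of_mem (hc hz))]
    have h3 : (1 - z) ≠ 0 := sub_ne_zero.2 (Ne.symm hz1)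
    apply mul_left_cancel₀ h3
    linear_combination this
  have hD := differentiableOn_avg_div hU hs hc hh
  -- at the singular point itself the identity follows by continuity
  have hone : f' 1 = avg h 1 / (1 + 1) := by
    have c1 : ContinuousAt f' 1 := (hf'd.differentiableAt (hU.mem_nhds h1)).continuousAt
    have c2 : ContinuousAt (fun w => avg h w / (w + 1)) 1 :=
      (hD.differentiableAt (hU.mem_nhds h1)).continuousAt
    refine tendsto_nhds_unique (c1.tendsto.mono_left nhdsWithin_le_nhds)
      ((c2.tendsto.mono_left (nhdsWithin_le_nhds (s := {1}ᶜ))).congr' ?_)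
    filter_upwards [self_mem_nhdsWithin, nhdsWithin_le_nhds (hU.mem_nhds h1)] with w hw hwU
    exact (hne w hwU hw).symm
  have := eqOn_of_hasDerivAt_eq hU hs (f := f) (g := fun z => f 1 + volterra h z) (d := f') hf
    (fun z hz => by
      refine ((hasDerivAt_volterra hU hs hc hh hz).const_add (f 1)).congr_deriv ?_
      by_cases hz1 : z = 1
      · rw [hz1, hone]
      · exact (hne z hz hz1).symm) h1 (by simp [volterra_one])
  exact this hz

/-! ### Power series in the eigenvalue parameter with holomorphic coefficients -/

/-- A sequence of holomorphic functions on the cut plane that decays factorially, locally uniformly,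
so that `∑ lam ^ k * c k z` is entire in `lam` and holomorphic in `z`. -/
def EntireFamily (c : ℕ → ℂ → ℂ) : Prop :=
  (∀ k, DifferentiableOn ℂ (c k) cutPlane) ∧
    ∀ K ⊆ cutPlane, IsCompact K →
      ∃ A C : ℝ, 0 ≤ A ∧ 0 ≤ C ∧ ∀ k, ∀ z ∈ K, ‖c k z‖ ≤ A * C ^ k / k.factorial

/-- The sum of the power series in `lam` with coefficients `c k z`. -/
noncomputable def lamSeries (c : ℕ → ℂ → ℂ) (lam z : ℂ) : ℂ := ∑' k, lam ^ k * c k z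

/-- The coefficients of the derivative in `lam` of `lamSeries c`. -/
def derivFamily (c : ℕ → ℂ → ℂ) : ℕ → ℂ → ℂ := fun k z => (k + 1) * c (k + 1) z

lemma summable_factorial_bound (R A C : ℝ) :
    Summable fun k : ℕ => R ^ k * (A * C ^ k / k.factorial) := by
  refine ((Real.summable_pow_div_factorial (R * C)).mul_left A).congr fun k => ?_
  rw [mul_pow]; ring

namespace EntireFamily

variable {c d : ℕ → ℂ → ℂ}

lemma summable (hc : EntireFamily c) (lam : ℂ) {z : ℂ} (hz : z ∈ cutPlane) :
    Summable fun k => lam ^ k * c k z := by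
  obtain ⟨A, C, -, -, h⟩ := hc.2 {z} (by simpa using hz) isCompact_singleton
  refine Summable.of_norm_bounded (summable_factorial_bound ‖lam‖ A C) fun k => ?_
  rw [norm_mul, norm_pow]
  exact mul_le_mul_of_nonneg_left (h k z rfl) (by positivity)

lemma derivFamily (hc : EntireFamily c) : EntireFamily (derivFamily c) := by
  refine ⟨fun k => (hc.1 _).const_mul _, fun K hK hKc => ?_⟩
  obtain ⟨A, C, hA, hC, h⟩ := hc.2 K hK hKc
  refine ⟨A * C, C, by positivity, hC, fun k z hz => ?_⟩
  have h1 : ‖((k : ℂ) + 1)‖ = k + 1 := by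
    rw [← Nat.cast_succ, Complex.norm_natCast]; simp
  rw [LegendreDegree.derivFamily, norm_mul, h1]
  refine (mul_le_mul_of_nonneg_left (h _ z hz) (by positivity)).trans_eq ?_
  rw [Nat.factorial_succ]; push_cast; field_simp; ring

lemma hasDerivAt (hc : EntireFamily c) {z : ℂ} (hz : z ∈ cutPlane) (lam : ℂ) :
    HasDerivAt (fun lam => lamSeries c lam z)
      (lamSeries (LegendreDegree.derivFamily c) lam z) lam := by
  obtain ⟨A, C, -, -, h⟩ := hc.2 {z} (by simpa using hz) isCompact_singleton
  obtain ⟨A', C', -, -, h'⟩ := hc.derivFamily.2 {z} (by simpa using hz) isCompact_singleton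
  set R := ‖lam‖ + 1
  have hR : lam ∈ Metric.ball (0 : ℂ) R := by simp [R]
  have key := hasDerivAt_tsum_of_isPreconnected (𝕜 := ℂ) (F := ℂ)
    (u := fun k => R ^ k * (A' * C' ^ k / k.factorial))
    (g := fun k l => l ^ (k + 1) * c (k + 1) z)
    (g' := fun k l => l ^ k * LegendreDegree.derivFamily c k z) (y₀ := 0) (y := lam)
    (summable_factorial_bound R A' C') Metric.isOpen_ball
    (convex_ball (0 : ℂ) R).isPreconnected
    (fun k l _ => by
      refine ((hasDerivAt_pow (k + 1) l).mul_const (c (k + 1) z)).congr_deriv ?_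
      simp [LegendreDegree.derivFamily]; ring)
    (fun k l hl => by
      rw [norm_mul, norm_pow]
      have : ‖l‖ ≤ R := (mem_ball_zero_iff.1 hl).le
      exact mul_le_mul (pow_le_pow_left₀ (norm_nonneg _) this k) (h' k z rfl) (norm_nonneg _)
        (by positivity))
    (by simp only [Metric.mem_ball, dist_self, R]; positivity)
    (by simp) hR
  have e : (fun lam => lamSeries c lam z) =
      fun l => c 0 z + ∑' k, l ^ (k + 1) * c (k + 1) z := by
    funext l
    rw [lamSeries, (hc.summable l hz).tsum_eq_zero_add]; simp
  rw [e]
  exact key.const_add _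

lemma differentiableOn (hc : EntireFamily c) (lam : ℂ) :
    DifferentiableOn ℂ (lamSeries c lam) cutPlane := by
  intro z hz
  obtain ⟨δ, hδ, hball⟩ := Metric.nhds_basis_closedBall.mem_iff.1 (isOpen_cutPlane.mem_nhds hz)
  obtain ⟨A, C, -, -, h⟩ := hc.2 _ hball (isCompact_closedBall z δ)
  have := Complex.differentiableOn_tsum_of_summable_norm (E := ℂ) (U := Metric.ball z δ)
    (F := fun k z => lam ^ k * c k z)
    (summable_factorial_bound ‖lam‖ A C)
    (fun k => ((hc.1 k).mono (Metric.ball_subset_closedBall.trans hball)).const_mul _)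
    Metric.isOpen_ball (fun k w hw => by
      rw [norm_mul, norm_pow]
      exact mul_le_mul_of_nonneg_left (h k w (Metric.ball_subset_closedBall hw)) (by positivity))
  exact (this.differentiableAt (Metric.ball_mem_nhds z hδ)).differentiableWithinAt

lemma add (hc : EntireFamily c) (hd : EntireFamily d) :
    EntireFamily fun k z => c k z + d k z := by
  refine ⟨fun k => (hc.1 k).add (hd.1 k), fun K hK hKc => ?_⟩
  obtain ⟨A, C, hA, hC, h⟩ := hc.2 K hK hKc
  obtain ⟨A', C', hA', hC', h'⟩ := hd.2 K hK hKc
  refine ⟨A + A', max C C', by positivity, by positivity, fun k z hz => ?_⟩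
  refine (norm_add_le _ _).trans ((add_le_add (h k z hz) (h' k z hz)).trans ?_)
  rw [add_mul, add_div]
  gcongr
  · exact le_max_left _ _
  · exact le_max_right _ _

lemma mul_left (hc : EntireFamily c) {φ : ℂ → ℂ} (hφ : DifferentiableOn ℂ φ cutPlane) :
    EntireFamily fun k z => φ z * c k z := by
  refine ⟨fun k => hφ.mul (hc.1 k), fun K hK hKc => ?_⟩
  obtain ⟨A, C, hA, hC, h⟩ := hc.2 K hK hKc
  obtain ⟨B, hB⟩ := hKc.exists_bound_of_continuousOn (hφ.continuousOn.mono hK)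
  refine ⟨max B 0 * A, C, by positivity, hC, fun k z hz => ?_⟩
  rw [norm_mul]
  refine (mul_le_mul ((hB z hz).trans (le_max_left B 0)) (h k z hz) (norm_nonneg _)
    (by positivity)).trans_eq (by ring)

lemma const_mul (hc : EntireFamily c) (a : ℂ) : EntireFamily fun k z => a * c k z :=
  hc.mul_left (differentiableOn_const a)

lemma avg (hc : EntireFamily c) : EntireFamily fun k => avg (c k) := by
  refine ⟨fun k => differentiableOn_avg isOpen_cutPlane starConvex_cutPlane (hc.1 k),
    fun K hK hKc => ?_⟩
  obtain ⟨A, C, hA, hC, h⟩ := hc.2 _ (starHull_subset starConvex_cutPlane hK)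
    (isCompact_starHull hKc)
  refine ⟨A, C, hA, hC, fun k z hz => ?_⟩
  have := norm_avg_le (k := 0) (starConvex_starHull K) (fun z hz => (by simpa using h k z hz))
    (subset_starHull K hz)
  simpa using this

lemma lamSeries_avg (hc : EntireFamily c) (lam : ℂ) {z : ℂ} (hz : z ∈ cutPlane) :
    lamSeries (fun k => LegendreDegree.avg (c k)) lam z
      = LegendreDegree.avg (lamSeries c lam) z := by
  have hz' : {z} ⊆ cutPlane := by simpa using hz
  obtain ⟨A, C, hA, hC, h⟩ := hc.2 _ (starHull_subset starConvex_cutPlane hz')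
    (isCompact_starHull isCompact_singleton)
  have hmem : ∀ t ∈ Set.uIoc (0 : ℝ) 1, (1 : ℂ) + t * (z - 1) ∈ starHull {z} := by
    intro t ht
    rw [Set.uIoc_of_le zero_le_one] at ht
    exact ⟨(t, z), ⟨⟨ht.1.le, ht.2⟩, rfl⟩, rfl⟩
  have key := intervalIntegral.hasSum_integral_of_dominated_convergence
    (μ := MeasureTheory.volume) (a := 0) (b := 1)
    (F := fun k (t : ℝ) => lam ^ k * c k (1 + t * (z - 1)))
    (f := fun t : ℝ => lamSeries c lam (1 + t * (z - 1)))
    (bound := fun k _ => ‖lam‖ ^ k * (A * C ^ k / k.factorial))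
    (fun k => by
      have := (intervalIntegrable_segment starConvex_cutPlane (hc.1 k).continuousOn
        hz).aestronglyMeasurable
      rw [Set.uIoc_of_le zero_le_one]
      exact this.const_mul _)
    (fun k => Eventually.of_forall fun t ht => by
      rw [norm_mul, norm_pow]
      exact mul_le_mul_of_nonneg_left (h k _ (hmem t ht)) (by positivity))
    (Eventually.of_forall fun t _ => summable_factorial_bound ‖lam‖ A C)
    intervalIntegrable_const
    (Eventually.of_forall fun t ht =>
      (hc.summable lam (starHull_subset starConvex_cutPlane hz' (hmem t ht))).hasSum)
  simp only [intervalIntegral.integral_const_mul] at key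
  exact key.tsum_eq

lemma lamSeries_mul_left (φ : ℂ → ℂ) (c : ℕ → ℂ → ℂ) (lam z : ℂ) :
    lamSeries (fun k z => φ z * c k z) lam z = φ z * lamSeries c lam z := by
  rw [lamSeries, lamSeries, ← tsum_mul_left]
  exact tsum_congr fun k => by ring

lemma lamSeries_add (hc : EntireFamily c) (hd : EntireFamily d) (lam : ℂ) {z : ℂ}
    (hz : z ∈ cutPlane) : lamSeries (fun k z => c k z + d k z) lam z
      = lamSeries c lam z + lamSeries d lam z := by
  rw [lamSeries, lamSeries, lamSeries, ← (hc.summable lam hz).tsum_add (hd.summable lam hz)]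
  exact tsum_congr fun k => by ring

lemma avg_div (hc : EntireFamily c) :
    EntireFamily fun k w => LegendreDegree.avg (c k) w / (w + 1) := by
  have := hc.avg.mul_left (φ := fun w => (w + 1)⁻¹)
    (DifferentiableOn.inv (by fun_prop) fun _ hw => add_one_ne_zero_of_mem hw)
  simpa only [div_eq_mul_inv, mul_comm] using this

lemma volterra (hc : EntireFamily c) : EntireFamily fun k => volterra (c k) :=
  hc.avg_div.avg.mul_left (φ := fun z => z - 1) (by fun_prop)

lemma lamSeries_volterra (hc : EntireFamily c) (lam : ℂ) {z : ℂ} (hz : z ∈ cutPlane) :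
    lamSeries (fun k => LegendreDegree.volterra (c k)) lam z
      = LegendreDegree.volterra (lamSeries c lam) z := by
  have h1 := lamSeries_mul_left (fun z => z - 1)
    (fun k => LegendreDegree.avg fun w => LegendreDegree.avg (c k) w / (w + 1)) lam z
  refine h1.trans ?_
  rw [hc.avg_div.lamSeries_avg lam hz, LegendreDegree.volterra]
  congr 1
  refine avg_congr starConvex_cutPlane (fun w hw => ?_) hz
  rw [← hc.lamSeries_avg lam hw, div_eq_inv_mul,
    ← lamSeries_mul_left (fun w => (w + 1)⁻¹) (fun k => LegendreDegree.avg (c k))]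
  simp only [div_eq_inv_mul]

end EntireFamily

/-! ### The Legendre function and the regular part of the logarithmic solution -/

/-- The coefficients of the Legendre function as a power series in `lam = ν (ν + 1)`. -/
noncomputable def legendreIter : ℕ → ℂ → ℂ
  | 0 => fun _ => 1
  | k + 1 => volterra (legendreIter k)

/-- The coefficients, as a power series in `lam = ν (ν + 1)`, of the function `g` for which
`P_ν(z) ln((1 - z) / 2) + g(z)` is a second solution of Legendre's equation. -/
noncomputable def logIter : ℕ → ℂ → ℂ
  | 0 => volterra fun _ => -1
  | k + 1 => volterra fun w =>
      logIter k w + (-2 * avg (legendreIter k) w + -1 * legendreIter (k + 1) w)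

lemma differentiableOn_legendreIter (k : ℕ) : DifferentiableOn ℂ (legendreIter k) cutPlane := by
  induction k with
  | zero => exact differentiableOn_const 1
  | succ k ih =>
    exact differentiableOn_volterra isOpen_cutPlane starConvex_cutPlane subset_rfl ih

lemma differentiableOn_logIter (k : ℕ) : DifferentiableOn ℂ (logIter k) cutPlane := by
  induction k with
  | zero =>
    exact differentiableOn_volterra isOpen_cutPlane starConvex_cutPlane subset_rfl
      (differentiableOn_const _)
  | succ k ih =>
    refine differentiableOn_volterra isOpen_cutPlane starConvex_cutPlane subset_rfl
      (ih.add ((DifferentiableOn.const_mul ?_ _).add ((differentiableOn_legendreIter _).const_mul _)))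
    exact differentiableOn_avg isOpen_cutPlane starConvex_cutPlane
      (differentiableOn_legendreIter k)

/-- On a star-shaped set both sequences are controlled by the same geometric sequence divided by
factorials. -/
lemma norm_iter_le {K : Set ℂ} (hs : StarConvex ℝ 1 K) {M R : ℝ} (hM0 : 0 ≤ M) (hR0 : 0 ≤ R)
    (hM : ∀ z ∈ K, ‖(z + 1)⁻¹‖ ≤ M) (hR : ∀ z ∈ K, ‖z - 1‖ ≤ R) (k : ℕ) :
    (∀ z ∈ K, ‖legendreIter k z‖ ≤ ((3 + M * R) * (1 + M)) ^ (k + 1) / k.factorial * ‖z - 1‖ ^ k) ∧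
    (∀ z ∈ K, ‖logIter k z‖ ≤ ((3 + M * R) * (1 + M)) ^ (k + 1) / k.factorial * ‖z - 1‖ ^ k) := by
  set E := (3 + M * R) * (1 + M) with hE
  have hMR : 0 ≤ M * R := by positivity
  have hE0 : 0 ≤ E := by positivity
  have hE1 : 1 ≤ E := by nlinarith
  have hEM : (3 + M * R) * M ≤ E := by nlinarith
  have hEM' : M ≤ E := by nlinarith
  induction k with
  | zero =>
    refine ⟨fun z _ => by simpa [legendreIter] using hE1, fun z hz => ?_⟩
    have := norm_volterra_le (f := fun _ => -1) (k := 0) hs zero_le_one hM (by simp) hz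
    simp only [logIter]
    refine this.trans ?_
    simp only [Nat.factorial_zero, Nat.cast_zero, Nat.cast_one, pow_zero, zero_add, pow_one,
      one_mul, div_one, mul_one]
    nlinarith [hR z hz, mul_le_mul_of_nonneg_left (hR z hz) hM0]
  | succ k ih =>
    have hE' : 0 ≤ E ^ (k + 1) / k.factorial := by positivity
    have ha : ∀ z ∈ K, ‖legendreIter (k + 1) z‖ ≤
        E ^ (k + 1) / k.factorial * M * ‖z - 1‖ ^ (k + 1) / (k + 1) := fun z hz =>
      norm_volterra_le hs hE' hM ih.1 hz
    refine ⟨fun z hz => (ha z hz).trans ?_, fun z hz => ?_⟩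
    · calc _ = M * (E ^ (k + 1) / (k + 1).factorial * ‖z - 1‖ ^ (k + 1)) := by
            rw [Nat.factorial_succ]; push_cast; field_simp
        _ ≤ E * (E ^ (k + 1) / (k + 1).factorial * ‖z - 1‖ ^ (k + 1)) := by gcongr
        _ = _ := by ring
    · have hb : ∀ w ∈ K, ‖logIter k w + (-2 * avg (legendreIter k) w +
          -1 * legendreIter (k + 1) w)‖ ≤
          (3 + M * R) * (E ^ (k + 1) / k.factorial) * ‖w - 1‖ ^ k := by
        intro w hw
        have h1 := ih.2 w hw
        have h2 := norm_avg_le hs ih.1 hw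
        have h3 := ha w hw
        have hk : (1 : ℝ) ≤ k + 1 := by linarith [(Nat.cast_nonneg k : (0 : ℝ) ≤ k)]
        have h2' := h2.trans (div_le_self (by positivity) hk)
        have h3' := h3.trans (div_le_self (by positivity) hk)
        have h4 : E ^ (k + 1) / k.factorial * M * ‖w - 1‖ ^ (k + 1) ≤
            M * R * (E ^ (k + 1) / k.factorial * ‖w - 1‖ ^ k) := by
          calc _ = M * ‖w - 1‖ * (E ^ (k + 1) / k.factorial * ‖w - 1‖ ^ k) := by ring
            _ ≤ _ := by gcongr; exact hR w hw
        refine (norm_add_le _ _).trans ((add_le_add_right (norm_add_le _ _) _).trans ?_)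
        rw [norm_mul, norm_mul]
        norm_num
        linarith
      have := norm_volterra_le hs (by positivity) hM hb hz
      refine this.trans ?_
      calc _ = (3 + M * R) * M * (E ^ (k + 1) / (k + 1).factorial * ‖z - 1‖ ^ (k + 1)) := by
            rw [Nat.factorial_succ]; push_cast; field_simp
        _ ≤ E * (E ^ (k + 1) / (k + 1).factorial * ‖z - 1‖ ^ (k + 1)) := by gcongr
        _ = _ := by ring

lemma exists_bound_iter {K : Set ℂ} (hK : K ⊆ cutPlane) (hKc : IsCompact K) :
    ∃ A C : ℝ, 0 ≤ A ∧ 0 ≤ C ∧ ∀ k, ∀ z ∈ K, ‖legendreIter k z‖ ≤ A * C ^ k / k.factorial ∧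
      ‖logIter k z‖ ≤ A * C ^ k / k.factorial := by
  have hs := starHull_subset starConvex_cutPlane hK
  have hc := isCompact_starHull hKc
  obtain ⟨M, hM⟩ := exists_norm_inv_add_one_le hc hs
  obtain ⟨R, hR⟩ := hc.exists_bound_of_continuousOn (f := fun z : ℂ => z - 1) (by fun_prop)
  have hb := norm_iter_le (M := max M 0) (R := max R 0) (starConvex_starHull K) (le_max_right _ _)
    (le_max_right _ _) (fun z hz => (hM z hz).trans (le_max_left _ _))
    (fun z hz => (hR z hz).trans (le_max_left _ _))
  set E := (3 + max M 0 * max R 0) * (1 + max M 0)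
  have hE : 0 ≤ E := by positivity
  clear_value E
  have hle : ∀ k : ℕ, ∀ z ∈ K, E ^ (k + 1) / k.factorial * ‖z - 1‖ ^ k ≤
      E * (E * max R 0) ^ k / k.factorial := by
    intro k z hz
    calc _ ≤ E ^ (k + 1) / k.factorial * (max R 0) ^ k := by
          gcongr; exact (hR z (subset_starHull K hz)).trans (le_max_left _ _)
      _ = _ := by rw [mul_pow]; ring
  exact ⟨E, E * max R 0, hE, by positivity, fun k z hz =>
    ⟨((hb k).1 z (subset_starHull K hz)).trans (hle k z hz),
      ((hb k).2 z (subset_starHull K hz)).trans (hle k z hz)⟩⟩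

lemma entireFamily_legendreIter : EntireFamily legendreIter :=
  ⟨differentiableOn_legendreIter, fun _ hK hKc => by
    obtain ⟨A, C, hA, hC, h⟩ := exists_bound_iter hK hKc
    exact ⟨A, C, hA, hC, fun k z hz => (h k z hz).1⟩⟩

lemma entireFamily_logIter : EntireFamily logIter :=
  ⟨differentiableOn_logIter, fun _ hK hKc => by
    obtain ⟨A, C, hA, hC, h⟩ := exists_bound_iter hK hKc
    exact ⟨A, C, hA, hC, fun k z hz => (h k z hz).2⟩⟩

/-- The Legendre function of the first kind as a function of `lam = ν (ν + 1)` and `z`. -/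
noncomputable def legendreFn (lam z : ℂ) : ℂ := lamSeries legendreIter lam z

/-- The derivative of `legendreFn` in `lam`. -/
noncomputable def legendreFn₁ (lam z : ℂ) : ℂ := lamSeries (derivFamily legendreIter) lam z

/-- The second derivative of `legendreFn` in `lam`. -/
noncomputable def legendreFn₂ (lam z : ℂ) : ℂ :=
  lamSeries (derivFamily (derivFamily legendreIter)) lam z

/-- The regular part `g` of the logarithmic solution `P_ν(z) ln((1 - z) / 2) + g(z)` of
Legendre's equation, `lam = ν (ν + 1)`. -/
noncomputable def logFn (lam z : ℂ) : ℂ := lamSeries logIter lam z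

/-- The derivative of `logFn` in `lam`. -/
noncomputable def logFn₁ (lam z : ℂ) : ℂ := lamSeries (derivFamily logIter) lam z

section Equations

variable {lam z : ℂ}

lemma hasDerivAt_legendreFn_lam (hz : z ∈ cutPlane) (lam : ℂ) :
    HasDerivAt (fun lam => legendreFn lam z) (legendreFn₁ lam z) lam :=
  entireFamily_legendreIter.hasDerivAt hz lam

lemma hasDerivAt_legendreFn₁_lam (hz : z ∈ cutPlane) (lam : ℂ) :
    HasDerivAt (fun lam => legendreFn₁ lam z) (legendreFn₂ lam z) lam :=
  entireFamily_legendreIter.derivFamily.hasDerivAt hz lam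

lemma hasDerivAt_logFn_lam (hz : z ∈ cutPlane) (lam : ℂ) :
    HasDerivAt (fun lam => logFn lam z) (logFn₁ lam z) lam :=
  entireFamily_logIter.hasDerivAt hz lam

lemma differentiableOn_legendreFn (lam : ℂ) : DifferentiableOn ℂ (legendreFn lam) cutPlane :=
  entireFamily_legendreIter.differentiableOn lam

lemma differentiableOn_legendreFn₁ (lam : ℂ) : DifferentiableOn ℂ (legendreFn₁ lam) cutPlane :=
  entireFamily_legendreIter.derivFamily.differentiableOn lam

lemma differentiableOn_legendreFn₂ (lam : ℂ) : DifferentiableOn ℂ (legendreFn₂ lam) cutPlane :=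
  entireFamily_legendreIter.derivFamily.derivFamily.differentiableOn lam

lemma differentiableOn_logFn (lam : ℂ) : DifferentiableOn ℂ (logFn lam) cutPlane :=
  entireFamily_logIter.differentiableOn lam

lemma differentiableOn_logFn₁ (lam : ℂ) : DifferentiableOn ℂ (logFn₁ lam) cutPlane :=
  entireFamily_logIter.derivFamily.differentiableOn lam

lemma derivFamily_volterra (c : ℕ → ℂ → ℂ) :
    derivFamily (fun k => volterra (c k)) = fun k => volterra (derivFamily c k) := by
  funext k z
  exact (volterra_const_mul _ _ _).symm

lemma legendreFn_eq_lam_mul (hz : z ∈ cutPlane) :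
    legendreFn lam z = 1 + lam * volterra (legendreFn lam) z := by
  have h := entireFamily_legendreIter
  unfold legendreFn
  rw [← h.lamSeries_volterra lam hz, lamSeries, (h.summable lam hz).tsum_eq_zero_add, lamSeries,
    ← tsum_mul_left]
  congr 1
  · simp [legendreIter]
  · exact tsum_congr fun k => by simp only [legendreIter]; ring

lemma legendreFn_eq (hz : z ∈ cutPlane) :
    legendreFn lam z = 1 + volterra (fun w => lam * legendreFn lam w) z := by
  rw [volterra_const_mul]; exact legendreFn_eq_lam_mul hz

lemma hasDerivAt_volterra_lamSeries {c : ℕ → ℂ → ℂ} (hc : EntireFamily c) (hz : z ∈ cutPlane) :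
    HasDerivAt (fun lam => volterra (lamSeries c lam) z)
      (volterra (lamSeries (derivFamily c) lam) z) lam := by
  have h := hc.volterra.hasDerivAt hz lam
  rw [derivFamily_volterra, hc.derivFamily.lamSeries_volterra lam hz] at h
  simpa only [hc.lamSeries_volterra _ hz] using h

/-- The Volterra equation differentiated once in `lam`. -/
lemma legendreFn₁_eq (hz : z ∈ cutPlane) :
    legendreFn₁ lam z = volterra (legendreFn lam) z + lam * volterra (legendreFn₁ lam) z := by
  have h1 := hasDerivAt_legendreFn_lam hz lam
  have h2 := ((hasDerivAt_id lam).mul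
    (hasDerivAt_volterra_lamSeries (lam := lam) entireFamily_legendreIter hz)).const_add 1
  have h3 : (fun lam => legendreFn lam z) =
      fun lam => 1 + ((id : ℂ → ℂ) * fun lam => volterra (lamSeries legendreIter lam) z) lam :=
    funext fun l => legendreFn_eq_lam_mul hz
  rw [h3] at h1
  have := h1.unique h2
  simp only [id, one_mul] at this
  exact this

/-- The Volterra equation differentiated twice in `lam`. -/
lemma legendreFn₂_eq (hz : z ∈ cutPlane) :
    legendreFn₂ lam z = 2 * volterra (legendreFn₁ lam) z + lam * volterra (legendreFn₂ lam) z := by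
  have h1 := hasDerivAt_legendreFn₁_lam hz lam
  have h2 := (hasDerivAt_volterra_lamSeries (lam := lam) entireFamily_legendreIter hz).add
    ((hasDerivAt_id lam).mul
      (hasDerivAt_volterra_lamSeries (lam := lam) entireFamily_legendreIter.derivFamily hz))
  have h3 : (fun lam => legendreFn₁ lam z) =
      (fun lam => volterra (lamSeries legendreIter lam) z) +
        (id * fun lam => volterra (lamSeries (derivFamily legendreIter) lam) z) :=
    funext fun l => legendreFn₁_eq hz
  rw [h3] at h1
  have := h1.unique h2
  simp only [id, one_mul] at this
  refine this.trans ?_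
  rw [two_mul, add_assoc]
  rfl

/-- The right-hand side of the equation `((1 - z²) g')' = -logSource` satisfied by `logFn`. -/
noncomputable def logSource (lam z : ℂ) : ℂ :=
  lam * logFn lam z + (-2 * lam * avg (legendreFn lam) z + -1 * legendreFn lam z)

lemma differentiableOn_avg_legendreFn (lam : ℂ) :
    DifferentiableOn ℂ (avg (legendreFn lam)) cutPlane :=
  differentiableOn_avg isOpen_cutPlane starConvex_cutPlane (differentiableOn_legendreFn lam)

lemma differentiableOn_logSource (lam : ℂ) : DifferentiableOn ℂ (logSource lam) cutPlane :=
  ((differentiableOn_logFn lam).const_mul _).add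
    (((differentiableOn_avg_legendreFn lam).const_mul _).add
      ((differentiableOn_legendreFn lam).const_mul _))

lemma logFn_eq (hz : z ∈ cutPlane) : logFn lam z = volterra (logSource lam) z := by
  have ha := entireFamily_legendreIter
  have hb := entireFamily_logIter
  have hs : EntireFamily fun k => legendreIter (k + 1) := ha.volterra
  have hav := ha.avg
  have hd : EntireFamily fun k w => logIter k w +
      (-2 * avg (legendreIter k) w + -1 * legendreIter (k + 1) w) :=
    hb.add ((hav.const_mul (-2)).add (hs.const_mul (-1)))
  have hsum : ∀ w ∈ cutPlane, logSource lam w = -1 + lam * lamSeries (fun k w => logIter k w +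
      (-2 * avg (legendreIter k) w + -1 * legendreIter (k + 1) w)) lam w := by
    intro w hw
    rw [EntireFamily.lamSeries_add hb ((hav.const_mul (-2)).add (hs.const_mul (-1))) lam hw,
      EntireFamily.lamSeries_add (hav.const_mul (-2)) (hs.const_mul (-1)) lam hw,
      EntireFamily.lamSeries_mul_left (fun _ => -2), EntireFamily.lamSeries_mul_left (fun _ => -1),
      ha.lamSeries_avg lam hw]
    have h1 : legendreFn lam w = 1 + lam * lamSeries (fun k => legendreIter (k + 1)) lam w := by
      rw [legendreFn_eq_lam_mul hw]
      exact congrArg (fun x => 1 + lam * x) (ha.lamSeries_volterra lam hw).symm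
    rw [logSource, h1]
    change lam * lamSeries logIter lam w + (-2 * lam * avg (lamSeries legendreIter lam) w + _) = _
    ring
  have hd' := hd.differentiableOn lam
  rw [volterra_congr starConvex_cutPlane hsum hz,
    volterra_add isOpen_cutPlane starConvex_cutPlane subset_rfl (differentiableOn_const _)
      (hd'.const_mul lam) hz, volterra_const_mul, ← hd.lamSeries_volterra lam hz,
    logFn, lamSeries, (hb.summable lam hz).tsum_eq_zero_add, lamSeries, ← tsum_mul_left]
  congr 1
  · simp [logIter]
  · exact tsum_congr fun k => by simp only [logIter]; ring

lemma hasDerivAt_legendreFn (hz : z ∈ cutPlane) :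
    HasDerivAt (legendreFn lam) (lam * avg (legendreFn lam) z / (z + 1)) z := by
  have h := ((hasDerivAt_volterra isOpen_cutPlane starConvex_cutPlane subset_rfl
    ((differentiableOn_legendreFn lam).const_mul lam) hz).const_add 1)
  rw [avg_const_mul] at h
  refine h.congr_of_eventuallyEq ?_
  filter_upwards [isOpen_cutPlane.mem_nhds hz] with w hw using legendreFn_eq hw

lemma hasDerivAt_logFn (hz : z ∈ cutPlane) :
    HasDerivAt (logFn lam) (avg (logSource lam) z / (z + 1)) z := by
  refine (hasDerivAt_volterra isOpen_cutPlane starConvex_cutPlane subset_rfl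
    (differentiableOn_logSource lam) hz).congr_of_eventuallyEq ?_
  filter_upwards [isOpen_cutPlane.mem_nhds hz] with w hw using logFn_eq hw

lemma legendreFn_one (lam : ℂ) : legendreFn lam 1 = 1 := by
  rw [legendreFn_eq one_mem_cutPlane, volterra_one, add_zero]

lemma logFn_one (lam : ℂ) : logFn lam 1 = 0 := by
  rw [logFn_eq one_mem_cutPlane, volterra_one]

end Equations

/-! ### The hypergeometric series -/

lemma ball_subset_cutPlane : Metric.ball (1 : ℂ) 2 ⊆ cutPlane := by
  intro z hz
  rw [Metric.mem_ball, dist_eq_norm] at hz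
  have := (Complex.abs_re_le_norm (z - 1)).trans_lt hz
  rw [abs_lt] at this
  left
  simp only [Complex.sub_re, Complex.one_re, Complex.add_re] at this ⊢
  linarith

lemma norm_half_lt_one {z : ℂ} (hz : z ∈ Metric.ball (1 : ℂ) 2) : ‖(1 - z) / 2‖ < 1 := by
  rw [Metric.mem_ball, dist_eq_norm, norm_sub_rev] at hz
  rw [norm_div]; norm_num; linarith

/-- The power series in `(1 - z) / 2` with coefficients `d`. -/
noncomputable def halfSeries (d : ℕ → ℂ) (z : ℂ) : ℂ := ∑' k, d k * ((1 - z) / 2) ^ k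

section HalfSeries

variable {d : ℕ → ℂ} {B : ℝ} {z : ℂ}

lemma summable_norm_halfSeries (hd : ∀ k, ‖d k‖ ≤ B) (hz : z ∈ Metric.ball (1 : ℂ) 2) :
    Summable fun k => ‖d k * ((1 - z) / 2) ^ k‖ := by
  refine Summable.of_nonneg_of_le (fun _ => norm_nonneg _) (fun k => ?_)
    ((summable_geometric_of_lt_one (norm_nonneg _) (norm_half_lt_one hz)).mul_left B)
  rw [norm_mul, norm_pow]
  exact mul_le_mul_of_nonneg_right (hd k) (by positivity)

lemma summable_halfSeries (hd : ∀ k, ‖d k‖ ≤ B) (hz : z ∈ Metric.ball (1 : ℂ) 2) :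
    Summable fun k => d k * ((1 - z) / 2) ^ k :=
  (summable_norm_halfSeries hd hz).of_norm

lemma differentiableOn_halfSeries (hd : ∀ k, ‖d k‖ ≤ B) :
    DifferentiableOn ℂ (halfSeries d) (Metric.ball 1 2) := by
  intro z hz
  obtain ⟨r, hr1, hr2⟩ := exists_between (norm_half_lt_one hz)
  have hB : 0 ≤ B := (norm_nonneg _).trans (hd 0)
  have hr0 : 0 ≤ r := (norm_nonneg _).trans hr1.le
  have hopen : IsOpen {w : ℂ | ‖(1 - w) / 2‖ < r} := isOpen_lt (by fun_prop) continuous_const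
  have := Complex.differentiableOn_tsum_of_summable_norm (E := ℂ)
    (F := fun k z => d k * ((1 - z) / 2) ^ k)
    ((summable_geometric_of_lt_one hr0 hr2).mul_left B)
    (fun k => by fun_prop) hopen (fun k w hw => by
      rw [norm_mul, norm_pow]
      exact mul_le_mul (hd k) (pow_le_pow_left₀ (norm_nonneg _) (le_of_lt hw) k) (by positivity) hB)
  exact (this.differentiableAt (hopen.mem_nhds hr1)).differentiableWithinAt

lemma avg_halfSeries (hd : ∀ k, ‖d k‖ ≤ B) (hz : z ∈ Metric.ball (1 : ℂ) 2) :
    avg (halfSeries d) z = halfSeries (fun k => d k / (k + 1)) z := by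
  have hcomp : ∀ t : ℝ, ((1 : ℂ) - (1 + t * (z - 1))) / 2 = t * ((1 - z) / 2) := fun t => by ring
  have hle : ∀ t ∈ Set.uIoc (0 : ℝ) 1, ‖(t : ℂ)‖ ≤ 1 := by
    intro t ht
    rw [Set.uIoc_of_le zero_le_one] at ht
    rw [Complex.norm_real, Real.norm_of_nonneg ht.1.le]; exact ht.2
  have key := intervalIntegral.hasSum_integral_of_dominated_convergence
    (μ := MeasureTheory.volume) (a := 0) (b := 1)
    (F := fun k (t : ℝ) => d k * ((1 - (1 + t * (z - 1))) / 2) ^ k)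
    (f := fun t : ℝ => halfSeries d (1 + t * (z - 1)))
    (bound := fun k _ => ‖d k * ((1 - z) / 2) ^ k‖)
    (fun k => (Continuous.aestronglyMeasurable (by fun_prop)))
    (fun k => Eventually.of_forall fun t ht => by
      rw [hcomp, mul_pow, mul_left_comm, norm_mul, norm_pow]
      exact mul_le_of_le_one_left (norm_nonneg _) (pow_le_one₀ (norm_nonneg _) (hle t ht)))
    (Eventually.of_forall fun t _ => summable_norm_halfSeries hd hz)
    intervalIntegrable_const
    (Eventually.of_forall fun t ht => (summable_halfSeries hd (by
      rw [Metric.mem_ball, dist_eq_norm] at hz ⊢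
      rw [add_sub_cancel_left, norm_mul]
      exact (mul_le_of_le_one_left (norm_nonneg _) (hle t ht)).trans_lt hz)).hasSum)
  refine key.tsum_eq.symm.trans (tsum_congr fun k => ?_)
  have hmul : ∀ t : ℝ, d k * ((1 - (1 + (t : ℂ) * (z - 1))) / 2) ^ k =
      d k * ((1 - z) / 2) ^ k * ((t ^ k : ℝ) : ℂ) := fun t => by
    rw [hcomp, mul_pow]; push_cast; ring
  simp only [hmul]
  rw [intervalIntegral.integral_const_mul, intervalIntegral.integral_ofReal, integral_pow]
  simp; ring

end HalfSeries

/-- The coefficients of the hypergeometric series of `P_ν`. -/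
noncomputable def hypCoeff (ν : ℂ) (k : ℕ) : ℂ :=
  ordinaryHypergeometricCoefficient (-ν) (ν + 1) 1 k

lemma hypCoeff_zero (ν : ℂ) : hypCoeff ν 0 = 1 := by
  simp [hypCoeff, ordinaryHypergeometricCoefficient]

lemma hypCoeff_succ (ν : ℂ) (k : ℕ) :
    hypCoeff ν (k + 1) * (k + 1) ^ 2 = hypCoeff ν k * ((k - ν) * (k + 1 + ν)) := by
  simp only [hypCoeff, ordinaryHypergeometricCoefficient, ascPochhammer_succ_eval,
    ascPochhammer_eval_one, Nat.factorial_succ]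
  have h1 : (k.factorial : ℂ) ≠ 0 := by exact_mod_cast k.factorial_ne_zero
  have h2 : (k : ℂ) + 1 ≠ 0 := by exact_mod_cast k.succ_ne_zero
  have h3 : (1 : ℂ) + k ≠ 0 := by rwa [add_comm]
  push_cast
  field_simp
  ring

lemma succ_mul_hypCoeff (ν : ℂ) (m : ℕ) :
    ((m : ℂ) + 1) * hypCoeff ν (m + 1) =
      -((1 + ν * (1 / ((m : ℂ) + 1))) *
        (ν * ∏ j ∈ Finset.range m, (1 - ν ^ 2 / ((j : ℂ) + 1) ^ 2))) := by
  induction m with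
  | zero =>
    have := hypCoeff_succ ν 0
    rw [hypCoeff_zero] at this
    simp at this ⊢
    rw [this]; ring
  | succ m ih =>
    have h := hypCoeff_succ ν (m + 1)
    have h1 : (m : ℂ) + 1 ≠ 0 := by exact_mod_cast m.succ_ne_zero
    have h2 : (m : ℂ) + 1 + 1 ≠ 0 := by exact_mod_cast (m + 1).succ_ne_zero
    rw [Finset.prod_range_succ]
    have ih' : hypCoeff ν (m + 1) = -((1 + ν * (1 / ((m : ℂ) + 1))) *
        (ν * ∏ j ∈ Finset.range m, (1 - ν ^ 2 / ((j : ℂ) + 1) ^ 2))) / (m + 1) := by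
      rw [eq_div_iff h1, ← ih]; ring
    push_cast at h ⊢
    rw [ih'] at h
    apply mul_right_cancel₀ h2
    rw [show ((m : ℂ) + 1 + 1) * hypCoeff ν (m + 1 + 1) * (m + 1 + 1) =
      hypCoeff ν (m + 1 + 1) * (m + 1 + 1) ^ 2 by ring, h]
    field_simp
    ring

/-- By Euler's product for the sine, the coefficients decay like `-sin (πν) / (π k)`. This gives
the strength of the logarithmic singularity of `P_ν` at `-1`. -/
lemma tendsto_mul_hypCoeff (ν : ℂ) :
    Tendsto (fun k : ℕ => (k : ℂ) * hypCoeff ν k) atTop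
      (𝓝 (-(Complex.sin (Real.pi * ν) / Real.pi))) := by
  rw [← tendsto_add_atTop_iff_nat 1]
  have h1 : Tendsto (fun m : ℕ => 1 + ν * (1 / ((m : ℂ) + 1))) atTop (𝓝 (1 + ν * 0)) :=
    (tendsto_one_div_add_atTop_nhds_zero_nat.const_mul ν).const_add 1
  have h2 := (Complex.tendsto_euler_sin_prod ν).div_const (Real.pi : ℂ)
  have hpi : (Real.pi : ℂ) ≠ 0 := Complex.ofReal_ne_zero.2 Real.pi_ne_zero
  have h3 := (h1.mul h2).neg
  rw [mul_zero, add_zero, one_mul] at h3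
  refine h3.congr fun m => ?_
  push_cast
  rw [succ_mul_hypCoeff]
  field_simp

lemma exists_bound_mul_hypCoeff (ν : ℂ) : ∃ B, ∀ k : ℕ, ‖(k : ℂ) * hypCoeff ν k‖ ≤ B := by
  obtain ⟨B, hB⟩ := (Metric.isBounded_range_of_tendsto _ (tendsto_mul_hypCoeff ν)).exists_norm_le
  exact ⟨B, fun k => hB _ ⟨k, rfl⟩⟩

lemma exists_bound_hypCoeff (ν : ℂ) : ∃ B, ∀ k : ℕ, ‖hypCoeff ν k‖ ≤ B := by
  obtain ⟨B, hB⟩ := exists_bound_mul_hypCoeff ν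
  refine ⟨max B 1, fun k => ?_⟩
  rcases Nat.eq_zero_or_pos k with rfl | hk
  · simp [hypCoeff_zero]
  · refine le_trans ?_ ((hB k).trans (le_max_left B 1))
    rw [norm_mul, Complex.norm_natCast]
    exact le_mul_of_one_le_left (norm_nonneg _) (by exact_mod_cast hk)

lemma hypergeometric_eq_halfSeries (ν z : ℂ) :
    ₂F₁ (-ν) (ν + 1) (1 : ℂ) ((1 - z) / 2) = halfSeries (hypCoeff ν) z := by
  rw [ordinaryHypergeometric_eq_tsum]
  rfl

/-- The hypergeometric series satisfies the Volterra equation. -/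
lemma halfSeries_hypCoeff_eq (ν : ℂ) {z : ℂ} (hz : z ∈ Metric.ball (1 : ℂ) 2) :
    halfSeries (hypCoeff ν) z
      = 1 + volterra (fun w => ν * (ν + 1) * halfSeries (hypCoeff ν) w) z := by
  obtain ⟨B, hB⟩ := exists_bound_hypCoeff ν
  obtain ⟨B', hB'⟩ := exists_bound_mul_hypCoeff ν
  have hs : StarConvex ℝ 1 (Metric.ball (1 : ℂ) 2) :=
    (convex_ball (1 : ℂ) 2).starConvex (Metric.mem_ball_self two_pos)
  have hB1 : ∀ k : ℕ, ‖((k : ℂ) + 1) * hypCoeff ν (k + 1)‖ ≤ B' := fun k => by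
    simpa using hB' (k + 1)
  have hB2 : ∀ k : ℕ, ‖hypCoeff ν k / ((k : ℂ) + 1)‖ ≤ B := fun k => by
    rw [norm_div]
    refine (div_le_self (norm_nonneg _) ?_).trans (hB k)
    rw [← Nat.cast_succ, Complex.norm_natCast]; simp
  -- `(w + 1) y' = lam * avg y`, read off from the coefficients
  have h1 : Set.EqOn (fun w => avg (halfSeries (hypCoeff ν)) w / (w + 1) * (ν * (ν + 1)))
      (fun w => -(1 / 2) * halfSeries (fun k => ((k : ℂ) + 1) * hypCoeff ν (k + 1)) w)
      (Metric.ball 1 2) := by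
    intro w hw
    simp only
    rw [avg_halfSeries hB hw, div_mul_eq_mul_div,
      div_eq_iff (add_one_ne_zero_of_mem (ball_subset_cutPlane hw))]
    have e1 := summable_halfSeries hB2 hw
    have e2 := summable_halfSeries hB1 hw
    have e3 := summable_halfSeries hB' hw
    have s0 : ∑' k : ℕ, (k : ℂ) * hypCoeff ν k * ((1 - w) / 2) ^ k =
        (1 - w) / 2 * halfSeries (fun k => ((k : ℂ) + 1) * hypCoeff ν (k + 1)) w := by
      rw [e3.tsum_eq_zero_add, halfSeries, ← tsum_mul_left]
      simp only [Nat.cast_zero, zero_mul, zero_add, Nat.cast_add, Nat.cast_one]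
      exact tsum_congr fun k => by ring
    have s1 : halfSeries (fun k => hypCoeff ν k / ((k : ℂ) + 1)) w * (ν * (ν + 1)) =
        ∑' k : ℕ, (k : ℂ) * hypCoeff ν k * ((1 - w) / 2) ^ k
          - halfSeries (fun k => ((k : ℂ) + 1) * hypCoeff ν (k + 1)) w := by
      rw [halfSeries, halfSeries, ← e3.tsum_sub e2, ← tsum_mul_right]
      refine tsum_congr fun k => ?_
      have hk : (k : ℂ) + 1 ≠ 0 := by exact_mod_cast k.succ_ne_zero
      have := hypCoeff_succ ν k
      have e : hypCoeff ν k / ((k : ℂ) + 1) * (ν * (ν + 1)) =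
          k * hypCoeff ν k - (k + 1) * hypCoeff ν (k + 1) := by
        field_simp
        linear_combination this
      linear_combination e * ((1 - w) / 2) ^ k
    rw [s1, s0]
    ring
  have h2 : volterra (fun w => ν * (ν + 1) * halfSeries (hypCoeff ν) w) z =
      (z - 1) * avg (fun w => -(1 / 2) *
        halfSeries (fun k => ((k : ℂ) + 1) * hypCoeff ν (k + 1)) w) z := by
    rw [volterra_const_mul, volterra, mul_left_comm, ← avg_const_mul]
    congr 1
    refine avg_congr hs (fun w hw => ?_) hz
    refine Eq.trans ?_ (h1 hw)
    simp only; ring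
  rw [h2, avg_const_mul, avg_halfSeries hB1 hz, halfSeries, halfSeries,
    (summable_halfSeries hB hz).tsum_eq_zero_add, ← mul_assoc, ← tsum_mul_left,
    hypCoeff_zero]
  congr 1
  · simp
  · refine tsum_congr fun k => ?_
    have hk : (k : ℂ) + 1 ≠ 0 := by exact_mod_cast k.succ_ne_zero
    rw [mul_div_cancel_left₀ _ hk]; ring

lemma legendreFn_eqOn_halfSeries (ν : ℂ) :
    Set.EqOn (legendreFn (ν * (ν + 1))) (halfSeries (hypCoeff ν)) (Metric.ball 1 2) := by
  obtain ⟨B, hB⟩ := exists_bound_hypCoeff ν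
  refine volterra_unique (h := fun _ => 0) (c := 1) (lam := ν * (ν + 1)) Metric.isOpen_ball
    ((convex_ball (1 : ℂ) 2).starConvex (Metric.mem_ball_self two_pos)) ball_subset_cutPlane
    ((differentiableOn_legendreFn _).mono ball_subset_cutPlane)
    (differentiableOn_halfSeries hB) (differentiableOn_const _) (fun z hz => ?_) (fun z hz => ?_)
  · simpa using legendreFn_eq (ball_subset_cutPlane hz)
  · simpa using halfSeries_hypCoeff_eq ν hz

lemma isLegendreContinuation_legendreFn (ν : ℂ) :
    IsLegendreContinuation ν (legendreFn (ν * (ν + 1))) :=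
  ⟨differentiableOn_legendreFn _, fun z hz => by
    rw [hypergeometric_eq_halfSeries]; exact legendreFn_eqOn_halfSeries ν hz⟩

lemma legendreP_eq (ν : ℂ) {z : ℂ} (hz : z ∈ cutPlane) :
    legendreP ν z = legendreFn (ν * (ν + 1)) z := by
  have h1 := isLegendreContinuation_legendreFn ν
  have h2 : IsLegendreContinuation ν (legendreP ν) := Classical.epsilon_spec ⟨_, h1⟩
  have hp : IsPreconnected cutPlane :=
    (starConvex_cutPlane.isPathConnected one_mem_cutPlane).isConnected.isPreconnected
  refine (h2.1.analyticOnNhd isOpen_cutPlane).eqOn_of_preconnected_of_eventuallyEq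
    (h1.1.analyticOnNhd isOpen_cutPlane) hp one_mem_cutPlane ?_ hz
  filter_upwards [Metric.ball_mem_nhds (1 : ℂ) two_pos] with w hw
  rw [h2.2 w hw, h1.2 w hw]

/-! ### Legendre polynomials -/

section Rodrigues

open Polynomial

lemma legendrePoly_zero : legendrePoly 0 = 1 := by simp [legendrePoly]

/-- The equation satisfied by `(X² - 1) ^ n`, differentiated `m + 1` times; Legendre's equation is
the case `m = n`. -/
lemma rodrigues_iterate_ode (n m : ℕ) :
    (X ^ 2 - 1) * derivative^[m + 2] ((X ^ 2 - 1 : ℂ[X]) ^ n)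
        + 2 * ((m : ℂ[X]) + 1) * X * derivative^[m + 1] ((X ^ 2 - 1) ^ n)
        + (m : ℂ[X]) * ((m : ℂ[X]) + 1) * derivative^[m] ((X ^ 2 - 1) ^ n)
      = 2 * (n : ℂ[X]) * X * derivative^[m + 1] ((X ^ 2 - 1) ^ n)
        + 2 * (n : ℂ[X]) * ((m : ℂ[X]) + 1) * derivative^[m] ((X ^ 2 - 1) ^ n) := by
  induction m with
  | zero =>
    have h : (X ^ 2 - 1) * derivative ((X ^ 2 - 1 : ℂ[X]) ^ n)
        = 2 * (n : ℂ[X]) * X * (X ^ 2 - 1) ^ n := by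
      rw [derivative_pow]
      rcases n with _ | n
      · simp
      · simp [pow_succ]; ring
    have h' := congrArg derivative h
    simp only [derivative_mul, derivative_sub, derivative_X_pow, derivative_one, derivative_X,
      derivative_natCast, derivative_ofNat] at h'
    simp only [Function.iterate_succ_apply', Function.iterate_zero, id]
    have hC : (C (2 : ℂ)) = 2 := map_ofNat C 2
    simp [hC] at h' ⊢
    linear_combination h'
  | succ m ih =>
    have h' := congrArg derivative ih
    simp only [derivative_add, derivative_mul, derivative_sub, derivative_X_pow, derivative_one,
      derivative_X, derivative_natCast, derivative_ofNat, ← Function.iterate_succ_apply'] at h'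
    have hC : (C (2 : ℂ)) = 2 := map_ofNat C 2
    simp [hC] at h' ⊢
    linear_combination h'

lemma legendrePoly_ode (n : ℕ) :
    (X ^ 2 - 1) * derivative (derivative (legendrePoly n)) + 2 * X * derivative (legendrePoly n)
      = (n : ℂ[X]) * ((n : ℂ[X]) + 1) * legendrePoly n := by
  have h := rodrigues_iterate_ode n n
  simp only [Function.iterate_succ_apply'] at h
  simp only [legendrePoly, derivative_C_mul]
  linear_combination (C ((1 : ℂ) / (2 ^ n * n.factorial))) * h

lemma derivative_legendrePoly_succ (n : ℕ) :
    derivative (legendrePoly (n + 1))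
      = X * derivative (legendrePoly n) + ((n : ℂ[X]) + 1) * legendrePoly n := by
  have h1 : derivative ((X ^ 2 - 1 : ℂ[X]) ^ (n + 1))
      = C (2 * ((n : ℂ) + 1)) * ((X ^ 2 - 1) ^ n * X) := by
    have hC : (C (2 : ℂ)) = 2 := map_ofNat C 2
    rw [derivative_pow]; simp [hC]; ring
  have h2 : derivative (derivative^[n + 1] ((X ^ 2 - 1 : ℂ[X]) ^ (n + 1)))
      = C (2 * ((n : ℂ) + 1)) * (derivative^[n + 1] ((X ^ 2 - 1) ^ n) * X
        + ((n : ℂ[X]) + 1) * derivative^[n] ((X ^ 2 - 1) ^ n)) := by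
    rw [← Function.iterate_succ_apply' (derivative : ℂ[X] → ℂ[X]), Function.iterate_succ_apply, h1,
      iterate_derivative_C_mul,
      iterate_derivative_mul_X]
    simp
  have h3 : ((n : ℂ) + 1) ≠ 0 := by exact_mod_cast n.succ_ne_zero
  have h4 : (n.factorial : ℂ) ≠ 0 := by exact_mod_cast n.factorial_ne_zero
  have h5 : (C ((1 : ℂ) / (2 ^ (n + 1) * (n + 1).factorial)) : ℂ[X]) * C (2 * ((n : ℂ) + 1))
      = C ((1 : ℂ) / (2 ^ n * n.factorial)) := by
    rw [← C_mul]
    congr 1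
    rw [Nat.factorial_succ]; push_cast; field_simp; ring
  simp only [legendrePoly, derivative_C_mul]
  rw [h2, ← mul_assoc, h5, Function.iterate_succ_apply']
  ring

lemma legendrePoly_eval_one (n : ℕ) :
    (legendrePoly n).eval 1 = 1 ∧
      2 * (derivative (legendrePoly n)).eval 1 = (n : ℂ) * (n + 1) := by
  have hode : ∀ n : ℕ, 2 * (derivative (legendrePoly n)).eval 1
      = (n : ℂ) * (n + 1) * (legendrePoly n).eval 1 := fun n => by
    simpa using congrArg (eval 1) (legendrePoly_ode n)
  induction n with
  | zero => simp [legendrePoly_zero]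
  | succ n ih =>
    have h := congrArg (eval 1) (derivative_legendrePoly_succ n)
    simp only [eval_add, eval_mul, eval_X, eval_natCast, eval_one, ih.1] at h
    have h2 := hode (n + 1)
    have h3 : ((n : ℂ) + 1) ≠ 0 := by exact_mod_cast n.succ_ne_zero
    have h4 : ((n : ℂ) + 1 + 1) ≠ 0 := by exact_mod_cast (n + 1).succ_ne_zero
    have h5 : 2 * (derivative (legendrePoly (n + 1))).eval 1 = ((n : ℂ) + 1) * (n + 1 + 1) := by
      linear_combination 2 * h + ih.2
    push_cast at h2 ⊢
    refine ⟨?_, h5⟩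
    apply mul_left_cancel₀ (mul_ne_zero h3 h4)
    rw [← h2, h5, mul_one]

lemma iterate_derivative_comp_neg_X (p : ℂ[X]) (k : ℕ) :
    derivative^[k] (p.comp (-X)) = (-1) ^ k * (derivative^[k] p).comp (-X) := by
  induction k with
  | zero => simp
  | succ k ih =>
    rw [Function.iterate_succ_apply', ih, Function.iterate_succ_apply', derivative_mul,
      derivative_comp]
    have : derivative ((-1 : ℂ[X]) ^ k) = 0 := by
      rw [show ((-1 : ℂ[X]) ^ k) = C ((-1) ^ k) by simp]; exact derivative_C
    rw [this]; simp; ring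

lemma legendrePoly_comp_neg_X (n : ℕ) :
    (legendrePoly n).comp (-X) = (-1) ^ n * legendrePoly n := by
  have h := iterate_derivative_comp_neg_X ((X ^ 2 - 1) ^ n) n
  have h2 : ((X ^ 2 - 1 : ℂ[X]) ^ n).comp (-X) = (X ^ 2 - 1) ^ n := by simp
  rw [h2] at h
  have h3 : ((-1 : ℂ[X]) ^ n) * (-1) ^ n = 1 := by rw [← mul_pow]; simp
  rw [legendrePoly, mul_comp, C_comp]
  linear_combination (-(C ((1 : ℂ) / (2 ^ n * n.factorial))) * (-1) ^ n) * h
    - C ((1 : ℂ) / (2 ^ n * n.factorial)) *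
      (derivative^[n] ((X ^ 2 - 1 : ℂ[X]) ^ n)).comp (-X) * h3

/-- A polynomial with vanishing derivative and a zero vanishes; here this turns the derivative
recurrence and Legendre's equation into the second derivative recurrence. -/
lemma X_mul_derivative_legendrePoly_succ (n : ℕ) :
    X * derivative (legendrePoly (n + 1))
      = derivative (legendrePoly n) + ((n : ℂ[X]) + 1) * legendrePoly (n + 1) := by
  set E : ℂ[X] := X * derivative (legendrePoly (n + 1))
    - derivative (legendrePoly n) - ((n : ℂ[X]) + 1) * legendrePoly (n + 1) with hE
  have hA := derivative_legendrePoly_succ n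
  have hd : derivative E = 0 := by
    have hode := legendrePoly_ode n
    have e : E = (X ^ 2 - 1) * derivative (legendrePoly n) + ((n : ℂ[X]) + 1) * X * legendrePoly n
        - ((n : ℂ[X]) + 1) * legendrePoly (n + 1) := by
      rw [hE, hA]; ring
    rw [e]
    simp only [derivative_sub, derivative_add, derivative_mul, derivative_X_pow, derivative_one,
      derivative_natCast, derivative_X, hA]
    have hC2 : (C (2 : ℂ)) = 2 := map_ofNat C 2
    simp [hC2]
    linear_combination hode
  have h1 : E.eval 1 = 0 := by
    have a := legendrePoly_eval_one n
    have b := legendrePoly_eval_one (n + 1)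
    push_cast at b
    simp only [hE, eval_sub, eval_mul, eval_X, eval_add, eval_natCast, eval_one, b.1]
    linear_combination (1 / 2) * b.2 - (1 / 2) * a.2
  have hC := eq_C_of_derivative_eq_zero hd
  rw [hC, eval_C] at h1
  rw [h1, C_0] at hC
  linear_combination hC

lemma add_one_mul_derivative_legendrePoly (n : ℕ) :
    (X + 1) * derivative (legendrePoly n) - (n : ℂ[X]) * legendrePoly n
      = ∑ k ∈ Finset.range n, (2 * (k : ℂ[X]) + 1) * legendrePoly k := by
  induction n with
  | zero => simp [legendrePoly_zero]
  | succ n ih =>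
    rw [Finset.sum_range_succ, ← ih]
    have hA := derivative_legendrePoly_succ n
    have hB := X_mul_derivative_legendrePoly_succ n
    push_cast
    linear_combination hA + hB

end Rodrigues

/-- The derivative of the Legendre polynomial. -/
noncomputable def legP' (n : ℕ) (z : ℂ) : ℂ := (Polynomial.derivative (legendrePoly n)).eval z

lemma hasDerivAt_legP (n : ℕ) (z : ℂ) : HasDerivAt (legP n) (legP' n z) z :=
  (legendrePoly n).hasDerivAt z

lemma differentiable_legP (n : ℕ) : Differentiable ℂ (legP n) := (legendrePoly n).differentiable

lemma hasDerivAt_flux_legP (n : ℕ) (z : ℂ) :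
    HasDerivAt (fun z => (1 - z ^ 2) * legP' n z) (-((n : ℂ) * (n + 1) * legP n z)) z := by
  have h1 : HasDerivAt (fun z : ℂ => 1 - z ^ 2) (-(2 * z)) z := by
    simpa using (hasDerivAt_pow 2 z).const_sub 1
  refine (h1.mul ((Polynomial.derivative (legendrePoly n)).hasDerivAt z)).congr_deriv ?_
  have h := congrArg (Polynomial.eval z) (legendrePoly_ode n)
  simp only [Polynomial.eval_add, Polynomial.eval_mul, Polynomial.eval_sub, Polynomial.eval_pow,
    Polynomial.eval_X, Polynomial.eval_one, Polynomial.eval_natCast, Polynomial.eval_ofNat] at h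
  rw [legP]
  linear_combination -h

lemma legP_one (n : ℕ) : legP n 1 = 1 := (legendrePoly_eval_one n).1

lemma legP_neg (n : ℕ) (z : ℂ) : legP n (-z) = (-1) ^ n * legP n z := by
  have h := congrArg (Polynomial.eval z) (legendrePoly_comp_neg_X n)
  simpa [legP] using h

lemma legP'_neg (n : ℕ) (z : ℂ) : legP' n (-z) = -(-1) ^ n * legP' n z := by
  have h1 : HasDerivAt (fun z => legP n (-z)) (-legP' n (-z)) z := by
    simpa [Function.comp_def] using (hasDerivAt_legP n (-z)).comp z (hasDerivAt_neg z)
  have h2 := (hasDerivAt_legP n z).const_mul ((-1) ^ n)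
  simp only [legP_neg] at h1
  have := h1.unique h2
  linear_combination -this

lemma add_mul_legP' (n : ℕ) (z : ℂ) :
    (1 + z) * legP' n z - n * legP n z
      = ∑ k ∈ Finset.range n, (2 * (k : ℂ) + 1) * legP k z := by
  have h := congrArg (Polynomial.eval z) (add_one_mul_derivative_legendrePoly n)
  simp only [Polynomial.eval_finsetSum, Polynomial.eval_add, Polynomial.eval_mul,
    Polynomial.eval_sub, Polynomial.eval_X, Polynomial.eval_one, Polynomial.eval_natCast,
    Polynomial.eval_ofNat] at h
  simp only [legP, legP']
  rw [← h]; ring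

lemma sub_mul_legP' (n : ℕ) (z : ℂ) :
    (1 - z) * legP' n z + n * legP n z
      = -∑ k ∈ Finset.range n, (-1) ^ (n + k) * (2 * (k : ℂ) + 1) * legP k z := by
  have h := add_mul_legP' n (-z)
  simp only [legP_neg, legP'_neg] at h
  have h3 : ((-1 : ℂ) ^ n) * (-1) ^ n = 1 := by rw [← mul_pow]; simp
  have h4 : ∑ k ∈ Finset.range n, (-1 : ℂ) ^ (n + k) * (2 * (k : ℂ) + 1) * legP k z
      = (-1) ^ n * ∑ k ∈ Finset.range n, (2 * (k : ℂ) + 1) * ((-1) ^ k * legP k z) := by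
    rw [Finset.mul_sum]
    exact Finset.sum_congr rfl fun k _ => by rw [pow_add]; ring
  rw [h4, ← h]
  linear_combination (-((1 - z) * legP' n z + n * legP n z)) * h3

/-! ### Alternating harmonic numbers and the coefficients of `B_n` and `C_n` -/

/-- The alternating harmonic number `1 - 1/2 + 1/3 - ⋯ ± 1/m`. -/
noncomputable def altHarm (m : ℕ) : ℂ := ∑ i ∈ Finset.range m, (-1) ^ i / ((i : ℂ) + 1)

lemma psi_succ_succ (m : ℕ) : psi (m + 1 + 1) = psi (m + 1) + 1 / ((m : ℂ) + 1) := by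
  have h := Complex.digamma_apply_add_one ((m : ℂ) + 1) (fun k hk => by
    have h2 : ((m + 1 + k : ℕ) : ℂ) = 0 := by push_cast; rw [hk]; ring
    have h3 : m + 1 + k = 0 := by exact_mod_cast h2
    omega)
  simp only [psi]
  push_cast
  rw [h]
  simp

/-- The digamma values of `B_n` and `C_n` enter only through these differences. As `m` passes to
the even number `2j + 2`, the first term grows by `1 / (2j + 2)` and the second by twice as much,
which makes the signs alternate. -/
lemma psi_sub_psi_half (m : ℕ) : psi (m + 1) - psi (m / 2 + 1) = altHarm m := by
  have key : ∀ j : ℕ, psi (2 * j + 1) - psi (j + 1) = altHarm (2 * j) ∧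
      psi (2 * j + 1 + 1) - psi (j + 1) = altHarm (2 * j + 1) := by
    intro j
    induction j with
    | zero =>
      have := psi_succ_succ 0
      simp [altHarm] at this ⊢
      rw [this]; ring
    | succ j ih =>
      have h1 := psi_succ_succ j
      have h2 := psi_succ_succ (2 * j + 1)
      have h3 := psi_succ_succ (2 * j + 2)
      have e1 : altHarm (2 * j + 2) = altHarm (2 * j + 1) - 1 / (2 * (j : ℂ) + 2) := by
        rw [altHarm, Finset.sum_range_succ, ← altHarm, pow_succ, pow_mul]
        push_cast; simp; ring
      have e2 : altHarm (2 * j + 3) = altHarm (2 * j + 2) + 1 / (2 * (j : ℂ) + 3) := by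
        rw [altHarm, Finset.sum_range_succ, ← altHarm, pow_add, pow_mul]
        push_cast; simp; ring
      have hj : (j : ℂ) + 1 ≠ 0 := by exact_mod_cast j.succ_ne_zero
      have e3 : 1 / (2 * (j : ℂ) + 2) = 1 / 2 * (1 / ((j : ℂ) + 1)) := by
        rw [show 2 * (j : ℂ) + 2 = 2 * (j + 1) by ring]; field_simp
      have e4 : 1 / (((2 * j + 1 : ℕ) : ℂ) + 1) = 1 / 2 * (1 / ((j : ℂ) + 1)) := by
        rw [← e3]; push_cast; ring
      have e5 : 1 / (((2 * j + 2 : ℕ) : ℂ) + 1) = 1 / (2 * (j : ℂ) + 3) := by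
        push_cast; ring
      rw [e4] at h2
      rw [e5] at h3
      rw [e3] at e1
      rw [show 2 * (j + 1) = 2 * j + 2 by ring]
      refine ⟨?_, ?_⟩
      · linear_combination ih.2 + h2 - h1 - e1
      · linear_combination ih.2 + h2 - h1 - e1 + h3 - e2
  rcases Nat.even_or_odd' m with ⟨j, rfl | rfl⟩
  · rw [show 2 * j / 2 = j by omega]; exact (key j).1
  · rw [show (2 * j + 1) / 2 = j by omega]; exact (key j).2

lemma coeffA_eq {n k : ℕ} (h : k < n) :
    coeffA n k = 1 / ((n : ℂ) - k) - 1 / ((n : ℂ) + k + 1) := by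
  have h1 : (n : ℂ) - k ≠ 0 := sub_ne_zero.2 (by exact_mod_cast h.ne')
  have h2 : (n : ℂ) + k + 1 ≠ 0 := by exact_mod_cast (n + k).succ_ne_zero
  rw [coeffA]
  field_simp
  ring

lemma mul_coeffA {n k : ℕ} (h : k < n) :
    ((n : ℂ) - k) * (n + k + 1) * coeffA n k = 2 * k + 1 := by
  have h1 : (n : ℂ) - k ≠ 0 := sub_ne_zero.2 (by exact_mod_cast h.ne')
  have h2 : (n : ℂ) + k + 1 ≠ 0 := by exact_mod_cast (n + k).succ_ne_zero
  rw [coeffA]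
  field_simp

lemma coeffD_eq (n k : ℕ) : (2 * (k : ℂ) + 1) * coeffD n k = (2 * n + 1) * coeffA n k := by
  rw [coeffD, coeffA]; ring

lemma altHarm_sub_succ {n k : ℕ} (h : k < n) :
    (altHarm (n + k) - altHarm (n - k)) - (altHarm (n + (k + 1)) - altHarm (n - (k + 1)))
      = (-1) ^ (n + k) * coeffA n k := by
  obtain ⟨m, rfl⟩ := Nat.exists_eq_add_of_lt h
  have e1 : altHarm (k + m + 1 + (k + 1)) = altHarm (k + m + 1 + k)
      + (-1) ^ (k + m + 1 + k) / (((k + m + 1 + k : ℕ) : ℂ) + 1) := by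
    rw [show k + m + 1 + (k + 1) = k + m + 1 + k + 1 by ring, altHarm, Finset.sum_range_succ,
      ← altHarm]
  have e2 : altHarm (m + 1) = altHarm m + (-1) ^ m / ((m : ℂ) + 1) := by
    rw [altHarm, Finset.sum_range_succ, ← altHarm]
  have e3 : (-1 : ℂ) ^ (k + m + 1 + k) = -(-1) ^ m := by
    rw [show k + m + 1 + k = 2 * k + (m + 1) by ring, pow_add, pow_mul]; simp [pow_succ]
  rw [show k + m + 1 - k = m + 1 by omega, show k + m + 1 - (k + 1) = m by omega, e1, e2,
    coeffA_eq h, e3]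
  push_cast
  rw [show (k : ℂ) + m + 1 - k = m + 1 by ring]
  ring

/-- The alternating sums of the coefficients of `B_n` telescope to alternating harmonic numbers. -/
lemma sum_Ico_coeffA {n k : ℕ} (h : k ≤ n) :
    ∑ j ∈ Finset.Ico k n, (-1) ^ (n + j) * coeffA n j
      = altHarm (n + k) - altHarm (n - k) - altHarm (2 * n) := by
  have hs : ∑ j ∈ Finset.Ico k n, (-1) ^ (n + j) * coeffA n j
      = -∑ j ∈ Finset.Ico k n, ((altHarm (n + (j + 1)) - altHarm (n - (j + 1)))
        - (altHarm (n + j) - altHarm (n - j))) := by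
    rw [← Finset.sum_neg_distrib]
    refine Finset.sum_congr rfl fun j hj => ?_
    rw [← altHarm_sub_succ (Finset.mem_Ico.1 hj).2]; ring
  rw [hs, Finset.sum_Ico_sub (fun j => altHarm (n + j) - altHarm (n - j)) h, Nat.sub_self,
    two_mul]
  simp [altHarm]

/-! ### Linear combinations of Legendre polynomials -/

/-- The combination `∑ c k * P_k(z)` over `k ≤ n`. -/
noncomputable def legComb (c : ℕ → ℂ) (n : ℕ) (z : ℂ) : ℂ :=
  ∑ k ∈ Finset.range (n + 1), c k * legP k z

/-- The derivative of `legComb`. -/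
noncomputable def legComb' (c : ℕ → ℂ) (n : ℕ) (z : ℂ) : ℂ :=
  ∑ k ∈ Finset.range (n + 1), c k * legP' k z

section LegComb

variable (c : ℕ → ℂ) (n : ℕ) (z : ℂ)

lemma hasDerivAt_legComb : HasDerivAt (legComb c n) (legComb' c n z) z :=
  HasDerivAt.fun_sum fun k _ => (hasDerivAt_legP k z).const_mul (c k)

lemma hasDerivAt_flux_legComb : HasDerivAt (fun z => (1 - z ^ 2) * legComb' c n z)
    (-legComb (fun k => k * (k + 1) * c k) n z) z := by
  have h := HasDerivAt.fun_sum (u := Finset.range (n + 1))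
    fun k _ => (hasDerivAt_flux_legP k z).const_mul (c k)
  have e : (fun z => (1 - z ^ 2) * legComb' c n z) =
      fun z => ∑ k ∈ Finset.range (n + 1), c k * ((1 - z ^ 2) * legP' k z) := by
    funext w
    rw [legComb', Finset.mul_sum]
    exact Finset.sum_congr rfl fun k _ => by ring
  rw [e]
  refine h.congr_deriv ?_
  rw [legComb, ← Finset.sum_neg_distrib]
  exact Finset.sum_congr rfl fun k _ => by ring

lemma legComb_eigen : (n : ℂ) * (n + 1) * legComb c n z
    - legComb (fun k => k * (k + 1) * c k) n z
      = ∑ k ∈ Finset.range n, ((n : ℂ) - k) * (n + k + 1) * c k * legP k z := by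
  rw [legComb, legComb, Finset.mul_sum, ← Finset.sum_sub_distrib, Finset.sum_range_succ]
  have : (n : ℂ) * (n + 1) * (c n * legP n z) - n * (n + 1) * c n * legP n z = 0 := by ring
  rw [this, add_zero]
  exact Finset.sum_congr rfl fun k _ => by ring

end LegComb

/-- The coefficients of `B_n` in the Legendre polynomials. -/
noncomputable def coefB (n k : ℕ) : ℂ := if k = n then 4 * altHarm (2 * n) else 4 * coeffA n k

/-- The coefficients in the Legendre polynomials of `R_n(z) = (-1) ^ n B_n(-z) / 2`, the polynomial
part of the derivative of `P_ν` at `ν = n`. -/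
noncomputable def coefR (n k : ℕ) : ℂ := (-1) ^ (n + k) / 2 * coefB n k

/-- The coefficients of `C_n` in the Legendre polynomials; `κ` stands for the one of `P_n`. -/
noncomputable def coefC (κ : ℂ) (n k : ℕ) : ℂ :=
  if k = n then κ else 4 * ((-1) ^ (n + k) * coeffA n k *
    (2 * (altHarm (n + k) - altHarm (n - k)) - (-1) ^ (n + k) * coeffA n k - coeffD n k))

lemma polyB_eq (n : ℕ) (z : ℂ) : polyB n z = legComb (coefB n) n z := by
  rw [polyB, legComb, Finset.sum_range_succ, coefB, if_pos rfl, ← psi_sub_psi_half,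
    Nat.mul_div_cancel_left n two_pos, add_comm, Finset.mul_sum]
  congr 1
  refine Finset.sum_congr rfl fun k hk => ?_
  rw [coefB, if_neg (Finset.mem_range.1 hk).ne]; ring

lemma legComb_coefR (n : ℕ) (z : ℂ) :
    legComb (coefR n) n z = (-1) ^ n / 2 * polyB n (-z) := by
  rw [polyB_eq, legComb, legComb, Finset.mul_sum]
  refine Finset.sum_congr rfl fun k _ => ?_
  rw [legP_neg, coefR, pow_add]; ring

lemma exists_polyC_eq (n : ℕ) : ∃ κ, ∀ z, polyC n z = legComb (coefC κ n) n z := by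
  refine ⟨-(Real.pi : ℂ) ^ 2 / 3 + 4 * (psi (2 * n + 1) - psi (n + 1)) ^ 2
    + 4 * psi₁ (2 * n + 1) - 2 * psi₁ (n + 1), fun z => ?_⟩
  rw [polyC, legComb, Finset.sum_range_succ, coefC, if_pos rfl, add_comm, Finset.mul_sum]
  congr 1
  refine Finset.sum_congr rfl fun k hk => ?_
  rw [coefC, if_neg (Finset.mem_range.1 hk).ne, ← psi_sub_psi_half, ← psi_sub_psi_half]
  ring

lemma neg_one_pow_mul_self (m : ℕ) : ((-1 : ℂ) ^ m) * (-1) ^ m = 1 := by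
  rw [← mul_pow]; simp

lemma legComb_coefR_one (n : ℕ) : legComb (coefR n) n 1 = 0 := by
  have h := sum_Ico_coeffA (Nat.zero_le n)
  simp only [add_zero, Nat.sub_zero, sub_self, zero_sub, Nat.Ico_zero_eq_range] at h
  have h2 : ∑ k ∈ Finset.range n, coefR n k * legP k 1 =
      2 * ∑ k ∈ Finset.range n, (-1) ^ (n + k) * coeffA n k := by
    rw [Finset.mul_sum]
    refine Finset.sum_congr rfl fun k hk => ?_
    rw [legP_one, coefR, coefB, if_neg (Finset.mem_range.1 hk).ne]; ring
  rw [legComb, Finset.sum_range_succ, h2, h, legP_one, coefR, coefB, if_pos rfl, pow_add,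
    neg_one_pow_mul_self]
  ring

lemma legComb_coefB_eigen (n : ℕ) (z : ℂ) : (n : ℂ) * (n + 1) * legComb (coefB n) n z
    - legComb (fun k => k * (k + 1) * coefB n k) n z
      = 4 * ((1 + z) * legP' n z - n * legP n z) := by
  rw [legComb_eigen, add_mul_legP', Finset.mul_sum]
  refine Finset.sum_congr rfl fun k hk => ?_
  rw [coefB, if_neg (Finset.mem_range.1 hk).ne, ← mul_coeffA (Finset.mem_range.1 hk)]
  ring

lemma legComb_coefR_eigen (n : ℕ) (z : ℂ) : (n : ℂ) * (n + 1) * legComb (coefR n) n z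
    - legComb (fun k => k * (k + 1) * coefR n k) n z
      = -2 * ((1 - z) * legP' n z + n * legP n z) := by
  rw [legComb_eigen, sub_mul_legP', mul_neg, neg_mul, neg_neg, Finset.mul_sum]
  refine Finset.sum_congr rfl fun k hk => ?_
  rw [coefR, coefB, if_neg (Finset.mem_range.1 hk).ne, ← mul_coeffA (Finset.mem_range.1 hk)]
  ring

/-- Comparison of the coefficients of `P_k` in the equation that determines `C_n`. -/
lemma legComb_coefC_eigen (κ : ℂ) (n : ℕ) (z : ℂ) : (n : ℂ) * (n + 1) * legComb (coefC κ n) n z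
    - legComb (fun k => k * (k + 1) * coefC κ n k) n z
      = -2 * (2 * n + 1) * legComb (coefR n) n z - 2 * ((1 - z) * legComb' (coefB n) n z)
        + legComb (coefB n) n z := by
  have hB : (1 - z) * legComb' (coefB n) n z = -legComb (fun k => k * coefB n k) n z
      - ∑ k ∈ Finset.range n, 4 * (-1) ^ (n + k) * (altHarm (n + (k + 1)) - altHarm (n - (k + 1)))
        * (2 * k + 1) * legP k z := by
    have h1 : (1 - z) * legComb' (coefB n) n z = -legComb (fun k => k * coefB n k) n z
        - ∑ j ∈ Finset.range (n + 1), ∑ k ∈ Finset.range j,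
          coefB n j * ((-1) ^ (j + k) * (2 * (k : ℂ) + 1) * legP k z) := by
      rw [legComb', legComb, Finset.mul_sum, ← Finset.sum_neg_distrib, ← Finset.sum_sub_distrib]
      refine Finset.sum_congr rfl fun j _ => ?_
      rw [← Finset.mul_sum]
      linear_combination coefB n j * sub_mul_legP' j z
    rw [h1, Finset.sum_comm' (t' := Finset.range n) (s' := fun k => Finset.Ico (k + 1) (n + 1))
      (by intro j k; simp only [Finset.mem_range, Finset.mem_Ico]; omega)]
    congr 1
    refine Finset.sum_congr rfl fun k hk => ?_
    have hkn := Finset.mem_range.1 hk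
    have h2 : ∑ j ∈ Finset.Ico (k + 1) n, coefB n j *
        ((-1) ^ (j + k) * (2 * (k : ℂ) + 1) * legP k z) =
        4 * (-1) ^ (n + k) * (2 * k + 1) * legP k z *
          ∑ j ∈ Finset.Ico (k + 1) n, (-1) ^ (n + j) * coeffA n j := by
      rw [Finset.mul_sum]
      refine Finset.sum_congr rfl fun j hj => ?_
      rw [coefB, if_neg (Finset.mem_Ico.1 hj).2.ne]
      have hn := neg_one_pow_mul_self n
      simp only [pow_add]
      linear_combination (-4 * coeffA n j * (-1) ^ j * (-1) ^ k * (2 * k + 1) * legP k z) * hn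
    rw [Finset.sum_Ico_succ_top (by omega), h2, sum_Ico_coeffA (by omega), coefB, if_pos rfl]
    ring
  rw [legComb_eigen, hB, legComb, legComb, legComb, Finset.sum_range_succ, Finset.sum_range_succ,
    Finset.sum_range_succ]
  have hn : -2 * (2 * (n : ℂ) + 1) * (coefR n n * legP n z) + 2 * (n * coefB n n * legP n z)
      + coefB n n * legP n z = 0 := by
    rw [coefR, pow_add, neg_one_pow_mul_self]; ring
  have hsum : ∑ k ∈ Finset.range n, ((n : ℂ) - k) * (n + k + 1) * coefC κ n k * legP k z
      = -2 * (2 * n + 1) * ∑ k ∈ Finset.range n, coefR n k * legP k z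
        + 2 * ∑ k ∈ Finset.range n, k * coefB n k * legP k z
        + 2 * ∑ k ∈ Finset.range n, 4 * (-1) ^ (n + k) *
          (altHarm (n + (k + 1)) - altHarm (n - (k + 1))) * (2 * k + 1) * legP k z
        + ∑ k ∈ Finset.range n, coefB n k * legP k z := by
    simp only [Finset.mul_sum, ← Finset.sum_add_distrib]
    refine Finset.sum_congr rfl fun k hk => ?_
    have hkn := Finset.mem_range.1 hk
    have hT := altHarm_sub_succ hkn
    have hA := mul_coeffA hkn
    have hD := coeffD_eq n k
    have hs := neg_one_pow_mul_self (n + k)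
    rw [coefR, coefB, coefC, if_neg hkn.ne, if_neg hkn.ne]
    generalize altHarm (n + (k + 1)) - altHarm (n - (k + 1)) = T' at *
    generalize altHarm (n + k) - altHarm (n - k) = T at *
    generalize (-1 : ℂ) ^ (n + k) = s at *
    obtain rfl : T' = T - s * coeffA n k := by linear_combination -hT
    linear_combination (4 * s * (2 * T - s * coeffA n k - coeffD n k) * legP k z) * hA
      - 4 * s * legP k z * hD + 4 * coeffA n k * (2 * k + 1) * legP k z * hs
  rw [hsum]
  linear_combination -hn

/-! ### The first two derivatives of `P_ν` with respect to `ν` at `ν = n` -/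

lemma half_mem_slitPlane {z : ℂ} (hz : z ∈ Complex.slitPlane) : z / 2 ∈ Complex.slitPlane := by
  rw [Complex.mem_slitPlane_iff] at hz ⊢
  have h1 : (z / 2).re = z.re / 2 := by simp
  have h2 : (z / 2).im = z.im / 2 := by simp
  rw [h1, h2]
  rcases hz with h | h
  · left; linarith
  · right; intro h'; apply h; linarith

lemma hasDerivAt_log_half {z : ℂ} (hz : z ∈ cutPlane) :
    HasDerivAt (fun z => Complex.log ((z + 1) / 2)) (z + 1)⁻¹ z := by
  have h0 := add_one_ne_zero_of_mem hz
  have h1 : HasDerivAt (fun z : ℂ => (z + 1) / 2) (1 / 2) z :=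
    ((hasDerivAt_id z).add_const 1).div_const 2
  refine (h1.clog (half_mem_slitPlane hz)).congr_deriv ?_
  field_simp

/-- `ln((z + 1) / 2) / (z - 1)`, the singularity at `1` being removed. -/
noncomputable def logSlope : ℂ → ℂ := dslope (fun z => Complex.log ((z + 1) / 2)) 1

lemma differentiableOn_logSlope : DifferentiableOn ℂ logSlope cutPlane :=
  (Complex.differentiableOn_dslope (isOpen_cutPlane.mem_nhds one_mem_cutPlane)).2 fun _ hz =>
    (hasDerivAt_log_half hz).differentiableAt.differentiableWithinAt

lemma sub_mul_logSlope (z : ℂ) : (z - 1) * logSlope z = Complex.log ((z + 1) / 2) := by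
  have := sub_smul_dslope (fun z => Complex.log ((z + 1) / 2)) 1 z
  rw [smul_eq_mul] at this
  rw [logSlope, this]
  norm_num

lemma dilog_half_eq (z : ℂ) : dilog ((1 - z) / 2) = -((z - 1) * avg logSlope z) := by
  rw [dilog, avg, ← intervalIntegral.integral_const_mul]
  congr 1
  refine intervalIntegral.integral_congr_ae (Eventually.of_forall fun t ht => ?_)
  rw [Set.uIoc_of_le zero_le_one] at ht
  have ht0 : (t : ℂ) ≠ 0 := Complex.ofReal_ne_zero.2 ht.1.ne'
  have h := sub_mul_logSlope (1 + t * (z - 1))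
  rw [show (1 : ℂ) - t * ((1 - z) / 2) = (1 + t * (z - 1) + 1) / 2 by ring, ← h]
  field_simp
  ring

lemma hasDerivAt_dilog_half {z : ℂ} (hz : z ∈ cutPlane) :
    HasDerivAt (fun z => dilog ((1 - z) / 2)) (-logSlope z) z := by
  simp only [dilog_half_eq]
  exact (hasDerivAt_mul_avg isOpen_cutPlane starConvex_cutPlane differentiableOn_logSlope hz).neg

lemma dilog_zero : dilog 0 = 0 := by simp [dilog]

/-- A version of `eq_add_volterra_of_ode` for functions on the cut plane with an explicit formula
`v` for the product `(1 - z²) f'`. -/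
lemma eq_add_volterra_of_flux {f f' v h : ℂ → ℂ} (hf : ∀ z ∈ cutPlane, HasDerivAt f (f' z) z)
    (hv : ∀ z ∈ cutPlane, (1 - z ^ 2) * f' z = v z)
    (hv' : ∀ z ∈ cutPlane, HasDerivAt v (-h z) z) (hh : DifferentiableOn ℂ h cutPlane) {z : ℂ}
    (hz : z ∈ cutPlane) : f z = f 1 + volterra h z := by
  refine eq_add_volterra_of_ode isOpen_cutPlane starConvex_cutPlane subset_rfl one_mem_cutPlane hf
    hh (fun w hw => (hv' w hw).congr_of_eventuallyEq ?_) hz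
  filter_upwards [isOpen_cutPlane.mem_nhds hw] with x hx using hv x hx

lemma volterra_eqOn {f g h : ℂ → ℂ} {c lam : ℂ} (hf : DifferentiableOn ℂ f cutPlane)
    (hg : DifferentiableOn ℂ g cutPlane) (hh : DifferentiableOn ℂ h cutPlane)
    (ef : ∀ z ∈ cutPlane, f z = c + volterra (fun w => lam * f w + h w) z)
    (eg : ∀ z ∈ cutPlane, g z = c + volterra (fun w => lam * g w + h w) z) :
    Set.EqOn f g cutPlane :=
  volterra_unique isOpen_cutPlane starConvex_cutPlane subset_rfl hf hg hh ef eg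

lemma volterra_add' {f g : ℂ → ℂ} (hf : DifferentiableOn ℂ f cutPlane)
    (hg : DifferentiableOn ℂ g cutPlane) {z : ℂ} (hz : z ∈ cutPlane) :
    volterra (fun w => f w + g w) z = volterra f z + volterra g z :=
  volterra_add isOpen_cutPlane starConvex_cutPlane subset_rfl hf hg hz

lemma legendreFn_natCast (n : ℕ) : Set.EqOn (legendreFn ((n : ℂ) * (n + 1))) (legP n) cutPlane := by
  have hd := (differentiable_legP n).differentiableOn (s := cutPlane)
  refine volterra_eqOn (h := fun _ => 0) (c := 1) (lam := (n : ℂ) * (n + 1))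
    (differentiableOn_legendreFn _) hd (differentiableOn_const _)
    (fun z hz => by simpa using legendreFn_eq hz) fun z hz => ?_
  have := eq_add_volterra_of_flux (fun w _ => hasDerivAt_legP n w) (fun _ _ => rfl)
    (fun w _ => hasDerivAt_flux_legP n w) (hd.const_mul _) hz
  simpa only [add_zero, legP_one] using this

/-- `∂P_ν/∂ν` at `ν = n`. -/
noncomputable def legendreDot (n : ℕ) (z : ℂ) : ℂ :=
  legP n z * Complex.log ((z + 1) / 2) + legComb (coefR n) n z

/-- `∂²P_ν/∂ν²` at `ν = n`; the multiple of `P_n` is such that the value at `1` is zero. -/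
noncomputable def legendreDdot (n : ℕ) (z : ℂ) : ℂ :=
  -2 * (legP n z * dilog ((1 - z) / 2)) + polyB n z * Complex.log ((z + 1) / 2)
    + (polyC n z - polyC n 1 * legP n z)

lemma hasDerivAt_legendreDot (n : ℕ) {z : ℂ} (hz : z ∈ cutPlane) :
    HasDerivAt (legendreDot n) (legP' n z * Complex.log ((z + 1) / 2) + legP n z * (z + 1)⁻¹
      + legComb' (coefR n) n z) z :=
  ((hasDerivAt_legP n z).mul (hasDerivAt_log_half hz)).add (hasDerivAt_legComb _ n z)

lemma hasDerivAt_one_sub (z : ℂ) : HasDerivAt (fun z : ℂ => 1 - z) (-1) z := by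
  simpa using (hasDerivAt_id z).const_sub 1

lemma legendreDot_eq (n : ℕ) {z : ℂ} (hz : z ∈ cutPlane) : legendreDot n z
    = 0 + volterra (fun w => (n : ℂ) * (n + 1) * legendreDot n w + (2 * n + 1) * legP n w) z := by
  have h1 : legendreDot n 1 = 0 := by
    rw [legendreDot, legComb_coefR_one]; norm_num
  rw [← h1]
  refine eq_add_volterra_of_flux (v := fun z => (1 - z ^ 2) * legP' n z * Complex.log ((z + 1) / 2)
      + (1 - z) * legP n z + (1 - z ^ 2) * legComb' (coefR n) n z)
    (fun w hw => hasDerivAt_legendreDot n hw) (fun w hw => ?_) (fun w hw => ?_) ?_ hz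
  · have := mul_inv_cancel₀ (add_one_ne_zero_of_mem hw)
    linear_combination (1 - w) * legP n w * this
  · have hv := (((hasDerivAt_flux_legP n w).mul (hasDerivAt_log_half hw)).add
      ((hasDerivAt_one_sub w).mul (hasDerivAt_legP n w))).add (hasDerivAt_flux_legComb (coefR n) n w)
    refine hv.congr_deriv ?_
    have h2 := mul_inv_cancel₀ (add_one_ne_zero_of_mem hw)
    have h3 := legComb_coefR_eigen n w
    rw [legendreDot]
    linear_combination (1 - w) * legP' n w * h2 + h3
  · refine DifferentiableOn.add (DifferentiableOn.const_mul (fun w hw => ?_) _)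
      ((differentiable_legP n).differentiableOn.const_mul _)
    exact (hasDerivAt_legendreDot n hw).differentiableAt.differentiableWithinAt

lemma differentiableOn_legendreDot (n : ℕ) : DifferentiableOn ℂ (legendreDot n) cutPlane :=
  fun _ hw => (hasDerivAt_legendreDot n hw).differentiableAt.differentiableWithinAt

/-- By the chain rule for `lam = ν (ν + 1)` the left-hand side is `∂P_ν/∂ν` at `ν = n`. -/
lemma legendreFn₁_natCast (n : ℕ) {z : ℂ} (hz : z ∈ cutPlane) :
    (2 * (n : ℂ) + 1) * legendreFn₁ ((n : ℂ) * (n + 1)) z = legendreDot n z := by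
  refine volterra_eqOn (f := fun z => (2 * (n : ℂ) + 1) * legendreFn₁ ((n : ℂ) * (n + 1)) z)
    (h := fun w => (2 * n + 1) * legP n w) (c := 0) (lam := (n : ℂ) * (n + 1))
    ((differentiableOn_legendreFn₁ _).const_mul _) (differentiableOn_legendreDot n)
    ((differentiable_legP n).differentiableOn.const_mul _) (fun w hw => ?_)
    (fun w hw => legendreDot_eq n hw) hz
  have h := legendreFn₁_eq (lam := (n : ℂ) * (n + 1)) hw
  rw [volterra_add' (((differentiableOn_legendreFn₁ _).const_mul _).const_mul _)
    ((differentiable_legP n).differentiableOn.const_mul _) hw, volterra_const_mul,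
    volterra_const_mul, volterra_const_mul, zero_add,
    ← volterra_congr starConvex_cutPlane (legendreFn_natCast n) hw]
  linear_combination (2 * (n : ℂ) + 1) * h

lemma legendreDdot_eq' (n : ℕ) : ∃ κ, ∀ z, legendreDdot n z =
    -2 * (legP n z * dilog ((1 - z) / 2)) + legComb (coefB n) n z * Complex.log ((z + 1) / 2)
    + (legComb (coefC κ n) n z - polyC n 1 * legP n z) := by
  obtain ⟨κ, hκ⟩ := exists_polyC_eq n
  exact ⟨κ, fun z => by rw [legendreDdot, polyB_eq, hκ z]⟩

lemma legendreDdot_one (n : ℕ) : legendreDdot n 1 = 0 := by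
  rw [legendreDdot, legP_one]; norm_num [dilog_zero]

lemma differentiableOn_legendreDdot (n : ℕ) : DifferentiableOn ℂ (legendreDdot n) cutPlane := by
  obtain ⟨κ, hκ⟩ := legendreDdot_eq' n
  intro z hz
  rw [funext hκ]
  have h1 := (hasDerivAt_legP n z).differentiableAt
  have h2 := (hasDerivAt_dilog_half hz).differentiableAt
  have h3 := (hasDerivAt_legComb (coefB n) n z).differentiableAt
  have h4 := (hasDerivAt_legComb (coefC κ n) n z).differentiableAt
  have h5 := (hasDerivAt_log_half hz).differentiableAt
  exact ((((h1.mul h2).const_mul (-2)).add (h3.mul h5)).add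
    (h4.sub (h1.const_mul _))).differentiableWithinAt

lemma legendreDdot_eq (n : ℕ) {z : ℂ} (hz : z ∈ cutPlane) : legendreDdot n z
    = 0 + volterra (fun w => (n : ℂ) * (n + 1) * legendreDdot n w
      + (2 * (2 * n + 1) * legendreDot n w + 2 * legP n w)) z := by
  obtain ⟨κ, hκ⟩ := legendreDdot_eq' n
  rw [← legendreDdot_one n]
  refine eq_add_volterra_of_flux
    (f' := fun z => -2 * (legP' n z * dilog ((1 - z) / 2) + legP n z * (-logSlope z))
      + (legComb' (coefB n) n z * Complex.log ((z + 1) / 2) + legComb (coefB n) n z * (z + 1)⁻¹)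
      + (legComb' (coefC κ n) n z - polyC n 1 * legP' n z))
    (v := fun z => -2 * ((1 - z ^ 2) * legP' n z * dilog ((1 - z) / 2)
        + (1 + z) * (legP n z * Complex.log ((z + 1) / 2)))
      + ((1 - z ^ 2) * legComb' (coefB n) n z * Complex.log ((z + 1) / 2)
        + (1 - z) * legComb (coefB n) n z)
      + ((1 - z ^ 2) * legComb' (coefC κ n) n z - polyC n 1 * ((1 - z ^ 2) * legP' n z)))
    (fun w hw => ?_) (fun w hw => ?_) (fun w hw => ?_) ?_ hz
  · rw [funext hκ]
    exact ((((hasDerivAt_legP n w).mul (hasDerivAt_dilog_half hw)).const_mul (-2)).add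
      ((hasDerivAt_legComb (coefB n) n w).mul (hasDerivAt_log_half hw))).add
      ((hasDerivAt_legComb (coefC κ n) n w).sub ((hasDerivAt_legP n w).const_mul _))
  · have h1 := mul_inv_cancel₀ (add_one_ne_zero_of_mem hw)
    have h2 := sub_mul_logSlope w
    linear_combination (1 - w) * legComb (coefB n) n w * h1 - 2 * (1 + w) * legP n w * h2
  · have hadd : HasDerivAt (fun z : ℂ => 1 + z) 1 w := by
      simpa using (hasDerivAt_id w).const_add 1
    have hv := (((((hasDerivAt_flux_legP n w).mul (hasDerivAt_dilog_half hw)).add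
      (hadd.mul ((hasDerivAt_legP n w).mul (hasDerivAt_log_half hw)))).const_mul (-2)).add
      (((hasDerivAt_flux_legComb (coefB n) n w).mul (hasDerivAt_log_half hw)).add
        ((hasDerivAt_one_sub w).mul (hasDerivAt_legComb (coefB n) n w)))).add
      ((hasDerivAt_flux_legComb (coefC κ n) n w).sub
        ((hasDerivAt_flux_legP n w).const_mul (polyC n 1)))
    refine hv.congr_deriv ?_
    have h1 := mul_inv_cancel₀ (add_one_ne_zero_of_mem hw)
    have h2 := sub_mul_logSlope w
    have h3 := legComb_coefB_eigen n w
    have h4 := legComb_coefC_eigen κ n w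
    rw [hκ w, legendreDot, Pi.mul_apply]
    linear_combination ((1 - w) * legComb' (coefB n) n w - 2 * legP n w) * h1
      - 2 * (1 + w) * legP' n w * h2 + Complex.log ((w + 1) / 2) * h3 + h4
  · exact ((differentiableOn_legendreDdot n).const_mul _).add
      (((differentiableOn_legendreDot n).const_mul _).add
        ((differentiable_legP n).differentiableOn.const_mul _))

/-- By the chain rule for `lam = ν (ν + 1)` the left-hand side is `∂²P_ν/∂ν²` at `ν = n`. -/
lemma legendreFn₂_natCast (n : ℕ) {z : ℂ} (hz : z ∈ cutPlane) :
    (2 * (n : ℂ) + 1) ^ 2 * legendreFn₂ ((n : ℂ) * (n + 1)) z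
      + 2 * legendreFn₁ ((n : ℂ) * (n + 1)) z = legendreDdot n z := by
  have d1 := differentiableOn_legendreFn₁ ((n : ℂ) * (n + 1))
  have d2 := differentiableOn_legendreFn₂ ((n : ℂ) * (n + 1))
  have d3 := (differentiable_legP n).differentiableOn (s := cutPlane)
  have d4 := differentiableOn_legendreDot n
  refine volterra_eqOn (f := fun z => (2 * (n : ℂ) + 1) ^ 2 * legendreFn₂ ((n : ℂ) * (n + 1)) z
      + 2 * legendreFn₁ ((n : ℂ) * (n + 1)) z)
    (h := fun w => 2 * (2 * n + 1) * legendreDot n w + 2 * legP n w) (c := 0)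
    (lam := (n : ℂ) * (n + 1)) ((d2.const_mul _).add (d1.const_mul _))
    (differentiableOn_legendreDdot n) ((d4.const_mul _).add (d3.const_mul _)) (fun w hw => ?_)
    (fun w hw => legendreDdot_eq n hw) hz
  have h1 := legendreFn₁_eq (lam := (n : ℂ) * (n + 1)) hw
  have h2 := legendreFn₂_eq (lam := (n : ℂ) * (n + 1)) hw
  have h3 : volterra (legendreDot n) w
      = (2 * (n : ℂ) + 1) * volterra (legendreFn₁ ((n : ℂ) * (n + 1))) w := by
    rw [← volterra_const_mul]
    exact volterra_congr starConvex_cutPlane (fun x hx => (legendreFn₁_natCast n hx).symm) hw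
  rw [volterra_add' (((d2.const_mul _).fun_add (d1.const_mul _)).const_mul _)
    ((d4.const_mul _).fun_add (d3.const_mul _)) hw, volterra_const_mul,
    volterra_add' (d2.const_mul _) (d1.const_mul _) hw, volterra_const_mul,
    volterra_const_mul, volterra_add' (d4.const_mul _) (d3.const_mul _) hw, volterra_const_mul,
    volterra_const_mul, zero_add, h3, ← volterra_congr starConvex_cutPlane (legendreFn_natCast n) hw]
  linear_combination (2 * (n : ℂ) + 1) ^ 2 * h2 + 2 * h1

/-! ### The reflection formula of the dilogarithm -/

/-- The complex plane cut along `(-∞, -1]` and `[1, ∞)`. -/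
def doubleCut : Set ℂ := {z | z ∈ cutPlane ∧ -z ∈ cutPlane}

lemma mem_cutPlane_of_im_ne_zero {z : ℂ} (hz : z.im ≠ 0) : z ∈ cutPlane := by
  right; simpa using hz

lemma mem_cutPlane_of_neg_one_lt {x : ℝ} (hx : -1 < x) : (x : ℂ) ∈ cutPlane := by
  left; simp; linarith

lemma mem_doubleCut_of_im_ne_zero {z : ℂ} (hz : z.im ≠ 0) : z ∈ doubleCut :=
  ⟨mem_cutPlane_of_im_ne_zero hz, mem_cutPlane_of_im_ne_zero (by simpa using hz)⟩

lemma ofReal_mem_doubleCut {x : ℝ} (h1 : -1 < x) (h2 : x < 1) : (x : ℂ) ∈ doubleCut :=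
  ⟨mem_cutPlane_of_neg_one_lt h1, by
    have := mem_cutPlane_of_neg_one_lt (x := -x) (by linarith)
    simpa using this⟩

lemma zero_mem_doubleCut : (0 : ℂ) ∈ doubleCut := by
  simpa using ofReal_mem_doubleCut (x := 0) (by norm_num) (by norm_num)

lemma isOpen_doubleCut : IsOpen doubleCut :=
  isOpen_cutPlane.inter (isOpen_cutPlane.preimage continuous_neg)

lemma starConvex_doubleCut : StarConvex ℝ 0 doubleCut := by
  have key : ∀ z ∈ cutPlane, ∀ a b : ℝ, 0 ≤ a → 0 ≤ b → a + b = 1 → b • z ∈ cutPlane := by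
    intro z hz a b ha hb hab
    have := Complex.starConvex_one_slitPlane hz ha hb hab
    simp only [cutPlane, Set.mem_ofPred_eq]
    convert this using 1
    have ha' : a = 1 - b := by linarith
    subst ha'
    simp only [Complex.real_smul]; push_cast; ring
  intro z hz a b ha hb hab
  rw [smul_zero, zero_add]
  refine ⟨key z hz.1 a b ha hb hab, ?_⟩
  rw [← smul_neg]
  exact key (-z) hz.2 a b ha hb hab

/-- A holomorphic function with vanishing derivative on the doubly cut plane is constant. -/
lemma eq_apply_zero_of_hasDerivAt_zero {f : ℂ → ℂ} (hf : ∀ z ∈ doubleCut, HasDerivAt f 0 z)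
    {z : ℂ} (hz : z ∈ doubleCut) : f z = f 0 :=
  eqOn_of_hasDerivAt_eq (g := fun _ => f 0) isOpen_doubleCut starConvex_doubleCut hf
    (fun z _ => hasDerivAt_const z _) zero_mem_doubleCut rfl hz

lemma logSlope_one : logSlope 1 = 1 / 2 := by
  rw [logSlope, dslope_same, (hasDerivAt_log_half one_mem_cutPlane).deriv]
  norm_num

lemma logSlope_eqOn : Set.EqOn logSlope (halfSeries fun k => 1 / (2 * ((k : ℂ) + 1)))
    (Metric.ball 1 2) := by
  intro z hz
  by_cases h1 : z = 1
  · subst h1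
    rw [logSlope_one, halfSeries, tsum_eq_single 0 (fun k hk => by simp [hk])]
    norm_num
  have h2 := (Complex.hasSum_taylorSeries_neg_log (norm_half_lt_one hz))
  rw [← hasSum_nat_add_iff' 1] at h2
  have hz1 : z - 1 ≠ 0 := sub_ne_zero.2 h1
  have h3 : Complex.log ((z + 1) / 2) = (z - 1) * halfSeries (fun k => 1 / (2 * ((k : ℂ) + 1))) z := by
    have h4 := h2.tsum_eq
    simp only [Finset.range_one, Finset.sum_singleton, pow_zero, Nat.cast_zero, div_zero,
      sub_zero] at h4
    rw [show (z + 1) / 2 = 1 - (1 - z) / 2 by ring, halfSeries, ← tsum_mul_left,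
      ← neg_neg (Complex.log _), ← h4, ← tsum_neg]
    refine tsum_congr fun k => ?_
    have hk : (k : ℂ) + 1 ≠ 0 := by exact_mod_cast k.succ_ne_zero
    push_cast
    field_simp
    ring
  exact mul_left_cancel₀ hz1 ((sub_mul_logSlope z).trans h3)

lemma dilog_eq_tsum {s : ℂ} (hs : ‖s‖ < 1) :
    dilog s = s * ∑' k : ℕ, 1 / ((k : ℂ) + 1) ^ 2 * s ^ k := by
  have hz : 1 - 2 * s ∈ Metric.ball (1 : ℂ) 2 := by
    rw [Metric.mem_ball, dist_eq_norm, sub_sub_cancel_left, norm_neg, norm_mul]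
    norm_num; linarith
  have hB : ∀ k : ℕ, ‖1 / (2 * ((k : ℂ) + 1))‖ ≤ 1 := fun k => by
    rw [norm_div, norm_mul, ← Nat.cast_succ, Complex.norm_natCast, norm_one]
    norm_num
    have h0 : (0 : ℝ) ≤ k := Nat.cast_nonneg k
    have : ((k : ℝ) + 1)⁻¹ ≤ 1 := inv_le_one_of_one_le₀ (by linarith)
    linarith
  have h := dilog_half_eq (1 - 2 * s)
  rw [show (1 - (1 - 2 * s)) / 2 = s by ring, avg_congr ((convex_ball (1 : ℂ) 2).starConvex
    (Metric.mem_ball_self two_pos)) logSlope_eqOn hz, avg_halfSeries hB hz, halfSeries,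
    show (1 - (1 - 2 * s)) / 2 = s by ring, sub_sub_cancel_left, neg_mul, neg_neg, mul_comm 2 s,
    mul_assoc, ← tsum_mul_left] at h
  rw [h]
  congr 1
  refine tsum_congr fun k => ?_
  have hk : (k : ℂ) + 1 ≠ 0 := by exact_mod_cast k.succ_ne_zero
  field_simp

lemma tendsto_dilog_one :
    Tendsto (fun y : ℝ => dilog y) (𝓝[<] 1) (𝓝 ((Real.pi : ℂ) ^ 2 / 6)) := by
  have hsum : HasSum (fun k : ℕ => 1 / ((k : ℂ) + 1) ^ 2) ((Real.pi : ℂ) ^ 2 / 6) := by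
    have h := (Complex.hasSum_ofReal.2 hasSum_zeta_two)
    rw [← hasSum_nat_add_iff' 1] at h
    simpa using h
  have h1 := Complex.tendsto_tsum_powerSeries_nhdsWithin_lt hsum.tendsto_sum_nat
  rw [tendsto_map'_iff] at h1
  have h2 : Tendsto (fun y : ℝ => (y : ℂ)) (𝓝[<] 1) (𝓝 1) :=
    (Complex.continuous_ofReal.tendsto' 1 1 (by simp)).mono_left nhdsWithin_le_nhds
  have h3 := h2.mul h1
  rw [one_mul] at h3
  refine h3.congr' ?_
  filter_upwards [Ioo_mem_nhdsLT (show (0 : ℝ) < 1 by norm_num)] with y hy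
  rw [dilog_eq_tsum (by rw [Complex.norm_real, Real.norm_of_nonneg hy.1.le]; exact hy.2)]
  rfl

lemma tendsto_log_mul_log :
    Tendsto (fun y : ℝ => Real.log (1 - y) * Real.log y) (𝓝[≠] 1) (𝓝 0) := by
  have h1 : Tendsto (fun y : ℝ => Real.log y / (y - 1)) (𝓝[≠] 1) (𝓝 1) := by
    have := hasDerivAt_iff_tendsto_slope.1 (Real.hasDerivAt_log one_ne_zero)
    simpa [slope_fun_def_field] using this
  have h2 : Tendsto (fun y : ℝ => (1 - y) * Real.log (1 - y)) (𝓝[≠] 1) (𝓝 0) := by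
    have h : Continuous fun y : ℝ => (1 - y) * Real.log (1 - y) :=
      Real.continuous_mul_log.comp (by fun_prop : Continuous fun y : ℝ => 1 - y)
    exact (h.tendsto' 1 0 (by simp)).mono_left nhdsWithin_le_nhds
  have h3 := (h2.mul h1).neg
  rw [zero_mul, neg_zero] at h3
  refine h3.congr' ?_
  filter_upwards [self_mem_nhdsWithin] with y hy
  have : y - 1 ≠ 0 := sub_ne_zero.2 hy
  field_simp
  ring

/-- The reflection formula off the real axis: the derivative of the difference of both sides
vanishes, and the constant is found by letting the real variable tend to `1`. -/
lemma dilog_reflection {z : ℂ} (hz : z ∈ doubleCut) :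
    dilog ((1 - z) / 2) + dilog ((1 + z) / 2)
      = (Real.pi : ℂ) ^ 2 / 6 - Complex.log ((1 - z) / 2) * Complex.log ((1 + z) / 2) := by
  set f : ℂ → ℂ := fun z => dilog ((1 - z) / 2) + dilog ((1 - -z) / 2)
    + Complex.log ((z + 1) / 2) * Complex.log ((-z + 1) / 2) with hf
  have hd : ∀ z ∈ doubleCut, HasDerivAt f 0 z := by
    intro z hz
    have h1 := hasDerivAt_dilog_half hz.1
    have h2 := (hasDerivAt_dilog_half hz.2).comp z (hasDerivAt_neg z)
    have h3 := hasDerivAt_log_half hz.1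
    have h4 := (hasDerivAt_log_half hz.2).comp z (hasDerivAt_neg z)
    refine ((h1.add h2).add (h3.mul h4)).congr_deriv ?_
    have e1 := sub_mul_logSlope z
    have e2 := sub_mul_logSlope (-z)
    have e3 := mul_inv_cancel₀ (add_one_ne_zero_of_mem hz.1)
    have e4 := mul_inv_cancel₀ (add_one_ne_zero_of_mem hz.2)
    simp only [Function.comp_apply]
    rw [← e1, ← e2]
    linear_combination (-logSlope (-z)) * e3 + logSlope z * e4
  have hlim : Tendsto (fun y : ℝ => f ((2 * y - 1 : ℝ) : ℂ)) (𝓝[<] 1)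
      (𝓝 (0 + (Real.pi : ℂ) ^ 2 / 6 + ((0 : ℝ) : ℂ))) := by
    refine Tendsto.add (Tendsto.add ?_ ?_) ?_
    · have h1 : Tendsto (fun z => dilog ((1 - z) / 2)) (𝓝 1) (𝓝 0) := by
        have := (hasDerivAt_dilog_half one_mem_cutPlane).continuousAt.tendsto
        simpa [dilog_zero] using this
      refine (h1.comp ?_)
      refine Tendsto.mono_left ?_ nhdsWithin_le_nhds
      exact (by fun_prop : Continuous fun y : ℝ => ((2 * y - 1 : ℝ) : ℂ)).tendsto' 1 1
        (by norm_num)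
    · refine tendsto_dilog_one.congr fun y => ?_
      congr 1; push_cast; ring
    · refine ((Complex.continuous_ofReal.tendsto 0).comp
        (tendsto_log_mul_log.mono_left (nhdsWithin_mono 1 fun y (hy : y < 1) => hy.ne))).congr' ?_
      filter_upwards [Ioo_mem_nhdsLT (show (0 : ℝ) < 1 by norm_num)] with y hy
      have e1 : (((2 * y - 1 : ℝ) : ℂ) + 1) / 2 = ((y : ℝ) : ℂ) := by push_cast; ring
      have e2 : (-((2 * y - 1 : ℝ) : ℂ) + 1) / 2 = ((1 - y : ℝ) : ℂ) := by push_cast; ring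
      rw [e1, e2, ← Complex.ofReal_log hy.1.le, ← Complex.ofReal_log (by linarith [hy.2])]
      simp only [Function.comp_apply]; push_cast; ring
  have hconst : Tendsto (fun y : ℝ => f ((2 * y - 1 : ℝ) : ℂ)) (𝓝[<] 1) (𝓝 (f 0)) := by
    refine tendsto_const_nhds.congr' ?_
    filter_upwards [Ioo_mem_nhdsLT (show (0 : ℝ) < 1 by norm_num)] with y hy
    exact (eq_apply_zero_of_hasDerivAt_zero hd
      (ofReal_mem_doubleCut (by linarith [hy.1]) (by linarith [hy.2]))).symm
  have h0 := tendsto_nhds_unique hconst hlim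
  have := (eq_apply_zero_of_hasDerivAt_zero hd hz).trans h0
  simp only [hf, Complex.ofReal_zero, zero_add, add_zero, sub_neg_eq_add] at this
  rw [show (1 - z) / 2 = (-z + 1) / 2 by ring, show (1 + z) / 2 = (z + 1) / 2 by ring]
  rw [show (1 - z) / 2 = (-z + 1) / 2 by ring, show (1 + z) / 2 = (z + 1) / 2 by ring] at this
  linear_combination this

/-- The integrand of the dilogarithm along the positive real axis. -/
noncomputable def dilogKernel (r : ℝ) : ℂ := Complex.log (1 - r) / r

lemma log_one_sub_of_le {r : ℝ} (hr : r ≤ 1) :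
    Complex.log (1 - r) = (Real.log (1 - r) : ℂ) := by
  rw [Complex.ofReal_log (by linarith)]; push_cast; rfl

lemma log_one_sub_of_lt {r : ℝ} (hr : 1 < r) :
    Complex.log (1 - r) = (Real.log (1 - r) : ℂ) + Real.pi * Complex.I := by
  have h1 : (1 : ℂ) - r = ((1 - r : ℝ) : ℂ) := by push_cast; ring
  rw [h1, Complex.log, Complex.arg_ofReal_of_neg (by linarith), Complex.norm_real, Real.norm_eq_abs,
    Real.log_abs]

lemma intervalIntegrable_log_one_sub (a b : ℝ) :
    IntervalIntegrable (fun r : ℝ => ((Real.log (1 - r) : ℝ) : ℂ)) MeasureTheory.volume a b := by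
  have h : IntervalIntegrable Real.log MeasureTheory.volume (1 - a) (1 - b) :=
    intervalIntegral.intervalIntegrable_log'
  have h2 := h.comp_sub_left 1
  simp only [sub_sub_cancel] at h2
  exact ⟨h2.1.ofReal, h2.2.ofReal⟩

lemma intervalIntegrable_dilogKernel {b : ℝ} (hb : 1 ≤ b) :
    IntervalIntegrable dilogKernel MeasureTheory.volume 0 b := by
  have hinv : ∀ a b : ℝ, 0 < a → a ≤ b → ContinuousOn (fun r : ℝ => ((r : ℂ))⁻¹) (Set.uIcc a b) := by
    intro a b ha hab
    rw [Set.uIcc_of_le hab]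
    exact ContinuousOn.inv₀ (by fun_prop) fun r hr =>
      Complex.ofReal_ne_zero.2 (by linarith [hr.1] : (0 : ℝ) < r).ne'
  have i1 : IntervalIntegrable dilogKernel MeasureTheory.volume 0 (1 / 2) := by
    have hc : ContinuousOn (fun r : ℝ => -2 * logSlope (1 - 2 * r)) (Set.uIcc 0 (1 / 2)) := by
      refine ContinuousOn.mul continuousOn_const
        (differentiableOn_logSlope.continuousOn.comp (by fun_prop) fun r hr => ?_)
      rw [Set.uIcc_of_le (by norm_num)] at hr
      have := mem_cutPlane_of_neg_one_lt (x := 1 - 2 * r) (by linarith [hr.2])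
      simpa using this
    refine hc.intervalIntegrable.congr fun r hr => ?_
    rw [Set.uIoc_of_le (by norm_num)] at hr
    have hr0 : (r : ℂ) ≠ 0 := Complex.ofReal_ne_zero.2 hr.1.ne'
    have h := sub_mul_logSlope (1 - 2 * r)
    simp only [dilogKernel]
    rw [show (1 : ℂ) - r = (1 - 2 * r + 1) / 2 by ring, ← h]
    field_simp
    ring
  have i2 : IntervalIntegrable dilogKernel MeasureTheory.volume (1 / 2) 1 := by
    refine ((intervalIntegrable_log_one_sub (1 / 2) 1).mul_continuousOn
      (hinv _ _ (by norm_num) (by norm_num))).congr fun r hr => ?_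
    rw [Set.uIoc_of_le (by norm_num)] at hr
    simp only [dilogKernel, log_one_sub_of_le hr.2, div_eq_mul_inv]
  have i3 : IntervalIntegrable dilogKernel MeasureTheory.volume 1 b := by
    refine (((intervalIntegrable_log_one_sub 1 b).add intervalIntegrable_const).mul_continuousOn
      (hinv _ _ (by norm_num) hb)).congr (f := fun r : ℝ =>
        ((Real.log (1 - r) : ℂ) + Real.pi * Complex.I) * ((r : ℂ))⁻¹) fun r hr => ?_
    rw [Set.uIoc_of_le hb] at hr
    simp only [dilogKernel, log_one_sub_of_lt hr.1, div_eq_mul_inv]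
  exact (i1.trans i2).trans i3

lemma dilog_ofReal {x : ℝ} (hx : x ≠ 0) : dilog x = -∫ r in (0 : ℝ)..x, dilogKernel r := by
  have h := intervalIntegral.smul_integral_comp_mul_right (a := 0) (b := 1) dilogKernel x
  rw [zero_mul, one_mul] at h
  have hx' : (x : ℂ) ≠ 0 := Complex.ofReal_ne_zero.2 hx
  rw [← h, dilog, ← intervalIntegral.integral_smul]
  congr 1
  refine intervalIntegral.integral_congr fun t _ => ?_
  simp only [dilogKernel, Complex.real_smul]
  push_cast
  rw [← div_div, mul_div_cancel₀ _ hx']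

lemma continuousAt_dilog_one : ContinuousAt (fun x : ℝ => dilog x) 1 := by
  have hi := intervalIntegrable_dilogKernel (b := 2) (by norm_num)
  have hc := intervalIntegral.continuousOn_primitive_interval' hi
    (Set.left_mem_uIcc)
  rw [Set.uIcc_of_le zero_le_two] at hc
  have h1 := (hc.continuousAt (Icc_mem_nhds (by norm_num : (0 : ℝ) < 1) (by norm_num))).neg
  refine h1.congr ?_
  filter_upwards [isOpen_ne.mem_nhds (one_ne_zero : (1 : ℝ) ≠ 0)] with x hx
  exact (dilog_ofReal hx).symm

lemma dilog_one : dilog 1 = (Real.pi : ℂ) ^ 2 / 6 := by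
  have h := continuousAt_dilog_one.tendsto.mono_left (nhdsWithin_le_nhds (s := Set.Iio 1))
  simpa using tendsto_nhds_unique h tendsto_dilog_one

lemma hasDerivAt_dilog_of_lt {x : ℝ} (hx : 1 < x) :
    HasDerivAt (fun x : ℝ => dilog x) (-(Complex.log (1 - x) / x)) x := by
  have hi := intervalIntegrable_dilogKernel (b := x) hx.le
  have hx0 : (x : ℂ) ≠ 0 := Complex.ofReal_ne_zero.2 (by linarith)
  have hcont : ContinuousOn dilogKernel (Set.Ioi 1) := by
    have h : ContinuousOn (fun r : ℝ =>
        ((Real.log (1 - r) : ℂ) + Real.pi * Complex.I) / (r : ℂ)) (Set.Ioi 1) := by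
      refine ContinuousOn.div (ContinuousOn.add ?_ continuousOn_const)
        Complex.continuous_ofReal.continuousOn fun r (hr : 1 < r) =>
          Complex.ofReal_ne_zero.2 (by linarith)
      exact Complex.continuous_ofReal.comp_continuousOn
        (ContinuousOn.log (by fun_prop) fun r (hr : 1 < r) => by linarith)
    refine h.congr fun r hr => ?_
    simp only [dilogKernel, log_one_sub_of_lt hr]
  have h := (intervalIntegral.integral_hasDerivAt_right hi
    (hcont.stronglyMeasurableAtFilter isOpen_Ioi x hx)
    (hcont.continuousAt (Ioi_mem_nhds hx))).neg
  refine h.congr_of_eventuallyEq ?_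
  filter_upwards [lt_mem_nhds hx] with r hr
  exact dilog_ofReal (by linarith)

/-- The reflection formula on the cut `(1, ∞)`, for the principal branches. -/
lemma dilog_reflection_of_lt {x : ℝ} (hx : 1 < x) :
    dilog x + dilog (1 - x)
      = (Real.pi : ℂ) ^ 2 / 6 - Complex.log x * Complex.log (1 - x) := by
  set f : ℝ → ℂ := fun x => dilog x + dilog ((1 - ((2 * x - 1 : ℝ) : ℂ)) / 2)
    + (Real.log x : ℂ) * ((Real.log (1 - x) : ℂ) + Real.pi * Complex.I) with hf
  have hd : ∀ x ∈ Set.Ioi (1 : ℝ), HasDerivAt f 0 x := by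
    intro x (hx : 1 < x)
    have h1 := hasDerivAt_dilog_of_lt hx
    have hm : ((2 * x - 1 : ℝ) : ℂ) ∈ cutPlane := mem_cutPlane_of_neg_one_lt (by linarith)
    have h2' : HasDerivAt (fun x : ℝ => ((2 * x - 1 : ℝ) : ℂ)) ((2 : ℝ) : ℂ) x :=
      HasDerivAt.ofReal_comp (by simpa using ((hasDerivAt_id x).const_mul 2).sub_const 1)
    have h2 := (hasDerivAt_dilog_half hm).comp x h2'
    have h3 := (Real.hasDerivAt_log (by linarith : x ≠ 0)).ofReal_comp
    have h4' : HasDerivAt (fun x : ℝ => Real.log (1 - x)) (-1 / (1 - x)) x :=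
      HasDerivAt.log (by simpa using (hasDerivAt_id x).const_sub 1) (by linarith)
    have h4 := h4'.ofReal_comp.add_const ((Real.pi : ℂ) * Complex.I)
    refine ((h1.add h2).add (h3.mul h4)).congr_deriv ?_
    have e1 := sub_mul_logSlope ((2 * x - 1 : ℝ) : ℂ)
    have e2 : (((2 * x - 1 : ℝ) : ℂ) + 1) / 2 = (x : ℂ) := by push_cast; ring
    rw [e2, ← Complex.ofReal_log (by linarith)] at e1
    have hx0 : (x : ℂ) ≠ 0 := Complex.ofReal_ne_zero.2 (by linarith)
    have hx1 : (1 : ℂ) - x ≠ 0 := by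
      have : ((1 - x : ℝ) : ℂ) ≠ 0 := Complex.ofReal_ne_zero.2 (by linarith)
      simpa using this
    rw [log_one_sub_of_lt hx]
    push_cast at e1 ⊢
    rw [← e1]
    field_simp
    ring
  have hconst : ∀ y : ℝ, 1 < y → f y = f x := by
    intro y hy
    exact isOpen_Ioi.is_const_of_deriv_eq_zero isPreconnected_Ioi
      (fun w hw => (hd w hw).differentiableAt.differentiableWithinAt)
      (fun w hw => (hd w hw).deriv) hy hx
  have hlim : Tendsto f (𝓝[>] 1)
      (𝓝 ((Real.pi : ℂ) ^ 2 / 6 + 0 + (((0 : ℝ) : ℂ) + 0 * (Real.pi * Complex.I)))) := by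
    refine Tendsto.add (Tendsto.add ?_ ?_) ?_
    · have h := continuousAt_dilog_one.tendsto.mono_left (nhdsWithin_le_nhds (s := Set.Ioi 1))
      simpa [dilog_one] using h
    · have h1 : Tendsto (fun z => dilog ((1 - z) / 2)) (𝓝 1) (𝓝 0) := by
        have := (hasDerivAt_dilog_half one_mem_cutPlane).continuousAt.tendsto
        simpa [dilog_zero] using this
      refine (h1.comp ?_)
      refine Tendsto.mono_left ?_ nhdsWithin_le_nhds
      exact (by fun_prop : Continuous fun y : ℝ => ((2 * y - 1 : ℝ) : ℂ)).tendsto' 1 1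
        (by norm_num)
    · have h1 := (Complex.continuous_ofReal.tendsto 0).comp
        (tendsto_log_mul_log.mono_left (nhdsWithin_mono 1 fun y (hy : 1 < y) => hy.ne'))
      have h2 : Tendsto (fun y : ℝ => (Real.log y : ℂ) * (Real.pi * Complex.I)) (𝓝[>] 1)
          (𝓝 (0 * (Real.pi * Complex.I))) := by
        refine Tendsto.mul_const _ ?_
        have h3 := (Complex.continuous_ofReal.continuousAt.comp
          (Real.continuousAt_log one_ne_zero)).tendsto.mono_left
          (nhdsWithin_le_nhds (s := Set.Ioi 1))
        simpa [Function.comp_def] using h3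
      refine (h1.add h2).congr fun y => ?_
      simp only [Function.comp_apply]; push_cast; ring
  have h0 := tendsto_nhds_unique (tendsto_const_nhds.congr'
    (by filter_upwards [self_mem_nhdsWithin] with y hy using (hconst y hy).symm)) hlim
  rw [log_one_sub_of_lt hx, ← Complex.ofReal_log (by linarith)]
  simp only [hf] at h0
  rw [show (1 - ((2 * x - 1 : ℝ) : ℂ)) / 2 = 1 - x by push_cast; ring] at h0
  simp only [Complex.ofReal_zero] at h0
  linear_combination h0

/-! ### The connection formula between `P_ν(-z)` and the solutions at `z = 1` -/

section Connection

/-- The product `(1 - z²) P_ν'(z)`. -/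
noncomputable def legendreFlux (lam z : ℂ) : ℂ := -(lam * ((z - 1) * avg (legendreFn lam) z))

/-- The product `(1 - z²) g'(z)` for `g = logFn lam`. -/
noncomputable def logFlux (lam z : ℂ) : ℂ := -((z - 1) * avg (logSource lam) z)

variable {lam z : ℂ}

lemma hasDerivAt_legendreFlux (hz : z ∈ cutPlane) :
    HasDerivAt (legendreFlux lam) (-(lam * legendreFn lam z)) z :=
  ((hasDerivAt_mul_avg isOpen_cutPlane starConvex_cutPlane (differentiableOn_legendreFn lam)
    hz).const_mul lam).neg

lemma hasDerivAt_logFlux (hz : z ∈ cutPlane) :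
    HasDerivAt (logFlux lam) (-logSource lam z) z :=
  (hasDerivAt_mul_avg isOpen_cutPlane starConvex_cutPlane (differentiableOn_logSource lam) hz).neg

/-- The Wronskian of `P_ν` and the logarithmic solution, in which the logarithms cancel. Its
derivative vanishes and its value is read off at `z = 1`. -/
lemma wronskian_log (hz : z ∈ cutPlane) :
    -((1 + z) * (legendreFn lam z * legendreFn lam z)) + legendreFn lam z * logFlux lam z
      - legendreFlux lam z * logFn lam z = -2 := by
  set W : ℂ → ℂ := fun z => -((1 + z) * (legendreFn lam z * legendreFn lam z))
    + legendreFn lam z * logFlux lam z - legendreFlux lam z * logFn lam z with hW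
  have hd : ∀ z ∈ cutPlane, HasDerivAt W 0 z := by
    intro z hz
    have hp := hasDerivAt_legendreFn (lam := lam) hz
    have hg := hasDerivAt_logFn (lam := lam) hz
    have hadd : HasDerivAt (fun z : ℂ => 1 + z) 1 z := by
      simpa using (hasDerivAt_id z).const_add 1
    refine (((hadd.mul (hp.mul hp)).neg.add (hp.mul (hasDerivAt_logFlux hz))).sub
      ((hasDerivAt_legendreFlux hz).mul hg)).congr_deriv ?_
    have h1 := add_one_ne_zero_of_mem hz
    simp only [legendreFlux, logFlux, Pi.mul_apply]
    field_simp
    rw [logSource]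
    ring
  have h1 : W 1 = -2 := by
    simp only [hW, legendreFn_one, logFn_one, logFlux]
    norm_num
  exact (eqOn_of_hasDerivAt_eq (g := fun _ => W 1) isOpen_cutPlane starConvex_cutPlane hd
    (fun z _ => hasDerivAt_const z _) one_mem_cutPlane rfl hz).trans h1

lemma hasDerivAt_legendreFn_neg (hz : -z ∈ cutPlane) :
    HasDerivAt (fun z => legendreFn lam (-z)) (-(lam * avg (legendreFn lam) (-z) / (-z + 1))) z := by
  refine ((hasDerivAt_legendreFn hz).comp z (hasDerivAt_neg z)).congr_deriv ?_
  ring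

lemma hasDerivAt_legendreFlux_neg (hz : -z ∈ cutPlane) :
    HasDerivAt (fun z => legendreFlux lam (-z)) (lam * legendreFn lam (-z)) z := by
  refine ((hasDerivAt_legendreFlux hz).comp z (hasDerivAt_neg z)).congr_deriv ?_
  ring

/-- The Wronskian of `P_ν(z)` and `P_ν(-z)` is constant. -/
lemma wronskian_neg (hz : z ∈ doubleCut) :
    legendreFn lam z * legendreFlux lam (-z) + legendreFlux lam z * legendreFn lam (-z)
      = 2 * (legendreFn lam 0 * legendreFlux lam 0) := by
  have h := eq_apply_zero_of_hasDerivAt_zero (f := fun z =>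
    legendreFn lam z * legendreFlux lam (-z) + legendreFlux lam z * legendreFn lam (-z))
    (fun z hz => by
      refine (((hasDerivAt_legendreFn hz.1).mul (hasDerivAt_legendreFlux_neg hz.2)).add
        ((hasDerivAt_legendreFlux hz.1).mul (hasDerivAt_legendreFn_neg hz.2))).congr_deriv ?_
      have h1 := add_one_ne_zero_of_mem hz.1
      have h2 := add_one_ne_zero_of_mem hz.2
      simp only [legendreFlux]
      field_simp
      ring) hz
  rw [h, neg_zero]; ring

/-- The Wronskian of `P_ν(-z)` and the logarithmic solution is constant. -/
lemma exists_wronskian_neg_log (lam : ℂ) : ∃ A, ∀ z ∈ doubleCut,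
    legendreFn lam (-z) * (legendreFlux lam z * Complex.log ((-z + 1) / 2)
        - (1 + z) * legendreFn lam z + logFlux lam z)
      + legendreFlux lam (-z) * (legendreFn lam z * Complex.log ((-z + 1) / 2) + logFn lam z)
      = A := by
  refine ⟨_, fun z hz => eq_apply_zero_of_hasDerivAt_zero (f := fun z =>
    legendreFn lam (-z) * (legendreFlux lam z * Complex.log ((-z + 1) / 2)
        - (1 + z) * legendreFn lam z + logFlux lam z)
      + legendreFlux lam (-z) * (legendreFn lam z * Complex.log ((-z + 1) / 2) + logFn lam z))
    (fun z hz => ?_) hz⟩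
  have hp := hasDerivAt_legendreFn (lam := lam) hz.1
  have hv := hasDerivAt_legendreFlux (lam := lam) hz.1
  have hadd : HasDerivAt (fun z : ℂ => 1 + z) 1 z := by
    simpa using (hasDerivAt_id z).const_add 1
  have hl : HasDerivAt (fun z : ℂ => Complex.log ((-z + 1) / 2)) (-(-z + 1)⁻¹) z := by
    refine ((hasDerivAt_log_half hz.2).comp z (hasDerivAt_neg z)).congr_deriv ?_
    ring
  refine (((hasDerivAt_legendreFn_neg hz.2).mul (((hv.mul hl).sub (hadd.mul hp)).add
    (hasDerivAt_logFlux hz.1))).add ((hasDerivAt_legendreFlux_neg hz.2).mul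
      ((hp.mul hl).add (hasDerivAt_logFn hz.1)))).congr_deriv ?_
  have h1 := add_one_ne_zero_of_mem hz.1
  have h2 := add_one_ne_zero_of_mem hz.2
  simp only [legendreFlux, logFlux, Pi.mul_apply, Pi.add_apply, Pi.sub_apply]
  field_simp
  rw [logSource]
  ring

end Connection

/-! ### The behaviour of `P_ν` at `-1` -/

section Abel

variable (ν : ℂ)

lemma lam_mul_hypCoeff_div (k : ℕ) : ν * (ν + 1) * (hypCoeff ν k / ((k : ℂ) + 1))
    = k * hypCoeff ν k - (k + 1 : ℕ) * hypCoeff ν (k + 1) := by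
  have hk : (k : ℂ) + 1 ≠ 0 := by exact_mod_cast k.succ_ne_zero
  have := hypCoeff_succ ν k
  push_cast
  field_simp
  linear_combination this

lemma ofReal_one_sub_two_mul_mem {y : ℝ} (hy : y ∈ Set.Ioo (0 : ℝ) 1) :
    (1 : ℂ) - 2 * y ∈ Metric.ball (1 : ℂ) 2 := by
  rw [Metric.mem_ball, dist_eq_norm, sub_sub_cancel_left, norm_neg, norm_mul, Complex.norm_real,
    Real.norm_of_nonneg hy.1.le]
  norm_num; linarith [hy.2]

/-- `(1 - x²) P_ν'(x)` tends to `2 sin (πν) / π` as `x → -1`, where `x = 1 - 2 y`. -/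
lemma tendsto_legendreFlux : Tendsto (fun y : ℝ => legendreFlux (ν * (ν + 1)) (1 - 2 * y)) (𝓝[<] 1)
    (𝓝 (2 * (Complex.sin (Real.pi * ν) / Real.pi))) := by
  obtain ⟨B, hB⟩ := exists_bound_hypCoeff ν
  have hsum : Tendsto (fun n => ∑ k ∈ Finset.range n,
      ν * (ν + 1) * (hypCoeff ν k / ((k : ℂ) + 1))) atTop
      (𝓝 (Complex.sin (Real.pi * ν) / Real.pi)) := by
    have h := (tendsto_mul_hypCoeff ν).neg
    rw [neg_neg] at h
    refine h.congr fun n => ?_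
    simp only [lam_mul_hypCoeff_div]
    rw [Finset.sum_range_sub' (fun k : ℕ => (k : ℂ) * hypCoeff ν k)]
    simp
  have h1 := Complex.tendsto_tsum_powerSeries_nhdsWithin_lt hsum
  rw [tendsto_map'_iff] at h1
  have h2 : Tendsto (fun y : ℝ => 2 * (y : ℂ)) (𝓝[<] 1) (𝓝 2) :=
    ((by fun_prop : Continuous fun y : ℝ => 2 * (y : ℂ)).tendsto' 1 2 (by simp)).mono_left
      nhdsWithin_le_nhds
  refine (h2.mul h1).congr' ?_
  filter_upwards [Ioo_mem_nhdsLT (show (0 : ℝ) < 1 by norm_num)] with y hy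
  have hm := ofReal_one_sub_two_mul_mem hy
  rw [legendreFlux, avg_congr ((convex_ball (1 : ℂ) 2).starConvex (Metric.mem_ball_self two_pos))
    (legendreFn_eqOn_halfSeries ν) hm, avg_halfSeries hB hm, halfSeries]
  simp only [Function.comp_apply, mul_assoc, tsum_mul_left]
  rw [show (1 - (1 - 2 * (y : ℂ))) / 2 = y by ring]
  simp only [← mul_assoc]
  ring

/-- `P_ν` is at most logarithmic at `-1`. -/
lemma tendsto_one_sub_mul_legendreFn :
    Tendsto (fun y : ℝ => (1 - (y : ℂ)) * legendreFn (ν * (ν + 1)) (1 - 2 * y)) (𝓝[<] 1) (𝓝 0) := by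
  obtain ⟨B, hB⟩ := exists_bound_hypCoeff ν
  have hc : Tendsto (hypCoeff ν) atTop (𝓝 0) := by
    have h := (tendsto_mul_hypCoeff ν).mul (tendsto_inv_atTop_nhds_zero_nat (𝕜 := ℂ))
    rw [mul_zero] at h
    refine h.congr' ?_
    filter_upwards [eventually_gt_atTop 0] with k hk
    have : (k : ℂ) ≠ 0 := by exact_mod_cast hk.ne'
    field_simp
  -- the coefficients of `(1 - y) * ∑ c k * y ^ k`, whose partial sums are the `c k`
  set d : ℕ → ℂ := fun k => hypCoeff ν k - (if k = 0 then 0 else hypCoeff ν (k - 1)) with hd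
  have hpart : ∀ n, ∑ k ∈ Finset.range (n + 1), d k = hypCoeff ν n := by
    intro n
    induction n with
    | zero => simp [hd]
    | succ n ih => rw [Finset.sum_range_succ, ih]; simp [hd]
  have hsum : Tendsto (fun n => ∑ k ∈ Finset.range n, d k) atTop (𝓝 0) := by
    rw [← tendsto_add_atTop_iff_nat 1]
    simpa only [hpart] using hc
  have h1 := Complex.tendsto_tsum_powerSeries_nhdsWithin_lt hsum
  rw [tendsto_map'_iff] at h1
  refine h1.congr' ?_
  filter_upwards [Ioo_mem_nhdsLT (show (0 : ℝ) < 1 by norm_num)] with y hy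
  have hm := ofReal_one_sub_two_mul_mem hy
  have hs := summable_halfSeries hB hm
  have hs' : Summable fun k => hypCoeff ν k * (y : ℂ) ^ k := by
    simpa only [show (1 - (1 - 2 * (y : ℂ))) / 2 = y by ring] using hs
  rw [legendreFn_eqOn_halfSeries ν hm, halfSeries]
  simp only [Function.comp_apply, show (1 - (1 - 2 * (y : ℂ))) / 2 = y by ring]
  have hs1 := (summable_nat_add_iff 1).2 hs'
  have hs2 := hs'.mul_left (y : ℂ)
  have hterm : ∀ k, d (k + 1) * (y : ℂ) ^ (k + 1)
      = hypCoeff ν (k + 1) * (y : ℂ) ^ (k + 1) - y * (hypCoeff ν k * (y : ℂ) ^ k) := fun k => by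
    simp [hd, pow_succ]; ring
  have hs3 : Summable fun k => d k * (y : ℂ) ^ k := by
    rw [← summable_nat_add_iff 1]
    simpa only [hterm] using hs1.sub hs2
  rw [hs3.tsum_eq_zero_add]
  simp only [hterm]
  rw [hs1.tsum_sub hs2, tsum_mul_left]
  have := hs'.tsum_eq_zero_add
  simp only [hd, if_true, sub_zero, pow_zero, mul_one] at this ⊢
  linear_combination -this

lemma wronskian_neg_value :
    2 * (legendreFn (ν * (ν + 1)) 0 * legendreFlux (ν * (ν + 1)) 0)
      = 2 * (Complex.sin (Real.pi * ν) / Real.pi) := by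
  have hc : Tendsto (fun y : ℝ => (2 * (y : ℂ) - 1)) (𝓝[<] 1) (𝓝 1) :=
    ((by fun_prop : Continuous fun y : ℝ => 2 * (y : ℂ) - 1).tendsto' 1 1
      (by norm_num)).mono_left nhdsWithin_le_nhds
  have hp := ((hasDerivAt_legendreFn (lam := ν * (ν + 1)) one_mem_cutPlane).continuousAt.tendsto.comp
    hc)
  have ha := (((differentiableOn_avg_legendreFn (ν * (ν + 1))).differentiableAt
    (isOpen_cutPlane.mem_nhds one_mem_cutPlane)).continuousAt.tendsto.comp hc)
  rw [legendreFn_one] at hp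
  have hlim := (hp.mul (tendsto_legendreFlux ν)).add
    ((ha.const_mul (2 * (ν * (ν + 1)))).mul (tendsto_one_sub_mul_legendreFn ν))
  rw [one_mul, mul_zero, add_zero] at hlim
  refine tendsto_nhds_unique (tendsto_const_nhds.congr' ?_) hlim
  filter_upwards [Ioo_mem_nhdsLT (show (0 : ℝ) < 1 by norm_num)] with y hy
  have hm : (2 * (y : ℂ) - 1) ∈ doubleCut := by
    have := ofReal_mem_doubleCut (x := 2 * y - 1) (by linarith [hy.1]) (by linarith [hy.2])
    simpa using this
  rw [← wronskian_neg hm, neg_sub]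
  simp only [Function.comp_apply]
  rw [show legendreFlux (ν * (ν + 1)) (2 * (y : ℂ) - 1) = 2 * (ν * (ν + 1)) *
    avg (legendreFn (ν * (ν + 1))) (2 * y - 1) * (1 - y) by rw [legendreFlux]; ring]
  ring

end Abel

/-- The connection formula: the coefficient of the logarithmic solution in `P_ν(-z)` is
`sin (πν) / π`. The regular coefficient is not needed explicitly. -/
lemma exists_connection (ν : ℂ) : ∃ α, ∀ z ∈ doubleCut,
    legendreFn (ν * (ν + 1)) (-z) = α * legendreFn (ν * (ν + 1)) z
      + Complex.sin (Real.pi * ν) / Real.pi *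
        (legendreFn (ν * (ν + 1)) z * Complex.log ((1 - z) / 2) + logFn (ν * (ν + 1)) z) := by
  obtain ⟨A, hA⟩ := exists_wronskian_neg_log (ν * (ν + 1))
  refine ⟨-(A / 2), fun z hz => ?_⟩
  have h1 := wronskian_log (lam := ν * (ν + 1)) hz.1
  have h2 := (wronskian_neg (lam := ν * (ν + 1)) hz).trans (wronskian_neg_value ν)
  have h3 := hA z hz
  rw [show (1 - z) / 2 = (-z + 1) / 2 by ring]
  -- Cramer's rule for the fundamental system
  set ℓ := Complex.log ((-z + 1) / 2)
  linear_combination ((1 / 2) * legendreFn (ν * (ν + 1)) (-z)) * h1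
    + (1 / 2) * (legendreFn (ν * (ν + 1)) z * ℓ + logFn (ν * (ν + 1)) z) * h2
    - (1 / 2) * legendreFn (ν * (ν + 1)) z * h3

/-! ### Removing the singularity of the quotient at an integer degree -/

/-- The derivative at `c` of `(f x - f c) / (x - c)` is half the second derivative of `f`. -/
lemma hasDerivAt_dslope_self {f f' : ℂ → ℂ} {f₂ c : ℂ} (hf : ∀ x, HasDerivAt f (f' x) x)
    (h₂ : HasDerivAt f' f₂ c) : HasDerivAt (dslope f c) (f₂ / 2) c := by
  have hD : Differentiable ℂ (dslope f c) := by
    rw [← differentiableOn_univ, Complex.differentiableOn_dslope univ_mem]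
    exact fun x _ => (hf x).differentiableAt.differentiableWithinAt
  have hD' : Differentiable ℂ (deriv (dslope f c)) := by
    rw [← differentiableOn_univ] at hD ⊢
    exact hD.deriv isOpen_univ
  have hfe : f = fun x => f c + (x - c) * dslope f c x := by
    funext x
    have := sub_smul_dslope f c x
    rw [smul_eq_mul] at this
    rw [this]; ring
  have hsub : ∀ x, HasDerivAt (fun x => x - c) 1 x := fun x => (hasDerivAt_id x).sub_const c
  have hf'e : f' = fun x => dslope f c x + (x - c) * deriv (dslope f c) x := by
    funext x
    refine (hf x).unique ?_
    refine ((((hsub x).mul (hD x).hasDerivAt).const_add (f c)).congr_of_eventuallyEq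
      (Eventually.of_forall (congrFun hfe))).congr_deriv ?_
    ring
  have h3 : HasDerivAt f' (deriv (dslope f c) c + (1 * deriv (dslope f c) c
      + (c - c) * deriv (deriv (dslope f c)) c)) c := by
    rw [hf'e]
    exact (hD c).hasDerivAt.add ((hsub c).mul (hD' c).hasDerivAt)
  have h4 := h₂.unique h3
  refine (hD c).hasDerivAt.congr_deriv ?_
  rw [h4]; ring

lemma hasDerivAt_sin_pi_mul (ν : ℂ) : HasDerivAt (fun ν : ℂ => Complex.sin (Real.pi * ν))
    (Real.pi * Complex.cos (Real.pi * ν)) ν := by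
  refine (((hasDerivAt_id ν).const_mul (Real.pi : ℂ)).csin).congr_deriv ?_
  simp [mul_comm]

lemma sin_pi_mul_natCast (n : ℕ) : Complex.sin (Real.pi * (n : ℂ)) = 0 := by
  rw [mul_comm]; exact Complex.sin_nat_mul_pi n

lemma cos_pi_mul_natCast (n : ℕ) : Complex.cos (Real.pi * (n : ℂ)) = (-1) ^ n := by
  have h := Real.cos_nat_mul_pi n
  have h2 := congrArg (fun x : ℝ => (x : ℂ)) h
  push_cast at h2
  rw [mul_comm, h2]

lemma dslope_sin_natCast (n : ℕ) :
    dslope (fun ν : ℂ => Complex.sin (Real.pi * ν)) n n = Real.pi * (-1) ^ n := by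
  rw [dslope_same, (hasDerivAt_sin_pi_mul n).deriv, cos_pi_mul_natCast]

lemma hasDerivAt_dslope_sin (n : ℕ) :
    HasDerivAt (dslope (fun ν : ℂ => Complex.sin (Real.pi * ν)) n) 0 n := by
  have h2 : HasDerivAt (fun ν : ℂ => Real.pi * Complex.cos (Real.pi * ν)) 0 n := by
    refine ((((hasDerivAt_id (n : ℂ)).const_mul (Real.pi : ℂ)).ccos).const_mul
      (Real.pi : ℂ)).congr_deriv ?_
    simp [sin_pi_mul_natCast]
  simpa using hasDerivAt_dslope_self hasDerivAt_sin_pi_mul h2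

lemma pi_mul_neg_one_pow_ne_zero (n : ℕ) : (Real.pi : ℂ) * (-1) ^ n ≠ 0 :=
  mul_ne_zero (Complex.ofReal_ne_zero.2 Real.pi_ne_zero) (pow_ne_zero _ (by norm_num))

lemma eventually_sin_pi_mul_ne_zero (n : ℕ) :
    ∀ᶠ ν : ℂ in 𝓝 (n : ℂ), ν ≠ n → Complex.sin (Real.pi * ν) ≠ 0 := by
  have h := (hasDerivAt_dslope_sin n).continuousAt.eventually_ne
    (by rw [dslope_sin_natCast]; exact pi_mul_neg_one_pow_ne_zero n)
  filter_upwards [h] with ν hν hne h0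
  refine hν ?_
  have := sub_smul_dslope (fun ν : ℂ => Complex.sin (Real.pi * ν)) n ν
  simp only [smul_eq_mul, h0, sin_pi_mul_natCast, sub_zero] at this
  exact (mul_eq_zero.1 this).resolve_left (sub_ne_zero.2 hne)

/-- If the numerator vanishes at `n`, then numerator and `sin(πν)` may both be divided by `ν - n`;
the first two Taylor coefficients of the two quotients give the derivative. -/
lemma hasDerivAt_limUnder_div_sin {N N' : ℂ → ℂ} {N₂ : ℂ} (n : ℕ)
    (hN : ∀ ν, HasDerivAt N (N' ν) ν) (hN' : HasDerivAt N' N₂ n) (h0 : N n = 0) :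
    HasDerivAt (fun ν : ℂ => if Complex.sin (Real.pi * ν) = 0 then
        limUnder (𝓝[≠] ν) (fun μ => (Real.pi / 2 : ℂ) * N μ / Complex.sin (Real.pi * μ))
      else (Real.pi / 2 : ℂ) * N ν / Complex.sin (Real.pi * ν)) ((-1) ^ n * N₂ / 4) n := by
  set S := dslope (fun ν : ℂ => Complex.sin (Real.pi * ν)) n with hS
  set A := dslope N n with hA
  have hSn : S n = Real.pi * (-1) ^ n := dslope_sin_natCast n
  have hSn0 : S n ≠ 0 := by rw [hSn]; exact pi_mul_neg_one_pow_ne_zero n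
  have hG : HasDerivAt (fun ν => (Real.pi / 2 : ℂ) * A ν / S ν) ((-1) ^ n * N₂ / 4) n := by
    refine (((hasDerivAt_dslope_self hN hN').const_mul (Real.pi / 2 : ℂ)).div
      (hasDerivAt_dslope_sin n) hSn0).congr_deriv ?_
    rw [← hS, hSn]
    have hpi : (Real.pi : ℂ) ≠ 0 := Complex.ofReal_ne_zero.2 Real.pi_ne_zero
    have h1 : ((-1 : ℂ) ^ n) ≠ 0 := pow_ne_zero _ (by norm_num)
    have hn := neg_one_pow_mul_self n
    field_simp
    linear_combination (-4 * Real.pi * N₂ * (-1) ^ n) * hn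
  have heq : ∀ ν : ℂ, ν ≠ n → (Real.pi / 2 : ℂ) * N ν / Complex.sin (Real.pi * ν)
      = (Real.pi / 2 : ℂ) * A ν / S ν := by
    intro ν hν
    have h1 := sub_smul_dslope N n ν
    have h2 := sub_smul_dslope (fun ν : ℂ => Complex.sin (Real.pi * ν)) n ν
    simp only [smul_eq_mul, sin_pi_mul_natCast, sub_zero, h0] at h1 h2
    rw [← h1, ← h2, ← hA, ← hS, mul_left_comm]
    exact mul_div_mul_left _ _ (sub_ne_zero.2 hν)
  refine hG.congr_of_eventuallyEq ?_
  filter_upwards [eventually_sin_pi_mul_ne_zero n] with ν hν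
  by_cases hνn : ν = n
  · rw [hνn, if_pos (sin_pi_mul_natCast n)]
    refine (Tendsto.congr' ?_ (hG.continuousAt.tendsto.mono_left nhdsWithin_le_nhds)).limUnder_eq
    filter_upwards [self_mem_nhdsWithin] with μ hμ using (heq μ hμ).symm
  · rw [if_neg (hν hνn), heq ν hνn]

/-! ### The degree derivative off the real axis -/

/-- The exponent `c = ∓iπ` of the phase `exp(cν)` in the definition of `Q_ν`. It is also the
difference between the logarithms of `(1 - w) / 2` and `(w - 1) / 2`. -/
noncomputable def phaseExponent (w : ℂ) : ℂ :=
  if 0 < w.im then -(Complex.I * Real.pi) else Complex.I * Real.pi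

lemma phaseExponent_sq (w : ℂ) : phaseExponent w ^ 2 = -(Real.pi : ℂ) ^ 2 := by
  rw [phaseExponent]
  split_ifs <;> linear_combination ((Real.pi : ℂ) ^ 2) * Complex.I_sq

lemma exp_phaseExponent_mul (w ν : ℂ) : Complex.exp (phaseExponent w * ν) =
    Complex.cos (Real.pi * ν) + phaseExponent w / Real.pi * Complex.sin (Real.pi * ν) := by
  have hpi : (Real.pi : ℂ) ≠ 0 := Complex.ofReal_ne_zero.2 Real.pi_ne_zero
  rw [phaseExponent]
  split_ifs
  · rw [show -(Complex.I * Real.pi) * ν = -(Real.pi * ν) * Complex.I by ring, Complex.exp_mul_I,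
      Complex.cos_neg, Complex.sin_neg]
    field_simp
  · rw [show Complex.I * Real.pi * ν = (Real.pi * ν) * Complex.I by ring, Complex.exp_mul_I]
    field_simp

lemma exp_phaseExponent_mul_natCast (w : ℂ) (n : ℕ) :
    Complex.exp (phaseExponent w * n) = (-1) ^ n := by
  rw [exp_phaseExponent_mul, sin_pi_mul_natCast, cos_pi_mul_natCast, mul_zero, add_zero]

lemma legendreQuotient_eq (ν : ℂ) {w : ℂ} (hw : w.im ≠ 0) : legendreQuotient ν w =
    (Real.pi / 2 : ℂ) * (Complex.exp (phaseExponent w * ν) * legendreFn (ν * (ν + 1)) w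
      - legendreFn (ν * (ν + 1)) (-w)) / Complex.sin (Real.pi * ν) := by
  obtain ⟨h1, h2⟩ := mem_doubleCut_of_im_ne_zero hw
  rw [legendreQuotient, legendreP_eq ν h1, legendreP_eq ν h2, phaseExponent]
  split_ifs <;> simp only [neg_mul]

lemma log_one_sub_half {w : ℂ} (hw : w.im ≠ 0) :
    Complex.log ((1 - w) / 2) = Complex.log ((w - 1) / 2) + phaseExponent w := by
  have him : ((w - 1) / 2).im = w.im / 2 := by simp
  have hneg : (1 - w) / 2 = -((w - 1) / 2) := by ring
  rw [hneg, Complex.log, Complex.log, norm_neg, phaseExponent]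
  split_ifs with h
  · rw [Complex.arg_neg_eq_arg_sub_pi_of_im_pos (by rw [him]; linarith)]
    push_cast; ring
  · have : w.im < 0 := lt_of_le_of_ne (not_lt.1 h) hw
    rw [Complex.arg_neg_eq_arg_add_pi_of_im_neg (by rw [him]; linarith)]
    push_cast; ring

lemma hasDerivAt_mul_add_one (ν : ℂ) :
    HasDerivAt (fun ν : ℂ => ν * (ν + 1)) (2 * ν + 1) ν := by
  refine ((hasDerivAt_id ν).mul ((hasDerivAt_id ν).add_const 1)).congr_deriv ?_
  simp only [id]; ring

lemma hasDerivAt_legendreFn_degree {w : ℂ} (hw : w ∈ cutPlane) (ν : ℂ) :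
    HasDerivAt (fun ν : ℂ => legendreFn (ν * (ν + 1)) w)
      ((2 * ν + 1) * legendreFn₁ (ν * (ν + 1)) w) ν := by
  refine ((hasDerivAt_legendreFn_lam hw (ν * (ν + 1))).comp ν
    (hasDerivAt_mul_add_one ν)).congr_deriv ?_
  ring

lemma hasDerivAt_legendreFn₁_degree {w : ℂ} (hw : w ∈ cutPlane) (ν : ℂ) :
    HasDerivAt (fun ν : ℂ => (2 * ν + 1) * legendreFn₁ (ν * (ν + 1)) w)
      ((2 * ν + 1) ^ 2 * legendreFn₂ (ν * (ν + 1)) w + 2 * legendreFn₁ (ν * (ν + 1)) w) ν := by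
  have h1 : HasDerivAt (fun ν : ℂ => 2 * ν + 1) 2 ν := by
    simpa using ((hasDerivAt_id ν).const_mul (2 : ℂ)).add_const 1
  refine (h1.mul ((hasDerivAt_legendreFn₁_lam hw (ν * (ν + 1))).comp ν
    (hasDerivAt_mul_add_one ν))).congr_deriv ?_
  simp only [Function.comp]
  ring

lemma hasDerivAt_logFn_degree {w : ℂ} (hw : w ∈ cutPlane) (ν : ℂ) :
    HasDerivAt (fun ν : ℂ => logFn (ν * (ν + 1)) w)
      ((2 * ν + 1) * logFn₁ (ν * (ν + 1)) w) ν := by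
  refine ((hasDerivAt_logFn_lam hw (ν * (ν + 1))).comp ν
    (hasDerivAt_mul_add_one ν)).congr_deriv ?_
  ring

/-- The closed form of `∂Q_ν/∂ν` at `ν = n`. -/
noncomputable def legendreQDot (n : ℕ) (z : ℂ) : ℂ :=
  -legP n z * dilog ((1 - z) / 2)
    - 1 / 2 * legP n z * Complex.log ((z + 1) / 2) * Complex.log ((z - 1) / 2)
    + 1 / 4 * polyB n z * Complex.log ((z + 1) / 2)
    - (-1) ^ n / 4 * polyB n (-z) * Complex.log ((z - 1) / 2)
    - (Real.pi : ℂ) ^ 2 / 6 * legP n z + 1 / 4 * polyC n z - (-1) ^ n / 4 * polyC n (-z)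

/-- The multiple of `P_n` left open in `legendreDdot` cancels between `z` and `-z`, by the parity
of `P_n`. -/
lemma hasDerivAt_legendreQOffReal (n : ℕ) {w : ℂ} (hw : w.im ≠ 0) :
    HasDerivAt (fun ν => legendreQOffReal ν w) (legendreQDot n w) n := by
  obtain ⟨h1, h2⟩ := mem_doubleCut_of_im_ne_zero hw
  set c := phaseExponent w with hc
  set N : ℂ → ℂ := fun ν => Complex.exp (c * ν) * legendreFn (ν * (ν + 1)) w
      - legendreFn (ν * (ν + 1)) (-w) with hN
  have hexp : ∀ ν, HasDerivAt (fun ν : ℂ => Complex.exp (c * ν)) (c * Complex.exp (c * ν)) ν := by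
    intro ν
    refine ((hasDerivAt_id ν).const_mul c).cexp.congr_deriv ?_
    simp [mul_comm]
  have hd : ∀ ν, HasDerivAt N (c * Complex.exp (c * ν) * legendreFn (ν * (ν + 1)) w
      + Complex.exp (c * ν) * ((2 * ν + 1) * legendreFn₁ (ν * (ν + 1)) w)
      - (2 * ν + 1) * legendreFn₁ (ν * (ν + 1)) (-w)) ν := fun ν =>
    ((hexp ν).mul (hasDerivAt_legendreFn_degree h1 ν)).sub (hasDerivAt_legendreFn_degree h2 ν)
  have hd2 := ((((hexp n).const_mul c).mul (hasDerivAt_legendreFn_degree h1 n)).add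
    ((hexp n).mul (hasDerivAt_legendreFn₁_degree h1 n))).sub (hasDerivAt_legendreFn₁_degree h2 n)
  have hsq := neg_one_pow_mul_self n
  have hN0 : N n = 0 := by
    simp only [hN, hc, exp_phaseExponent_mul_natCast, legendreFn_natCast n h1,
      legendreFn_natCast n h2, legP_neg]
    ring
  have hfun : (fun ν => legendreQOffReal ν w) = fun ν : ℂ =>
      if Complex.sin (Real.pi * ν) = 0 then
        limUnder (𝓝[≠] ν) (fun μ => (Real.pi / 2 : ℂ) * N μ / Complex.sin (Real.pi * μ))
      else (Real.pi / 2 : ℂ) * N ν / Complex.sin (Real.pi * ν) := by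
    funext ν
    simp only [legendreQOffReal, legendreQuotient_eq _ hw, hN, hc]
  rw [hfun]
  refine (hasDerivAt_limUnder_div_sin n hd hd2 hN0).congr_deriv ?_
  rw [legendreFn₂_natCast n h1, legendreFn₂_natCast n h2, legendreFn₁_natCast n h1, hc,
    exp_phaseExponent_mul_natCast, legendreFn_natCast n h1, ← hc]
  have hlog := log_one_sub_half hw
  have hrefl := dilog_reflection (mem_doubleCut_of_im_ne_zero hw)
  have hc2 : c ^ 2 = -(Real.pi : ℂ) ^ 2 := phaseExponent_sq w
  rw [← hc] at hlog
  have hplus : (1 - -w) / 2 = (1 + w) / 2 := by ring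
  have hminus : (-w + 1) / 2 = (1 - w) / 2 := by ring
  have hcomm : (w + 1) / 2 = (1 + w) / 2 := by ring
  rw [legendreDdot, legendreDdot, legendreDot, legComb_coefR, legendreQDot, legP_neg, hplus, hminus,
    hcomm]
  rw [hlog] at hrefl ⊢
  generalize Complex.log ((1 + w) / 2) = L at *
  generalize Complex.log ((w - 1) / 2) = M at *
  generalize dilog ((1 + w) / 2) = D' at *
  generalize dilog ((1 - w) / 2) = D at *
  generalize polyB n (-w) = B' at *
  generalize polyB n w = B at *
  generalize legP n w = p at *
  generalize polyC n w = C at *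
  generalize polyC n (-w) = C' at *
  generalize polyC n 1 = C1 at *
  generalize (-1 : ℂ) ^ n = s at *
  linear_combination (c ^ 2 * p + 2 * c * p * L + c * s * B' - 2 * p * D + B * L + C
    + 2 * p * D') / 4 * hsq + p / 4 * hc2 + p / 2 * hrefl

/-! ### Continuation of the degree derivative to the real axis -/

/-- The solution `P_ν(w) ln((w - 1) / 2) + …` of Legendre's equation, with a logarithmic singularity
at `1` and no jump on `(1, ∞)`. -/
noncomputable def secondSol (ν w : ℂ) : ℂ :=
  legendreFn (ν * (ν + 1)) w * Complex.log ((w - 1) / 2) + logFn (ν * (ν + 1)) w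

/-- The degree derivative of `secondSol`. -/
noncomputable def secondSolDot (ν w : ℂ) : ℂ :=
  (2 * ν + 1) * legendreFn₁ (ν * (ν + 1)) w * Complex.log ((w - 1) / 2)
    + (2 * ν + 1) * logFn₁ (ν * (ν + 1)) w

lemma hasDerivAt_secondSol {w : ℂ} (hw : w ∈ cutPlane) (ν : ℂ) :
    HasDerivAt (fun ν => secondSol ν w) (secondSolDot ν w) ν :=
  ((hasDerivAt_legendreFn_degree hw ν).mul_const _).add (hasDerivAt_logFn_degree hw ν)

/-- The cotangent part of the phase and the coefficient in the connection formula combine to a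
coefficient that is the same in both half-planes. -/
lemma exists_legendreQuotient_eq {ν : ℂ} (hν : Complex.sin (Real.pi * ν) ≠ 0) :
    ∃ κ, ∀ w : ℂ, w.im ≠ 0 →
      legendreQuotient ν w = κ * legendreFn (ν * (ν + 1)) w - 1 / 2 * secondSol ν w := by
  obtain ⟨α, hα⟩ := exists_connection ν
  refine ⟨Real.pi / 2 * (Complex.cos (Real.pi * ν) - α) / Complex.sin (Real.pi * ν),
    fun w hw => ?_⟩
  have hpi : (Real.pi : ℂ) ≠ 0 := Complex.ofReal_ne_zero.2 Real.pi_ne_zero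
  rw [legendreQuotient_eq ν hw, hα w (mem_doubleCut_of_im_ne_zero hw), exp_phaseExponent_mul,
    log_one_sub_half hw, secondSol]
  field_simp
  ring

lemma ofReal_mem_closure_im_pos (x : ℝ) : (x : ℂ) ∈ closure {w : ℂ | 0 < w.im} := by
  rw [Complex.closure_setOfPred_lt_im]
  simp

instance neBot_nhdsWithin_im_pos (x : ℝ) : (𝓝[{w : ℂ | 0 < w.im}] (x : ℂ)).NeBot :=
  mem_closure_iff_nhdsWithin_neBot.1 (ofReal_mem_closure_im_pos x)

instance neBot_nhdsWithin_im_ne_zero (x : ℝ) : (𝓝[{w : ℂ | w.im ≠ 0}] (x : ℂ)).NeBot :=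
  (neBot_nhdsWithin_im_pos x).mono (nhdsWithin_mono _ fun _ hw => ne_of_gt hw)

lemma exists_im_ne_zero_legP_ne_zero (n : ℕ) : ∃ w : ℂ, w.im ≠ 0 ∧ legP n w ≠ 0 := by
  have h1 : ∀ᶠ w in 𝓝[{w : ℂ | w.im ≠ 0}] ((1 : ℝ) : ℂ), legP n w ≠ 0 :=
    nhdsWithin_le_nhds ((differentiable_legP n).continuous.continuousAt.eventually_ne
      (by rw [Complex.ofReal_one, legP_one]; exact one_ne_zero))
  obtain ⟨w, h, h'⟩ := (h1.and self_mem_nhdsWithin).exists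
  exact ⟨w, h', h⟩

/-- Two functions continuous at `a` that agree on a punctured neighbourhood agree at `a`. -/
lemma eq_of_continuousAt_of_eventually_eq {f g : ℂ → ℂ} {a : ℂ} (hf : ContinuousAt f a)
    (hg : ContinuousAt g a) (h : ∀ᶠ x in 𝓝[≠] a, f x = g x) : f a = g a :=
  tendsto_nhds_unique_of_eventuallyEq (hf.tendsto.mono_left nhdsWithin_le_nhds)
    (hg.tendsto.mono_left nhdsWithin_le_nhds) h

/-- Near `ν = n`, the coefficient of `P_ν` in `Q_ν` is a differentiable function of `ν`: it is
determined by the value at one point where `P_n` does not vanish. -/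
lemma exists_legendreQOffReal_eq (n : ℕ) : ∃ (K : ℂ → ℂ) (K' : ℂ), HasDerivAt K K' n ∧
    ∀ᶠ ν : ℂ in 𝓝 (n : ℂ), ∀ w : ℂ, w.im ≠ 0 →
      legendreQOffReal ν w = K ν * legendreFn (ν * (ν + 1)) w - 1 / 2 * secondSol ν w := by
  obtain ⟨w₀, him, hP⟩ := exists_im_ne_zero_legP_ne_zero n
  have hw₀ := mem_cutPlane_of_im_ne_zero him
  have hp₀ : legendreFn ((n : ℂ) * (n + 1)) w₀ ≠ 0 := by rwa [legendreFn_natCast n hw₀]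
  set K : ℂ → ℂ := fun ν =>
    (legendreQOffReal ν w₀ + 1 / 2 * secondSol ν w₀) / legendreFn (ν * (ν + 1)) w₀ with hK
  have hdK : HasDerivAt K _ n :=
    ((hasDerivAt_legendreQOffReal n him).add ((hasDerivAt_secondSol hw₀ n).const_mul
      (1 / 2 : ℂ))).div (hasDerivAt_legendreFn_degree hw₀ n) hp₀
  have hne : ∀ᶠ ν : ℂ in 𝓝 (n : ℂ), ν ≠ n → ∀ w : ℂ, w.im ≠ 0 →
      legendreQOffReal ν w = K ν * legendreFn (ν * (ν + 1)) w - 1 / 2 * secondSol ν w := by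
    filter_upwards [(hasDerivAt_legendreFn_degree hw₀ n).continuousAt.eventually_ne hp₀,
      eventually_sin_pi_mul_ne_zero n] with ν h1 h2 hνn w hw
    have hs := h2 hνn
    obtain ⟨κ, hκ⟩ := exists_legendreQuotient_eq hs
    have hκK : K ν = κ := by
      simp only [hK, legendreQOffReal, if_neg hs, hκ w₀ him]
      field_simp
      ring
    rw [legendreQOffReal, if_neg hs, hκ w hw, hκK]
  refine ⟨K, _, hdK, ?_⟩
  filter_upwards [hne] with ν hν w hw
  by_cases hνn : ν = n
  · rw [hνn]
    have hwc := mem_cutPlane_of_im_ne_zero hw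
    refine eq_of_continuousAt_of_eventually_eq (f := fun ν => legendreQOffReal ν w)
      (g := fun ν => K ν * legendreFn (ν * (ν + 1)) w - 1 / 2 * secondSol ν w)
      (hasDerivAt_legendreQOffReal n hw).continuousAt
      ((hdK.continuousAt.mul (hasDerivAt_legendreFn_degree hwc n).continuousAt).sub
        ((hasDerivAt_secondSol hwc n).continuousAt.const_mul _)) ?_
    rw [eventually_nhdsWithin_iff]
    filter_upwards [hne] with μ hμ hμn using hμ hμn w hw
  · exact hν hνn w hw

lemma half_sub_one_mem_slitPlane {x : ℝ} (hx : 1 < x) :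
    ((x : ℂ) - 1) / 2 ∈ Complex.slitPlane := by
  refine half_mem_slitPlane (Or.inl ?_)
  simpa using hx

lemma continuousAt_legendreFn {w : ℂ} (hw : w ∈ cutPlane) (lam : ℂ) :
    ContinuousAt (legendreFn lam) w :=
  ((differentiableOn_legendreFn lam).differentiableAt (isOpen_cutPlane.mem_nhds hw)).continuousAt

lemma continuousAt_legendreFn₁ {w : ℂ} (hw : w ∈ cutPlane) (lam : ℂ) :
    ContinuousAt (legendreFn₁ lam) w :=
  ((differentiableOn_legendreFn₁ lam).differentiableAt (isOpen_cutPlane.mem_nhds hw)).continuousAt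

lemma continuousAt_log_sub_one_half {x : ℝ} (hx : 1 < x) :
    ContinuousAt (fun w : ℂ => Complex.log ((w - 1) / 2)) x :=
  ContinuousAt.clog (by fun_prop) (half_sub_one_mem_slitPlane hx)

lemma continuousAt_secondSol {x : ℝ} (hx : 1 < x) (ν : ℂ) : ContinuousAt (secondSol ν) x := by
  have hw := mem_cutPlane_of_neg_one_lt (x := x) (by linarith)
  exact ((continuousAt_legendreFn hw _).mul (continuousAt_log_sub_one_half hx)).add
    ((differentiableOn_logFn _).differentiableAt (isOpen_cutPlane.mem_nhds hw)).continuousAt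

lemma continuousAt_secondSolDot {x : ℝ} (hx : 1 < x) (ν : ℂ) :
    ContinuousAt (secondSolDot ν) x := by
  have hw := mem_cutPlane_of_neg_one_lt (x := x) (by linarith)
  exact (((continuousAt_legendreFn₁ hw _).const_mul _).mul (continuousAt_log_sub_one_half hx)).add
    (((differentiableOn_logFn₁ _).differentiableAt
      (isOpen_cutPlane.mem_nhds hw)).continuousAt.const_mul _)

lemma continuous_polyB (n : ℕ) : Continuous (polyB n) := by
  have h := fun k => (differentiable_legP k).continuous
  unfold polyB
  fun_prop

lemma continuous_polyC (n : ℕ) : Continuous (polyC n) := by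
  have h := fun k => (differentiable_legP k).continuous
  unfold polyC
  fun_prop

lemma tendsto_legendreQDot {n : ℕ} {l : Filter ℂ} {z : ℂ} (hl : l ≤ 𝓝 z)
    (h1 : Tendsto (fun w => dilog ((1 - w) / 2)) l (𝓝 (dilog ((1 - z) / 2))))
    (h2 : Tendsto (fun w => Complex.log ((w + 1) / 2)) l (𝓝 (Complex.log ((z + 1) / 2))))
    (h3 : Tendsto (fun w => Complex.log ((w - 1) / 2)) l (𝓝 (Complex.log ((z - 1) / 2)))) :
    Tendsto (legendreQDot n) l (𝓝 (legendreQDot n z)) := by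
  have hP : Tendsto (legP n) l (𝓝 (legP n z)) :=
    ((differentiable_legP n).continuous.tendsto z).mono_left hl
  have hB : Tendsto (polyB n) l (𝓝 (polyB n z)) := ((continuous_polyB n).tendsto z).mono_left hl
  have hC : Tendsto (polyC n) l (𝓝 (polyC n z)) := ((continuous_polyC n).tendsto z).mono_left hl
  have hB' : Tendsto (fun w => polyB n (-w)) l (𝓝 (polyB n (-z))) :=
    (((continuous_polyB n).comp continuous_neg).tendsto z).mono_left hl
  have hC' : Tendsto (fun w => polyC n (-w)) l (𝓝 (polyC n (-z))) :=
    (((continuous_polyC n).comp continuous_neg).tendsto z).mono_left hl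
  exact ((((((hP.neg.mul h1).sub (((hP.const_mul _).mul h2).mul h3)).add
    ((hB.const_mul _).mul h2)).sub ((hB'.const_mul _).mul h3)).sub (hP.const_mul _)).add
    (hC.const_mul _)).sub (hC'.const_mul _)

/-- The degree derivative of the common representation of `Q_ν` in both half-planes is continuous
across `(1, ∞)`, and so is the closed formula with which it agrees off the real axis. -/
lemma hasDerivAt_legendreQ_of_one_lt (n : ℕ) {x : ℝ} (hx : 1 < x) :
    HasDerivAt (fun ν => legendreQ ν x) (legendreQDot n x) n := by
  obtain ⟨K, K', hK, hQ⟩ := exists_legendreQOffReal_eq n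
  have hxc := mem_cutPlane_of_neg_one_lt (x := x) (by linarith)
  set G : ℂ → ℂ → ℂ := fun ν w => K ν * legendreFn (ν * (ν + 1)) w - 1 / 2 * secondSol ν w with hG
  set G' : ℂ → ℂ := fun w => K' * legendreFn ((n : ℂ) * (n + 1)) w
    + K n * ((2 * n + 1) * legendreFn₁ ((n : ℂ) * (n + 1)) w) - 1 / 2 * secondSolDot n w with hG'
  have hGd : ∀ w ∈ cutPlane, HasDerivAt (fun ν => G ν w) (G' w) n := fun w hw =>
    (hK.mul (hasDerivAt_legendreFn_degree hw n)).sub ((hasDerivAt_secondSol hw n).const_mul _)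
  have hval : ∀ᶠ ν : ℂ in 𝓝 (n : ℂ), legendreQ ν x = G ν x := by
    filter_upwards [hQ] with ν hν
    rw [legendreQ, if_neg (by simp), if_pos (by simpa using hx)]
    have hc : ContinuousAt (G ν) x := ((continuousAt_legendreFn hxc _).const_mul _).sub
      ((continuousAt_secondSol hx ν).const_mul _)
    refine (Tendsto.congr' ?_ (hc.tendsto.mono_left nhdsWithin_le_nhds)).limUnder_eq
    filter_upwards [self_mem_nhdsWithin] with w hw using (hν w hw).symm
  have heq : G' x = legendreQDot n x := by
    refine tendsto_nhds_unique_of_eventuallyEq (l := 𝓝[{w : ℂ | w.im ≠ 0}] (x : ℂ)) (f := G')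
      (g := legendreQDot n) ?_ ?_ ?_
    · have hc : ContinuousAt G' x := (((continuousAt_legendreFn hxc _).const_mul _).add
        (((continuousAt_legendreFn₁ hxc _).const_mul _).const_mul _)).sub
        ((continuousAt_secondSolDot hx n).const_mul _)
      exact hc.tendsto.mono_left nhdsWithin_le_nhds
    · refine tendsto_legendreQDot nhdsWithin_le_nhds ?_ ?_ ?_
      · exact (hasDerivAt_dilog_half hxc).continuousAt.tendsto.mono_left nhdsWithin_le_nhds
      · exact (hasDerivAt_log_half hxc).continuousAt.tendsto.mono_left nhdsWithin_le_nhds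
      · exact (continuousAt_log_sub_one_half hx).tendsto.mono_left nhdsWithin_le_nhds
    · filter_upwards [self_mem_nhdsWithin] with w hw
      refine (hGd w (mem_cutPlane_of_im_ne_zero hw)).unique
        ((hasDerivAt_legendreQOffReal n hw).congr_of_eventuallyEq ?_)
      filter_upwards [hQ] with ν hν using (hν w hw).symm
  rw [← heq]
  exact (hGd x hxc).congr_of_eventuallyEq hval

lemma legendreQuotient_neg (ν : ℂ) {w : ℂ} (hw : 0 < w.im) : legendreQuotient ν w =
    -Complex.exp (-(Complex.I * Real.pi * ν)) * legendreQuotient ν (-w) := by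
  have h : ¬ 0 < (-w).im := by simp; linarith
  rw [legendreQuotient, legendreQuotient, if_pos hw, if_neg h, neg_neg]
  have he : Complex.exp (-(Complex.I * Real.pi * ν)) * Complex.exp (Complex.I * Real.pi * ν) = 1 := by
    rw [← Complex.exp_add, neg_add_cancel, Complex.exp_zero]
  generalize Complex.exp (-(Complex.I * Real.pi * ν)) = a at *
  generalize Complex.exp (Complex.I * Real.pi * ν) = b at *
  linear_combination (Real.pi / 2 / Complex.sin (Real.pi * ν) * legendreP ν (-w)) * he

lemma hasDerivAt_phase (ν : ℂ) :
    HasDerivAt (fun ν : ℂ => -Complex.exp (-(Complex.I * Real.pi * ν)))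
      (Complex.I * Real.pi * Complex.exp (-(Complex.I * Real.pi * ν))) ν := by
  refine (((hasDerivAt_id ν).const_mul (Complex.I * Real.pi)).neg.cexp.neg).congr_deriv ?_
  simp [mul_comm]

lemma eventually_legendreQOffReal_neg (n : ℕ) : ∀ᶠ ν : ℂ in 𝓝 (n : ℂ), ∀ w : ℂ, 0 < w.im →
    legendreQOffReal ν w =
      -Complex.exp (-(Complex.I * Real.pi * ν)) * legendreQOffReal ν (-w) := by
  have hne : ∀ᶠ ν : ℂ in 𝓝 (n : ℂ), ν ≠ n → ∀ w : ℂ, 0 < w.im → legendreQOffReal ν w =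
      -Complex.exp (-(Complex.I * Real.pi * ν)) * legendreQOffReal ν (-w) := by
    filter_upwards [eventually_sin_pi_mul_ne_zero n] with ν h2 hνn w hw
    rw [legendreQOffReal, legendreQOffReal, if_neg (h2 hνn), if_neg (h2 hνn),
      legendreQuotient_neg ν hw]
  filter_upwards [hne] with ν hν w hw
  by_cases hνn : ν = n
  · rw [hνn]
    refine eq_of_continuousAt_of_eventually_eq (f := fun ν => legendreQOffReal ν w)
      (g := fun ν => -Complex.exp (-(Complex.I * Real.pi * ν)) * legendreQOffReal ν (-w))
      (hasDerivAt_legendreQOffReal n hw.ne').continuousAt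
      ((hasDerivAt_phase n).continuousAt.mul (hasDerivAt_legendreQOffReal n (w := -w)
        (by simpa using hw.ne')).continuousAt) ?_
    rw [eventually_nhdsWithin_iff]
    filter_upwards [hne] with μ hμ hμn using hμ hμn w hw
  · exact hν hνn w hw

lemma tendsto_log_half_im_pos {x a : ℝ} (h : x + a < 0) :
    Tendsto (fun w : ℂ => Complex.log ((w + a) / 2)) (𝓝[{w : ℂ | 0 < w.im}] (x : ℂ))
      (𝓝 (Complex.log ((x + a) / 2))) := by
  have h0 : ((x : ℂ) + a) / 2 = (((x + a) / 2 : ℝ) : ℂ) := by push_cast; ring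
  have h1 := Complex.continuousWithinAt_log_of_re_neg_of_im_zero (z := ((x : ℂ) + a) / 2)
    (by rw [h0, Complex.ofReal_re]; linarith) (by rw [h0, Complex.ofReal_im])
  refine h1.tendsto.comp (tendsto_nhdsWithin_iff.2 ⟨?_, ?_⟩)
  · exact (Continuous.tendsto (by fun_prop : Continuous fun w : ℂ => (w + a) / 2) _).mono_left
      nhdsWithin_le_nhds
  · filter_upwards [self_mem_nhdsWithin] with w hw
    have hw' : 0 < w.im := hw
    simp
    linarith

/-- Continuity of `Li₂((1 - w) / 2)` at its cut from the upper half-plane, by Euler's reflection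
formula on both sides. -/
lemma tendsto_dilog_half_im_pos {x : ℝ} (hx : x < -1) :
    Tendsto (fun w : ℂ => dilog ((1 - w) / 2)) (𝓝[{w : ℂ | 0 < w.im}] (x : ℂ))
      (𝓝 (dilog ((1 - x) / 2))) := by
  have hxc : (((-x : ℝ)) : ℂ) ∈ cutPlane := mem_cutPlane_of_neg_one_lt (by linarith)
  have hxc' : -(x : ℂ) ∈ cutPlane := by simpa using hxc
  have hval : dilog ((1 - x) / 2) = (Real.pi : ℂ) ^ 2 / 6
      - Complex.log ((1 - x) / 2) * Complex.log ((x + (1 : ℝ)) / 2) - dilog ((1 - -(x : ℂ)) / 2) := by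
    have h := dilog_reflection_of_lt (x := (1 - x) / 2) (by linarith)
    have e1 : (((1 - x) / 2 : ℝ) : ℂ) = (1 - x) / 2 := by push_cast; ring
    have e2 : (1 : ℂ) - (1 - x) / 2 = (x + (1 : ℝ)) / 2 := by push_cast; ring
    have e3 : (1 - -(x : ℂ)) / 2 = (x + (1 : ℝ)) / 2 := by push_cast; ring
    rw [e1, e2] at h
    rw [e3]
    linear_combination h
  rw [hval]
  have h1 : Tendsto (fun w : ℂ => Complex.log ((1 - w) / 2)) (𝓝[{w : ℂ | 0 < w.im}] (x : ℂ))
      (𝓝 (Complex.log ((1 - x) / 2))) := by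
    have hc : ContinuousAt (fun w : ℂ => Complex.log ((1 - w) / 2)) x := by
      refine ContinuousAt.clog (by fun_prop) (half_mem_slitPlane (Or.inl ?_))
      simp; linarith
    exact hc.tendsto.mono_left nhdsWithin_le_nhds
  have h2 := tendsto_log_half_im_pos (x := x) (a := 1) (by linarith)
  have h3 : Tendsto (fun w : ℂ => dilog ((1 - -w) / 2)) (𝓝[{w : ℂ | 0 < w.im}] (x : ℂ))
      (𝓝 (dilog ((1 - -(x : ℂ)) / 2))) := by
    have hc : ContinuousAt (fun w : ℂ => dilog ((1 - -w) / 2)) x :=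
      (hasDerivAt_dilog_half hxc').continuousAt.comp (f := fun w : ℂ => -w) (by fun_prop)
    exact hc.tendsto.mono_left nhdsWithin_le_nhds
  refine (((h1.mul h2).const_sub ((Real.pi : ℂ) ^ 2 / 6)).sub h3).congr' ?_
  filter_upwards [self_mem_nhdsWithin] with w hw
  have h := dilog_reflection (mem_doubleCut_of_im_ne_zero (ne_of_gt hw))
  have e3 : (1 - -w) / 2 = (1 + w) / 2 := by ring
  have e4 : (w + (1 : ℝ)) / 2 = (1 + w) / 2 := by push_cast; ring
  rw [e3, e4]
  linear_combination -h

/-- On the cut, `Q_ν` is expressed through its values on `(1, ∞)` by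
`Q_ν(x + i0) = -exp(-iπν) Q_ν(-x)`. -/
lemma hasDerivAt_legendreQ_of_lt_neg_one (n : ℕ) {x : ℝ} (hx : x < -1) :
    HasDerivAt (fun ν => legendreQ ν x) (legendreQDot n x) n := by
  obtain ⟨K, K', hK, hQ⟩ := exists_legendreQOffReal_eq n
  have hx1 : 1 < -x := by linarith
  have hxc : -(x : ℂ) ∈ cutPlane := by
    have := mem_cutPlane_of_neg_one_lt (x := -x) (by linarith)
    simpa using this
  set G : ℂ → ℂ → ℂ := fun ν w => -Complex.exp (-(Complex.I * Real.pi * ν)) *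
    (K ν * legendreFn (ν * (ν + 1)) (-w) - 1 / 2 * secondSol ν (-w)) with hG
  set G' : ℂ → ℂ := fun w => Complex.I * Real.pi * Complex.exp (-(Complex.I * Real.pi * n)) *
      (K n * legendreFn ((n : ℂ) * (n + 1)) (-w) - 1 / 2 * secondSol n (-w))
    + -Complex.exp (-(Complex.I * Real.pi * n)) * (K' * legendreFn ((n : ℂ) * (n + 1)) (-w)
    + K n * ((2 * n + 1) * legendreFn₁ ((n : ℂ) * (n + 1)) (-w)) - 1 / 2 * secondSolDot n (-w))
    with hG'
  have hGd : ∀ w, -w ∈ cutPlane → HasDerivAt (fun ν => G ν w) (G' w) n := fun w hw =>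
    (hasDerivAt_phase n).mul
      ((hK.mul (hasDerivAt_legendreFn_degree hw n)).sub ((hasDerivAt_secondSol hw n).const_mul _))
  have hneg : ContinuousAt (fun w : ℂ => -w) (x : ℂ) := by fun_prop
  have hcs : ∀ ν, ContinuousAt (fun w => secondSol ν (-w)) (x : ℂ) := fun ν => by
    have h := continuousAt_secondSol hx1 ν
    rw [Complex.ofReal_neg] at h
    exact ContinuousAt.comp (f := fun w : ℂ => -w) h hneg
  have hcs' : ContinuousAt (fun w => secondSolDot n (-w)) (x : ℂ) := by
    have h := continuousAt_secondSolDot hx1 n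
    rw [Complex.ofReal_neg] at h
    exact ContinuousAt.comp (f := fun w : ℂ => -w) h hneg
  have hcl : ∀ lam, ContinuousAt (fun w => legendreFn lam (-w)) (x : ℂ) := fun lam =>
    ContinuousAt.comp (f := fun w : ℂ => -w) (continuousAt_legendreFn hxc lam) hneg
  have hcl' : ∀ lam, ContinuousAt (fun w => legendreFn₁ lam (-w)) (x : ℂ) := fun lam =>
    ContinuousAt.comp (f := fun w : ℂ => -w) (continuousAt_legendreFn₁ hxc lam) hneg
  have hoff : ∀ᶠ ν : ℂ in 𝓝 (n : ℂ), ∀ w : ℂ, 0 < w.im → legendreQOffReal ν w = G ν w := by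
    filter_upwards [hQ, eventually_legendreQOffReal_neg n] with ν h1 h2 w hw
    rw [h2 w hw, h1 (-w) (by simpa using hw.ne')]
  have hval : ∀ᶠ ν : ℂ in 𝓝 (n : ℂ), legendreQ ν x = G ν x := by
    filter_upwards [hoff] with ν hν
    rw [legendreQ, if_neg (by simp), if_neg (by rw [Complex.ofReal_re]; linarith)]
    have hc : ContinuousAt (G ν) x :=
      (((hcl _).const_mul _).sub ((hcs ν).const_mul _)).const_mul _
    refine (Tendsto.congr' ?_ (hc.tendsto.mono_left nhdsWithin_le_nhds)).limUnder_eq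
    filter_upwards [self_mem_nhdsWithin] with w hw using (hν w hw).symm
  have heq : G' x = legendreQDot n x := by
    refine tendsto_nhds_unique_of_eventuallyEq (l := 𝓝[{w : ℂ | 0 < w.im}] (x : ℂ)) (f := G')
      (g := legendreQDot n) ?_ ?_ ?_
    · have hc : ContinuousAt G' x :=
        ((((hcl _).const_mul _).sub ((hcs n).const_mul _)).const_mul _).add
        (((((hcl _).const_mul _).add (((hcl' _).const_mul _).const_mul _)).sub
          (hcs'.const_mul _)).const_mul _)
      exact hc.tendsto.mono_left nhdsWithin_le_nhds
    · refine tendsto_legendreQDot nhdsWithin_le_nhds (tendsto_dilog_half_im_pos hx) ?_ ?_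
      · have := tendsto_log_half_im_pos (x := x) (a := 1) (by linarith)
        simpa using this
      · have := tendsto_log_half_im_pos (x := x) (a := -1) (by linarith)
        simpa [sub_eq_add_neg] using this
    · filter_upwards [self_mem_nhdsWithin] with w hw
      have hw0 : w.im ≠ 0 := ne_of_gt hw
      refine (hGd w (mem_doubleCut_of_im_ne_zero hw0).2).unique
        ((hasDerivAt_legendreQOffReal n hw0).congr_of_eventuallyEq ?_)
      filter_upwards [hoff] with ν hν using (hν w hw).symm
  rw [← heq]
  exact (hGd x hxc).congr_of_eventuallyEq hval

end LegendreDegree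

theorem mainTheorem2 (n : ℕ) (z : ℂ) (hz : z ∉ (fun x : ℝ => (x : ℂ)) '' Set.Icc (-1) 1) :
    HasDerivAt (fun ν : ℂ => LegendreDegree.legendreQ ν z)
      (-LegendreDegree.legP n z * LegendreDegree.dilog ((1 - z) / 2)
        - 1 / 2 * LegendreDegree.legP n z * Complex.log ((z + 1) / 2) * Complex.log ((z - 1) / 2)
        + 1 / 4 * LegendreDegree.polyB n z * Complex.log ((z + 1) / 2)
        - (-1) ^ n / 4 * LegendreDegree.polyB n (-z) * Complex.log ((z - 1) / 2)
        - (Real.pi : ℂ) ^ 2 / 6 * LegendreDegree.legP n z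
        + 1 / 4 * LegendreDegree.polyC n z
        - (-1) ^ n / 4 * LegendreDegree.polyC n (-z))
      (n : ℂ) := by
  by_cases him : z.im = 0
  · obtain ⟨x, rfl⟩ : ∃ x : ℝ, (x : ℂ) = z := ⟨z.re, Complex.ext rfl (by simp [him])⟩
    rcases lt_or_ge 1 x with h1 | h1
    · exact LegendreDegree.hasDerivAt_legendreQ_of_one_lt n h1
    · have h2 : x < -1 := not_le.1 fun h => hz ⟨x, ⟨h, h1⟩, rfl⟩
      exact LegendreDegree.hasDerivAt_legendreQ_of_lt_neg_one n h2
  · have hfun : (fun ν : ℂ => LegendreDegree.legendreQ ν z) =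
        fun ν => LegendreDegree.legendreQOffReal ν z :=
      funext fun ν => by rw [LegendreDegree.legendreQ, if_pos him]
    rw [hfun]
    exact LegendreDegree.hasDerivAt_legendreQOffReal n him
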